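/- A metric boundedly finite measure space is a quadruple $(X,r,\rho,\mu)$, where $(X,r)$ is a complete separable metric space, $\rho\in X$ is a root, and $\mu$ is a Borel measure on $X$ that is finite on bounded sets. Two such spaces $(X,r,\rho,\mu)$ and $(X',r',\rho',\mu')$ are equivalent if there is an isometry $\phi$ from $\operatorname{supp}(\mu)\cup\{\rho\}$ onto $\operatorname{supp}(\mu')\cup\{\rho'\}$ with $\phi(\rho)=\rho'$ and $\phi_*\mu=\mu'$. Let $\mathbb{X}$ be the set of equivalence classes. For $R>0$ let $\mathcal{X}|_R=(X,r,\rho,\mu|_{\overline{B}(\rho,R)})$ be the restriction of $\mathcal X$ to the closed ball of radius $R$ around the root. If $\mu$ is finite and $m\in\mathbb{N}$, the $m$-point distance matrix distribution of $(X,r,\rho,\mu)$ is the image of $\mu^{\otimes m}$ under $(x_1,\dots,x_m)\mapsto (r(x_i,x_j))_{0\le i<j\le m}$, with $x_0:=\rho$. Finite measure spaces converge Gromov-weakly if, for each $m$, their $m$-point distance matrix distributions converge weakly. A sequence $(\mathcal{X}_n)$ in $\mathbb{X}$ converges Gromov-vaguely to $\mathcal{X}\in\mathbb{X}$ if $\mathcal{X}_n|_R\to\mathcal{X}|_R$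 Gromov-weakly for Lebesgue-almost all $R>0$. The Gromov-vague topology on $\mathbb{X}$ is the sequential topology of this convergence: $U$ is open if and only if every sequence that converges Gromov-vaguely to a point of $U$ is eventually in $U$. For finite measures on a metric space, let $d_{\mathrm{Pr}}(\mu,\mu')$ be the Prohorov distance, i.e. the infimum of the $\varepsilon>0$ such that $\mu(A)\le\mu'(A^\varepsilon)+\varepsilon$ and $\mu'(A)\le\mu(A^\varepsilon)+\varepsilon$ for all closed $A$, where $A^\varepsilon$ is the closed $\varepsilon$-neighbourhood of $A$. For metric finite measure spaces let $$d_{\mathrm{GP}}\big((X,r,\rho,\mu),(X',r',\rho',\mu')\big)=\inf_d\Big(d_{\mathrm{Pr}}^{(X\sqcup X',d)}(\mu,\mu')+d(\rho,\rho')\Big)$$ be the pointed Gromov--Prohorov distance, where the infimum is over all metrics $d$ on $X\sqcup X'$ that extend both $r$ and $r'$. **Proposition.** A sequence in $\mathbb{X}$ converges in the Gromov-vague topology if and only if it converges Gromov-vaguely (with the same limits), and $\mathbb{X}$ with the Gromov-vague topology is a Polish space. Moreover, for all $\mathcal{X},\mathcal{Y}\in\mathbb{X}$ the function $R\mapsto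 e^{-R}\big(1\wedge d_{\mathrm{GP}}(\mathcal{X}|_R,\mathcal{Y}|_R)\big)$ is integrable on $(0,\infty)$, and $$d_{\mathrm{GP}}^*(\mathcal{X},\mathcal{Y})=\int_0^\infty e^{-R}\big(1\wedge d_{\mathrm{GP}}(\mathcal{X}|_R,\mathcal{Y}|_R)\big)\,dR$$ is a well-defined complete metric on $\mathbb{X}$ that induces the Gromov-vague topology. -/

import Mathlib

open MeasureTheory Filter Topology

namespace GromovVague

/-- A pointed, complete, separable metric space carrying a boundedly finite Borel measure.
Separable metric spaces have at most continuum many points, so `Type` contains a copy of each. -/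
structure MMSpace where
  carrier : Type
  [metric : MetricSpace carrier]
  [complete : CompleteSpace carrier]
  [separable : TopologicalSpace.SeparableSpace carrier]
  [measurable : MeasurableSpace carrier]
  [borel : BorelSpace carrier]
  root : carrier
  measure : Measure carrier
  boundedlyFinite : ∀ s : Set carrier, Bornology.IsBounded s → measure s < ⊤

namespace MMSpace

attribute [instance] MMSpace.metric MMSpace.complete MMSpace.separable MMSpace.measurable
  MMSpace.borel

/-- The set `supp μ ∪ {ρ}`. -/
def core (X : MMSpace) : Set X.carrier := X.measure.support ∪ {X.root}

/-- The root as a point of the core. -/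
def coreRoot (X : MMSpace) : X.core := ⟨X.root, Or.inr rfl⟩

/-- The measure, viewed as a measure on the core. -/
noncomputable def coreMeasure (X : MMSpace) : Measure X.core :=
  X.measure.comap Subtype.val

/-- Two spaces are equivalent if there is a root-preserving, measure-preserving isometry between
`supp μ ∪ {ρ}` and `supp μ' ∪ {ρ'}`. -/
def Equivalent (X Y : MMSpace) : Prop :=
  ∃ φ : X.core ≃ᵢ Y.core, φ X.coreRoot = Y.coreRoot ∧
    X.coreMeasure.map φ = Y.coreMeasure

theorem equivalent_equivalence : Equivalence Equivalent where
  refl X := ⟨IsometryEquiv.refl _, rfl, Measure.map_id⟩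
  symm := by
    rintro X Y ⟨φ, h1, h2⟩
    refine ⟨φ.symm, by rw [← h1, φ.symm_apply_apply], ?_⟩
    rw [← h2, Measure.map_map φ.symm.continuous.measurable φ.continuous.measurable]
    have : (φ.symm ∘ φ : X.core → X.core) = id := by
      funext x; simp
    rw [this, Measure.map_id]
  trans := by
    rintro X Y Z ⟨φ, h1, h2⟩ ⟨ψ, h3, h4⟩
    refine ⟨φ.trans ψ, by rw [IsometryEquiv.trans_apply, h1, h3], ?_⟩
    rw [← h4, ← h2, Measure.map_map ψ.continuous.measurable φ.continuous.measurable]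
    rfl

instance setoid : Setoid MMSpace := ⟨Equivalent, equivalent_equivalence⟩

/-- The restriction `X|_R`: the measure is restricted to the closed ball of radius `R` around
the root. -/
noncomputable def restrict (X : MMSpace) (R : ℝ) : MMSpace where
  carrier := X.carrier
  root := X.root
  measure := X.measure.restrict (Metric.closedBall X.root R)
  boundedlyFinite := fun s hs => lt_of_le_of_lt (Measure.restrict_apply_le _ s) (X.boundedlyFinite s hs)

instance restrict_isFiniteMeasure (X : MMSpace) (R : ℝ) :
    IsFiniteMeasure (X.restrict R).measure :=
  ⟨by
    change X.measure.restrict (Metric.closedBall X.root R) Set.univ < ⊤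
    rw [Measure.restrict_apply_univ]
    exact X.boundedlyFinite _ Metric.isBounded_closedBall⟩

/-- The index set of the pairs `0 ≤ i < j ≤ m`. -/
abbrev Pairs (m : ℕ) : Type := {p : Fin (m + 1) × Fin (m + 1) // p.1 < p.2}

/-- The distances `r(x_i, x_j)`, `0 ≤ i < j ≤ m`, where `x_0` is the root. -/
def distMatrix (X : MMSpace) (m : ℕ) (x : Fin m → X.carrier) : Pairs m → NNReal :=
  fun p => nndist ((Fin.cons X.root x : Fin (m + 1) → X.carrier) p.1.1)
    ((Fin.cons X.root x : Fin (m + 1) → X.carrier) p.1.2)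

/-- The `m`-point distance matrix distribution of a metric finite measure space. -/
noncomputable def distMatrixLaw (X : MMSpace) [IsFiniteMeasure X.measure] (m : ℕ) :
    FiniteMeasure (Pairs m → NNReal) :=
  ⟨(Measure.pi fun _ : Fin m => X.measure).map (X.distMatrix m), inferInstance⟩

/-- Gromov-weak convergence of a sequence of metric finite measure spaces: weak convergence of all
distance matrix distributions. -/
def GromovWeakTendsto (X : ℕ → MMSpace) (Y : MMSpace) [∀ n, IsFiniteMeasure (X n).measure]
    [IsFiniteMeasure Y.measure] : Prop :=
  ∀ m : ℕ, Tendsto (fun n => (X n).distMatrixLaw m) atTop (𝓝 (Y.distMatrixLaw m))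

/-- Gromov-vague convergence: the restrictions to the closed balls of radius `R` around the roots
converge Gromov-weakly, for Lebesgue-almost all `R > 0`. -/
def GromovVagueTendsto (X : ℕ → MMSpace) (Y : MMSpace) : Prop :=
  ∀ᵐ R ∂(volume.restrict (Set.Ioi (0 : ℝ))),
    GromovWeakTendsto (fun n => (X n).restrict R) (Y.restrict R)

end MMSpace

/-- The space of equivalence classes of metric boundedly finite measure spaces. -/
def MMClass : Type 1 := Quotient MMSpace.setoid

/-- The equivalence class of a space. -/
def MMSpace.toClass (X : MMSpace) : MMClass := Quotient.mk MMSpace.setoid X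

/-- The Gromov-vague topology, i.e. the sequential topology of Gromov-vague convergence: a set `U`
is open if every sequence that converges Gromov-vaguely to a point of `U` is eventually in `U`. -/
instance gromovVagueTopology : TopologicalSpace MMClass where
  IsOpen U := ∀ (X : ℕ → MMSpace) (Y : MMSpace), MMSpace.GromovVagueTendsto X Y →
    Y.toClass ∈ U → ∀ᶠ n in atTop, (X n).toClass ∈ U
  isOpen_univ := fun _ _ _ _ => Eventually.of_forall fun _ => trivial
  isOpen_inter := fun _ _ hs ht X Y h hY => (hs X Y h hY.1).and (ht X Y h hY.2)
  isOpen_sUnion := by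
    rintro S hS X Y h ⟨U, hU, hY⟩
    exact (hS U hU X Y h hY).mono fun n hn => ⟨U, hU, hn⟩

/-- The Prohorov distance of two finite Borel measures on a metric space; `Metric.cthickening ε A`
is the closed `ε`-neighbourhood of `A`. -/
noncomputable def prohorovDist {Z : Type} [MetricSpace Z] [MeasurableSpace Z]
    (μ ν : Measure Z) : ℝ :=
  sInf {ε : ℝ | 0 < ε ∧ ∀ A : Set Z, IsClosed A →
    μ A ≤ ν (Metric.cthickening ε A) + ENNReal.ofReal ε ∧
    ν A ≤ μ (Metric.cthickening ε A) + ENNReal.ofReal ε}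

namespace MMSpace

/-- The metrics on the disjoint union that extend the metrics of both spaces. As both spaces are
complete, they are clopen for each such metric, whose Borel sets are therefore the measurable sets
of the sum. -/
def SumMetric (X Y : MMSpace) : Type :=
  {d : MetricSpace (X.carrier ⊕ Y.carrier) //
    (∀ x x' : X.carrier, d.dist (Sum.inl x) (Sum.inl x') = dist x x') ∧
    (∀ y y' : Y.carrier, d.dist (Sum.inr y) (Sum.inr y') = dist y y')}

/-- The pointed Gromov-Prohorov distance of two metric finite measure spaces: the infimum of
`d_Pr(μ, μ') + d(ρ, ρ')` over all metrics `d` on the disjoint union that extend both metrics. -/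
noncomputable def gromovProhorovDist (X Y : MMSpace) : ℝ :=
  ⨅ d : SumMetric X Y,
    @prohorovDist (X.carrier ⊕ Y.carrier) d.1 inferInstance
        (X.measure.map Sum.inl) (Y.measure.map Sum.inr) +
      d.1.dist (Sum.inl X.root) (Sum.inr Y.root)

/-- The integrand `e^{-R} (1 ∧ d_GP(X|_R, Y|_R))`. -/
noncomputable def localizedIntegrand (X Y : MMSpace) (R : ℝ) : ℝ :=
  Real.exp (-R) * min 1 (gromovProhorovDist (X.restrict R) (Y.restrict R))

/-- The localized Gromov-Prohorov distance. -/
noncomputable def localizedGromovProhorovDist (X Y : MMSpace) : ℝ :=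
  ∫ R in Set.Ioi (0 : ℝ), localizedIntegrand X Y R

end MMSpace

end GromovVague

/-!
All comparisons of two spaces are phrased through cross distances `D : X → Y → ℝ`, which are the
metrics on the disjoint union up to positivity (`IsCross`), and through the two inequalities of the
Prohorov distance relative to `D` (`ProhorovClose`). Composition of cross distances gives the
triangle inequality for the Gromov-Prohorov distance, hence for the localized distance `d*`. The
integrand of `d*` is measurable since the restriction to a ball depends on the radius, in the
Gromov-Prohorov distance, only through the mass of the ball, which is monotone. If `d*` vanishes,
there are cross distances on larger and larger balls that are almost optimal, and their limit along
an ultrafilter identifies the two spaces (`equivalent_of_localizedGromovProhorovDist_eq_zero`).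

The link between `d*` and Gromov-vague convergence are the integrals of Lipschitz functions with
bounded support of the distance matrix of the root and finitely many points (`TestConvergence`).
A small value of `d*` provides a radius of the size wanted at which the restrictions are close, so
`d* → 0` implies convergence of the test integrals, and these give Gromov-weak convergence at each
radius whose sphere has no mass in the limit. Conversely, suppose that finite measures converge
Gromov-weakly. Choose finitely many points in the support of the limit whose small balls carry
almost all of the mass. The approximating spaces contain points with almost the same distances,
around which unions of balls have almost the same masses
(`GromovWeakTendsto.eventually_exists_points`): polynomials in these masses are integrals
over further sampled points, so Weierstrass approximation reduces the claim to distance matrices.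
Gluing along such points bounds the Gromov-Prohorov distance, and dominated convergence yields
`d* → 0`. Thus `d* → 0` if and only if the sequence converges Gromov-vaguely
(`tendsto_localizedGromovProhorovDist_iff`), and the metric topology is the sequential topology of
Gromov-vague convergence.

For completeness, the spaces of a rapidly Cauchy sequence are embedded into one complete separable
space by successive gluing. The images of the measures are Cauchy against Lipschitz functions with
bounded support, which makes their cutoffs tight; by Prokhorov's theorem they converge to a
boundedly finite measure (`exists_limit_measure`), and the test integrals converge as well.
Separability holds since the test functions have a countable dense subset, so that countably many
test integrals embed the space into a countable product of lines.
-/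

namespace GromovVague

/-! ### Cross distances and Prohorov closeness -/

/-- A function `D : α → β → ℝ` that gives the distances between the two parts of a pseudometric on
the disjoint union of `α` and `β` extending the given ones. -/
structure IsCross {α β : Type*} [PseudoMetricSpace α] [PseudoMetricSpace β]
    (D : α → β → ℝ) : Prop where
  left_triangle : ∀ x x' y, D x y ≤ dist x x' + D x' y
  right_triangle : ∀ x y y', D x y ≤ D x y' + dist y' y
  dist_left_le : ∀ x x' y, dist x x' ≤ D x y + D x' y
  dist_right_le : ∀ x y y', dist y y' ≤ D x y + D x y'

/-- The points of `β` at cross distance less than `a` from `A ⊆ α`. -/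
def crossNhd {α β : Type*} (D : α → β → ℝ) (A : Set α) (a : ℝ) : Set β :=
  {y | ∃ x ∈ A, D x y < a}

/-- The two inequalities of the Prohorov distance for measures on two spaces that are joined by a
cross distance, with open neighbourhoods and arbitrary sets. -/
structure ProhorovClose {α β : Type*} [MeasurableSpace α] [MeasurableSpace β]
    (μ : Measure α) (ν : Measure β) (D : α → β → ℝ) (a : ℝ) : Prop where
  left : ∀ A : Set α, μ A ≤ ν (crossNhd D A a) + ENNReal.ofReal a
  right : ∀ B : Set β, ν B ≤ μ (crossNhd (flip D) B a) + ENNReal.ofReal a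

namespace IsCross

variable {α β γ : Type*} [PseudoMetricSpace α] [PseudoMetricSpace β] [PseudoMetricSpace γ]
  {D : α → β → ℝ} {E : β → γ → ℝ}

theorem nonneg (h : IsCross D) (x : α) (y : β) : 0 ≤ D x y := by
  have := h.dist_left_le x x y
  rw [dist_self] at this
  linarith

theorem symm (h : IsCross D) : IsCross (flip D) where
  left_triangle x x' y := by
    have := h.right_triangle y x x'
    rw [dist_comm] at this
    simp only [flip]; linarith
  right_triangle x y y' := by
    have := h.left_triangle y y' x
    rw [dist_comm] at this
    simp only [flip]; linarith
  dist_left_le x x' y := h.dist_right_le y x x'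
  dist_right_le x y y' := h.dist_left_le y y' x

theorem add_const (h : IsCross D) {δ : ℝ} (hδ : 0 ≤ δ) : IsCross fun x y => D x y + δ where
  left_triangle x x' y := by linarith [h.left_triangle x x' y]
  right_triangle x y y' := by linarith [h.right_triangle x y y']
  dist_left_le x x' y := by linarith [h.dist_left_le x x' y]
  dist_right_le x y y' := by linarith [h.dist_right_le x y y']

theorem abs_sub_le_left (h : IsCross D) (x x' : α) (y : β) : |D x y - D x' y| ≤ dist x x' := by
  rw [abs_le]
  have h1 := h.left_triangle x x' y
  have h2 := h.left_triangle x' x y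
  rw [dist_comm] at h2
  constructor <;> linarith

theorem abs_sub_le_right (h : IsCross D) (x : α) (y y' : β) : |D x y - D x y'| ≤ dist y y' :=
  h.symm.abs_sub_le_left y y' x

theorem continuous_right (h : IsCross D) (x : α) : Continuous (D x) := by
  refine (LipschitzWith.of_dist_le_mul (K := 1) fun y y' => ?_).continuous
  simpa [Real.dist_eq] using h.abs_sub_le_right x y y'

theorem isOpen_crossNhd (h : IsCross D) (A : Set α) (a : ℝ) : IsOpen (crossNhd D A a) := by
  have : crossNhd D A a = ⋃ x ∈ A, {y | D x y < a} := by
    ext y; simp [crossNhd]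
  rw [this]
  exact isOpen_biUnion fun x _ => isOpen_lt (h.continuous_right x) continuous_const

theorem _root_.PseudoMetricSpace.isCross_dist : IsCross (fun x y : α => dist x y) where
  left_triangle _ _ _ := dist_triangle _ _ _
  right_triangle _ _ _ := dist_triangle _ _ _
  dist_left_le _ _ _ := dist_triangle_right _ _ _
  dist_right_le _ _ _ := dist_triangle_left _ _ _

/-- The cross distance obtained by passing through a middle space. -/
noncomputable def comp (D : α → β → ℝ) (E : β → γ → ℝ) : α → γ → ℝ :=
  fun x z => ⨅ y, (D x y + E y z)

theorem bddBelow_comp (hD : IsCross D) (hE : IsCross E) (x : α) (z : γ) :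
    BddBelow (Set.range fun y => D x y + E y z) :=
  ⟨0, by rintro _ ⟨y, rfl⟩; exact add_nonneg (hD.nonneg _ _) (hE.nonneg _ _)⟩

theorem comp_le (hD : IsCross D) (hE : IsCross E) (x : α) (y : β) (z : γ) :
    comp D E x z ≤ D x y + E y z :=
  ciInf_le (hD.bddBelow_comp hE x z) y

theorem isCross_comp [Nonempty β] (hD : IsCross D) (hE : IsCross E) : IsCross (comp D E) where
  left_triangle x x' z := by
    rw [← sub_le_iff_le_add']
    refine le_ciInf fun y => ?_
    linarith [hD.comp_le hE x y z, hD.left_triangle x x' y]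
  right_triangle x z z' := by
    rw [← sub_le_iff_le_add]
    refine le_ciInf fun y => ?_
    linarith [hD.comp_le hE x y z, hE.right_triangle y z z']
  dist_left_le x x' z := by
    rw [← sub_le_iff_le_add']
    refine le_ciInf fun y' => ?_
    rw [sub_le_comm]
    refine le_ciInf fun y => ?_
    have h1 := hD.dist_left_le x x' y
    have h2 := hD.right_triangle x' y y'
    have h3 := hE.dist_left_le y y' z
    rw [dist_comm] at h3
    linarith
  dist_right_le x z z' := by
    rw [← sub_le_iff_le_add']
    refine le_ciInf fun y' => ?_
    rw [sub_le_comm]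
    refine le_ciInf fun y => ?_
    have h1 := hE.dist_right_le y' z z'
    have h2 := hE.left_triangle y' y z
    have h3 := hD.dist_right_le x y' y
    linarith

end IsCross

namespace ProhorovClose

variable {α β γ : Type*} [MeasurableSpace α] [MeasurableSpace β] [MeasurableSpace γ]
  {μ : Measure α} {ν : Measure β} {κ : Measure γ} {D : α → β → ℝ} {a b : ℝ}

theorem symm (h : ProhorovClose μ ν D a) : ProhorovClose ν μ (flip D) a :=
  ⟨h.right, h.left⟩

theorem mono {D' : α → β → ℝ} (h : ProhorovClose μ ν D a)
    (hD : ∀ x y, D x y < a → D' x y < b) (hab : a ≤ b) : ProhorovClose μ ν D' b where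
  left A := (h.left A).trans <| add_le_add
    (measure_mono fun _ ⟨x, hx, hxy⟩ => ⟨x, hx, hD _ _ hxy⟩) (ENNReal.ofReal_le_ofReal hab)
  right B := (h.right B).trans <| add_le_add
    (measure_mono fun _ ⟨x, hx, hxy⟩ => ⟨x, hx, hD _ _ hxy⟩) (ENNReal.ofReal_le_ofReal hab)

theorem comp [PseudoMetricSpace α] [PseudoMetricSpace β] [PseudoMetricSpace γ]
    {E : β → γ → ℝ} (h : ProhorovClose μ ν D a) (h' : ProhorovClose ν κ E b)
    (hD : IsCross D) (hE : IsCross E) (ha : 0 ≤ a) (hb : 0 ≤ b) :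
    ProhorovClose μ κ (IsCross.comp D E) (a + b) where
  left A := by
    refine (h.left A).trans ?_
    rw [ENNReal.ofReal_add ha hb, add_comm (ENNReal.ofReal a), ← add_assoc]
    refine add_le_add_left ((h'.left _).trans (add_le_add_left (measure_mono ?_) _)) _
    rintro z ⟨y, ⟨x, hx, hxy⟩, hyz⟩
    exact ⟨x, hx, (hD.comp_le hE x y z).trans_lt (add_lt_add hxy hyz)⟩
  right B := by
    refine (h'.right B).trans ?_
    rw [ENNReal.ofReal_add ha hb, ← add_assoc]
    refine add_le_add_left ((h.right _).trans (add_le_add_left (measure_mono ?_) _)) _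
    rintro x ⟨y, ⟨z, hz, hyz⟩, hxy⟩
    exact ⟨z, hz, (hD.comp_le hE x y z).trans_lt (add_lt_add hxy hyz)⟩

/-- One of the two Prohorov inequalities implies the other when the total masses are comparable:
apply it to the complement of a neighbourhood. -/
theorem of_left [PseudoMetricSpace α] [PseudoMetricSpace β] [OpensMeasurableSpace β]
    [OpensMeasurableSpace α] [IsFiniteMeasure μ] (hD : IsCross D)
    (hb : 0 ≤ b) {c : ℝ} (hc : 0 ≤ c)
    (h : ∀ A : Set α, μ A ≤ ν (crossNhd D A a) + ENNReal.ofReal b)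
    (hm : ν Set.univ ≤ μ Set.univ + ENNReal.ofReal c) (hbc : b + c ≤ a) :
    ProhorovClose μ ν D a where
  left A := (h A).trans <| by gcongr; linarith
  right B := by
    set C := crossNhd (flip D) B a with hC
    have hCm : MeasurableSet C := (hD.symm.isOpen_crossNhd B a).measurableSet
    set N := crossNhd D Cᶜ a with hN
    have hNm : MeasurableSet N := (hD.isOpen_crossNhd _ a).measurableSet
    have hBN : B ⊆ Nᶜ := fun y hy ⟨x, hx, hxy⟩ => hx ⟨y, hy, hxy⟩
    have h1 := h Cᶜ
    have h2 : ν B + μ Cᶜ ≤ μ C + ENNReal.ofReal a + μ Cᶜ := by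
      calc ν B + μ Cᶜ ≤ ν Nᶜ + (ν N + ENNReal.ofReal b) := add_le_add (measure_mono hBN) h1
        _ = ν Set.univ + ENNReal.ofReal b := by
          rw [← add_assoc, add_comm (ν Nᶜ), measure_add_measure_compl hNm]
        _ ≤ μ Set.univ + ENNReal.ofReal c + ENNReal.ofReal b := by gcongr
        _ = μ C + μ Cᶜ + ENNReal.ofReal (b + c) := by
          rw [measure_add_measure_compl hCm, ENNReal.ofReal_add hb hc]; ring
        _ ≤ μ C + μ Cᶜ + ENNReal.ofReal a := by gcongr
        _ = _ := by ring
    exact (ENNReal.add_le_add_iff_right (measure_ne_top μ _)).1 h2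

theorem measure_univ_le (h : ProhorovClose μ ν D a) :
    μ Set.univ ≤ ν Set.univ + ENNReal.ofReal a :=
  (h.left _).trans (by gcongr; exact Set.subset_univ _)

end ProhorovClose

/-! ### The Gromov-Prohorov distance through cross distances -/

namespace MMSpace

/-- A positive cross distance gives a metric on the disjoint union. -/
def sumMetricOfCross {X Y : MMSpace} {D : X.carrier → Y.carrier → ℝ} (hD : IsCross D)
    (hpos : ∀ x y, 0 < D x y) : SumMetric X Y :=
  ⟨{ dist := fun
        | .inl x, .inl x' => dist x x'
        | .inl x, .inr y => D x y
        | .inr y, .inl x => D x y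
        | .inr y, .inr y' => dist y y'
     dist_self := by rintro (x | x) <;> exact dist_self x
     dist_comm := by rintro (x | x) (y | y) <;> first | exact dist_comm x y | rfl
     dist_triangle := by
        rintro (x | x) (y | y) (z | z)
        · exact dist_triangle _ _ _
        · exact hD.left_triangle _ _ _
        · exact hD.dist_left_le _ _ _
        · exact hD.right_triangle _ _ _
        · have := hD.left_triangle z y x
          rw [dist_comm] at this
          exact this.trans_eq (add_comm _ _)
        · exact hD.dist_right_le _ _ _
        · have := hD.right_triangle z x y
          rw [dist_comm] at this
          exact this.trans_eq (add_comm _ _)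
        · exact dist_triangle _ _ _
     eq_of_dist_eq_zero := by
        rintro (x | x) (y | y) h
        · exact congrArg _ (dist_eq_zero.1 h)
        · exact absurd h (hpos x y).ne'
        · exact absurd h (hpos y x).ne'
        · exact congrArg _ (dist_eq_zero.1 h) },
    fun _ _ => rfl, fun _ _ => rfl⟩

theorem isCross_root (X Y : MMSpace) :
    IsCross fun (x : X.carrier) (y : Y.carrier) => dist x X.root + dist Y.root y where
  left_triangle x x' y := by linarith [dist_triangle x x' X.root]
  right_triangle x y y' := by linarith [dist_triangle Y.root y' y]
  dist_left_le x x' y := by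
    linarith [dist_triangle_right x x' X.root, dist_nonneg (x := Y.root) (y := y)]
  dist_right_le x y y' := by
    linarith [dist_triangle_left y y' Y.root, dist_nonneg (x := x) (y := X.root)]

instance (X Y : MMSpace) : Nonempty (SumMetric X Y) :=
  ⟨sumMetricOfCross ((isCross_root X Y).add_const zero_le_one) fun x y =>
    add_pos_of_nonneg_of_pos ((isCross_root X Y).nonneg x y) one_pos⟩

/-- The cross distance of a metric on the disjoint union. -/
def SumMetric.cross {X Y : MMSpace} (d : SumMetric X Y) (x : X.carrier) (y : Y.carrier) : ℝ :=
  d.1.dist (.inl x) (.inr y)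

theorem SumMetric.isCross {X Y : MMSpace} (d : SumMetric X Y) : IsCross d.cross where
  left_triangle x x' y := by
    rw [← d.2.1]; exact d.1.dist_triangle _ _ _
  right_triangle x y y' := by
    rw [← d.2.2]; exact d.1.dist_triangle _ _ _
  dist_left_le x x' y := by
    rw [← d.2.1]
    have := d.1.dist_triangle (.inl x) (.inr y) (.inl x')
    rwa [d.1.dist_comm (.inr y) (.inl x')] at this
  dist_right_le x y y' := by
    rw [← d.2.2]
    have := d.1.dist_triangle (.inr y) (.inl x) (.inr y')
    rwa [d.1.dist_comm (.inr y) (.inl x)] at this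

theorem prohorovDist_nonneg {Z : Type} [MetricSpace Z] [MeasurableSpace Z] (μ ν : Measure Z) :
    0 ≤ prohorovDist μ ν :=
  Real.sInf_nonneg fun _ h => h.1.le

theorem gromovProhorovDist_nonneg (X Y : MMSpace) : 0 ≤ gromovProhorovDist X Y :=
  Real.iInf_nonneg fun d => add_nonneg
    (@prohorovDist_nonneg _ d.1 _ _ _) (@dist_nonneg _ d.1.toPseudoMetricSpace _ _)

theorem bddBelow_gromovProhorov (X Y : MMSpace) :
    BddBelow (Set.range fun d : SumMetric X Y =>
      @prohorovDist (X.carrier ⊕ Y.carrier) d.1 inferInstance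
        (X.measure.map Sum.inl) (Y.measure.map Sum.inr) +
      d.1.dist (Sum.inl X.root) (Sum.inr Y.root)) :=
  ⟨0, by
    rintro _ ⟨d, rfl⟩
    exact add_nonneg (@prohorovDist_nonneg _ d.1 _ _ _)
      (@dist_nonneg _ d.1.toPseudoMetricSpace _ _)⟩

/-- The disjoint union with the topology of the given metric, which Lean would otherwise take to be
the topology of the sum. -/
def SumMetric.Space {X Y : MMSpace} (_ : SumMetric X Y) : Type := X.carrier ⊕ Y.carrier

instance {X Y : MMSpace} (d : SumMetric X Y) : MetricSpace d.Space := d.1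

instance {X Y : MMSpace} (d : SumMetric X Y) : MeasurableSpace d.Space :=
  inferInstanceAs (MeasurableSpace (X.carrier ⊕ Y.carrier))

/-- The left inclusion. -/
def SumMetric.inl {X Y : MMSpace} (d : SumMetric X Y) (x : X.carrier) : d.Space := Sum.inl x

/-- The right inclusion. -/
def SumMetric.inr {X Y : MMSpace} (d : SumMetric X Y) (y : Y.carrier) : d.Space := Sum.inr y

theorem SumMetric.isometry_inl {X Y : MMSpace} (d : SumMetric X Y) : Isometry d.inl :=
  Isometry.of_dist_eq d.2.1

theorem SumMetric.isometry_inr {X Y : MMSpace} (d : SumMetric X Y) : Isometry d.inr :=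
  Isometry.of_dist_eq d.2.2

theorem SumMetric.measurable_inl {X Y : MMSpace} (d : SumMetric X Y) : Measurable d.inl :=
  _root_.measurable_inl

theorem SumMetric.measurable_inr {X Y : MMSpace} (d : SumMetric X Y) : Measurable d.inr :=
  _root_.measurable_inr

theorem measurableSet_of_isClosed {X Y : MMSpace} (d : SumMetric X Y)
    {S : Set d.Space} (hS : IsClosed S) : MeasurableSet S :=
  measurableSet_sum_iff.2 ⟨(hS.preimage d.isometry_inl.continuous).measurableSet,
    (hS.preimage d.isometry_inr.continuous).measurableSet⟩

theorem prohorovClose_of_prohorovDist_lt {X Y : MMSpace} [IsFiniteMeasure X.measure]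
    [IsFiniteMeasure Y.measure] (d : SumMetric X Y) {c : ℝ}
    (h : prohorovDist (X.measure.map d.inl) (Y.measure.map d.inr) < c) :
    0 < c ∧ ProhorovClose X.measure Y.measure d.cross c := by
  refine ⟨(prohorovDist_nonneg _ _).trans_lt h, ?_⟩
  unfold prohorovDist at h
  have hne : {ε : ℝ | 0 < ε ∧ ∀ A : Set d.Space, IsClosed A →
    X.measure.map d.inl A ≤ Y.measure.map d.inr (Metric.cthickening ε A) + ENNReal.ofReal ε ∧
    Y.measure.map d.inr A ≤ X.measure.map d.inl (Metric.cthickening ε A) +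
      ENNReal.ofReal ε}.Nonempty := by
    refine ⟨X.measure.real Set.univ + Y.measure.real Set.univ + 1, by positivity,
      fun A hA => ⟨?_, ?_⟩⟩
    · rw [Measure.map_apply d.measurable_inl (measurableSet_of_isClosed d hA)]
      refine le_add_left ((measure_mono (Set.subset_univ _)).trans ?_)
      rw [← ofReal_measureReal]
      exact ENNReal.ofReal_le_ofReal
        (by linarith [measureReal_nonneg (μ := Y.measure) (s := Set.univ)])
    · rw [Measure.map_apply d.measurable_inr (measurableSet_of_isClosed d hA)]
      refine le_add_left ((measure_mono (Set.subset_univ _)).trans ?_)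
      rw [← ofReal_measureReal]
      exact ENNReal.ofReal_le_ofReal
        (by linarith [measureReal_nonneg (μ := X.measure) (s := Set.univ)])
  obtain ⟨ε, ⟨hε, hA⟩, hεc⟩ := exists_lt_of_csInf_lt hne h
  constructor
  · intro A
    have h1 := (hA (closure (d.inl '' A)) isClosed_closure).1
    rw [Metric.cthickening_closure,
      Measure.map_apply d.measurable_inl (measurableSet_of_isClosed d isClosed_closure),
      Measure.map_apply d.measurable_inr
        (measurableSet_of_isClosed d Metric.isClosed_cthickening)] at h1
    have h0 : A ⊆ d.inl ⁻¹' closure (d.inl '' A) := fun x hx => subset_closure ⟨x, hx, rfl⟩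
    refine (measure_mono h0).trans (h1.trans ?_)
    gcongr
    intro y hy
    have hy' := Metric.cthickening_subset_thickening' (hε.trans hεc) hεc _ hy
    rw [Metric.mem_thickening_iff] at hy'
    obtain ⟨_, ⟨x, hx, rfl⟩, hxy⟩ := hy'
    rw [dist_comm] at hxy
    exact ⟨x, hx, hxy⟩
  · intro A
    have h1 := (hA (closure (d.inr '' A)) isClosed_closure).2
    rw [Metric.cthickening_closure,
      Measure.map_apply d.measurable_inr (measurableSet_of_isClosed d isClosed_closure),
      Measure.map_apply d.measurable_inl
        (measurableSet_of_isClosed d Metric.isClosed_cthickening)] at h1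
    have h0 : A ⊆ d.inr ⁻¹' closure (d.inr '' A) := fun x hx => subset_closure ⟨x, hx, rfl⟩
    refine (measure_mono h0).trans (h1.trans ?_)
    gcongr
    intro y hy
    have hy' := Metric.cthickening_subset_thickening' (hε.trans hεc) hεc _ hy
    rw [Metric.mem_thickening_iff] at hy'
    obtain ⟨_, ⟨x, hx, rfl⟩, hxy⟩ := hy'
    exact ⟨x, hx, hxy⟩

theorem prohorovDist_le_of_prohorovClose {X Y : MMSpace} (d : SumMetric X Y) {c : ℝ} (hc : 0 < c)
    (h : ProhorovClose X.measure Y.measure d.cross c) :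
    prohorovDist (X.measure.map d.inl) (Y.measure.map d.inr) ≤ c := by
  refine csInf_le ⟨0, fun _ h => h.1.le⟩ ⟨hc, fun A hA => ⟨?_, ?_⟩⟩
  · rw [Measure.map_apply d.measurable_inl (measurableSet_of_isClosed d hA),
      Measure.map_apply d.measurable_inr (measurableSet_of_isClosed d Metric.isClosed_cthickening)]
    refine (h.left _).trans ?_
    gcongr
    rintro y ⟨x, hx, hxy⟩
    refine Metric.mem_cthickening_of_dist_le _ _ _ _ hx ?_
    rw [dist_comm]
    exact hxy.le
  · rw [Measure.map_apply d.measurable_inr (measurableSet_of_isClosed d hA),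
      Measure.map_apply d.measurable_inl (measurableSet_of_isClosed d Metric.isClosed_cthickening)]
    refine (h.right _).trans ?_
    gcongr
    rintro y ⟨x, hx, hxy⟩
    exact Metric.mem_cthickening_of_dist_le _ _ _ _ hx hxy.le

theorem exists_cross_of_gromovProhorovDist_lt {X Y : MMSpace} [IsFiniteMeasure X.measure]
    [IsFiniteMeasure Y.measure] {c : ℝ} (h : gromovProhorovDist X Y < c) :
    ∃ (D : X.carrier → Y.carrier → ℝ) (a : ℝ), IsCross D ∧ 0 < a ∧
      ProhorovClose X.measure Y.measure D a ∧ D X.root Y.root + a < c := by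
  obtain ⟨d, hd⟩ := exists_lt_of_ciInf_lt h
  obtain ⟨a, ha, hac⟩ := exists_between (lt_sub_iff_add_lt.2 hd)
  obtain ⟨ha0, hP⟩ := prohorovClose_of_prohorovDist_lt d ha
  refine ⟨d.cross, a, d.isCross, ha0, hP, ?_⟩
  have : d.cross X.root Y.root = d.1.dist (.inl X.root) (.inr Y.root) := rfl
  linarith

theorem gromovProhorovDist_le_of_cross {X Y : MMSpace} {D : X.carrier → Y.carrier → ℝ} {a : ℝ}
    (hD : IsCross D) (ha : 0 ≤ a)
    (hP : ∀ b, a < b → ProhorovClose X.measure Y.measure D b) :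
    gromovProhorovDist X Y ≤ D X.root Y.root + a := by
  refine le_of_forall_pos_le_add fun ε hε => ?_
  have hε3 : 0 < ε / 3 := by positivity
  let d := sumMetricOfCross (hD.add_const hε3.le) fun x y =>
    add_pos_of_nonneg_of_pos (hD.nonneg x y) hε3
  have h1 : ProhorovClose X.measure Y.measure d.cross (a + ε / 3 + ε / 3) :=
    (hP (a + ε / 3) (by linarith)).mono (fun x y h => add_lt_add_left h _) (by linarith)
  have h2 := prohorovDist_le_of_prohorovClose d (by positivity) h1
  refine (ciInf_le (bddBelow_gromovProhorov X Y) d).trans ?_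
  have h3 : d.1.dist (.inl X.root) (.inr Y.root) = D X.root Y.root + ε / 3 := rfl
  exact (add_le_add h2 h3.le).trans_eq (by ring)

theorem gromovProhorovDist_le {X Y : MMSpace} {D : X.carrier → Y.carrier → ℝ} {a : ℝ}
    (hD : IsCross D) (ha : 0 ≤ a) (hP : ProhorovClose X.measure Y.measure D a) :
    gromovProhorovDist X Y ≤ D X.root Y.root + a :=
  gromovProhorovDist_le_of_cross hD ha fun _ hb => hP.mono (fun _ _ h => h.trans hb) hb.le

theorem gromovProhorovDist_comm_le {X Y : MMSpace} [IsFiniteMeasure X.measure]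
    [IsFiniteMeasure Y.measure] : gromovProhorovDist X Y ≤ gromovProhorovDist Y X := by
  refine le_of_forall_gt fun c hc => ?_
  obtain ⟨D, a, hD, ha, hP, hc⟩ := exists_cross_of_gromovProhorovDist_lt hc
  exact (gromovProhorovDist_le hD.symm ha.le hP.symm).trans_lt hc

theorem gromovProhorovDist_comm {X Y : MMSpace} [IsFiniteMeasure X.measure]
    [IsFiniteMeasure Y.measure] : gromovProhorovDist X Y = gromovProhorovDist Y X :=
  le_antisymm gromovProhorovDist_comm_le gromovProhorovDist_comm_le

theorem gromovProhorovDist_triangle (X Y Z : MMSpace) [IsFiniteMeasure X.measure]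
    [IsFiniteMeasure Y.measure] [IsFiniteMeasure Z.measure] :
    gromovProhorovDist X Z ≤ gromovProhorovDist X Y + gromovProhorovDist Y Z := by
  refine le_of_forall_pos_lt_add fun ε hε => ?_
  obtain ⟨D, a, hD, ha, hP, hc⟩ := exists_cross_of_gromovProhorovDist_lt
    (lt_add_of_pos_right (gromovProhorovDist X Y) (half_pos hε))
  obtain ⟨E, b, hE, hb, hQ, hc'⟩ := exists_cross_of_gromovProhorovDist_lt
    (lt_add_of_pos_right (gromovProhorovDist Y Z) (half_pos hε))
  have : Nonempty Y.carrier := ⟨Y.root⟩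
  have h1 := gromovProhorovDist_le (hD.isCross_comp hE) (add_nonneg ha.le hb.le)
    (hP.comp hQ hD hE ha.le hb.le)
  have h2 := hD.comp_le hE X.root Y.root Z.root
  linarith

theorem abs_gromovProhorovDist_sub_le (X X' Y : MMSpace) [IsFiniteMeasure X.measure]
    [IsFiniteMeasure X'.measure] [IsFiniteMeasure Y.measure] :
    |gromovProhorovDist X Y - gromovProhorovDist X' Y| ≤ gromovProhorovDist X X' := by
  have h1 := gromovProhorovDist_triangle X X' Y
  have h2 := gromovProhorovDist_triangle X' X Y
  rw [gromovProhorovDist_comm (X := X') (Y := X)] at h2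
  rw [abs_le]; constructor <;> linarith

/-- The mass of the closed ball of radius `R` around the root. -/
noncomputable def ballMass (X : MMSpace) (R : ℝ) : ℝ :=
  X.measure.real (Metric.closedBall X.root R)

theorem measure_closedBall_ne_top (X : MMSpace) (R : ℝ) :
    X.measure (Metric.closedBall X.root R) ≠ ⊤ :=
  (X.boundedlyFinite _ Metric.isBounded_closedBall).ne

theorem ballMass_mono (X : MMSpace) : Monotone X.ballMass := fun _ _ h =>
  measureReal_mono (Metric.closedBall_subset_closedBall h) (X.measure_closedBall_ne_top _)

theorem ballMass_nonneg (X : MMSpace) (R : ℝ) : 0 ≤ X.ballMass R := measureReal_nonneg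

theorem gromovProhorovDist_restrict_le_of_le (X : MMSpace) {R R' : ℝ} (h : R ≤ R') :
    gromovProhorovDist (X.restrict R) (X.restrict R') ≤ X.ballMass R' - X.ballMass R := by
  have h0 : 0 ≤ X.ballMass R' - X.ballMass R := sub_nonneg.2 (X.ballMass_mono h)
  have key : ∀ b, X.ballMass R' - X.ballMass R < b →
      ProhorovClose (X.measure.restrict (Metric.closedBall X.root R))
        (X.measure.restrict (Metric.closedBall X.root R')) (fun x y => dist x y) b := by
    intro b hb
    have hb0 : 0 < b := h0.trans_lt hb
    have : IsFiniteMeasure (X.measure.restrict (Metric.closedBall X.root R)) :=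
      restrict_isFiniteMeasure X R
    refine ProhorovClose.of_left (b := 0) (c := b) PseudoMetricSpace.isCross_dist le_rfl hb0.le
      (fun A => ?_) ?_ (by simp)
    · have h1 := Measure.restrict_mono_set X.measure
        (Metric.closedBall_subset_closedBall (x := X.root) h) A
      refine (h1.trans (measure_mono fun x hx => ?_)).trans le_self_add
      exact ⟨x, hx, (dist_self x).trans_lt hb0⟩
    · rw [Measure.restrict_apply_univ, Measure.restrict_apply_univ,
        ← ofReal_measureReal (X.measure_closedBall_ne_top R),
        ← ofReal_measureReal (X.measure_closedBall_ne_top R'),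
        ← ENNReal.ofReal_add measureReal_nonneg hb0.le]
      refine ENNReal.ofReal_le_ofReal ?_
      simp only [ballMass] at hb
      linarith
  refine (gromovProhorovDist_le_of_cross (X := X.restrict R) (Y := X.restrict R')
    PseudoMetricSpace.isCross_dist h0 key).trans_eq ?_
  change dist X.root X.root + _ = _
  rw [dist_self, zero_add]

theorem exists_cross_restrict_of_gromovProhorovDist_lt {X Y : MMSpace} {R c : ℝ}
    (h : gromovProhorovDist (X.restrict R) (Y.restrict R) < c) :
    ∃ (D : X.carrier → Y.carrier → ℝ) (a : ℝ), IsCross D ∧ 0 < a ∧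
      ProhorovClose (X.measure.restrict (Metric.closedBall X.root R))
        (Y.measure.restrict (Metric.closedBall Y.root R)) D a ∧ D X.root Y.root + a < c :=
  exists_cross_of_gromovProhorovDist_lt h

end MMSpace

theorem isCross_dist_of_isometry {α β γ : Type*} [PseudoMetricSpace α] [PseudoMetricSpace β]
    [PseudoMetricSpace γ] {f : α → γ} {g : β → γ} (hf : Isometry f) (hg : Isometry g) :
    IsCross fun x y => dist (f x) (g y) where
  left_triangle x x' y := by rw [← hf.dist_eq x x']; exact dist_triangle _ _ _
  right_triangle x y y' := by rw [← hg.dist_eq y' y]; exact dist_triangle _ _ _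
  dist_left_le x x' y := by rw [← hf.dist_eq x x']; exact dist_triangle_right _ _ _
  dist_right_le x y y' := by rw [← hg.dist_eq y y']; exact dist_triangle_left _ _ _

namespace MMSpace

/-! ### The localized distance -/

/-- `R ↦ d_GP(X|_R, Y|_R)` is a Lipschitz function of the mass of the balls of radius `R`, which
is monotone in `R`. -/
theorem measurable_gromovProhorovDist_restrict (X Y : MMSpace) :
    Measurable fun R => gromovProhorovDist (X.restrict R) (Y.restrict R) := by
  set f := fun R => gromovProhorovDist (X.restrict R) (Y.restrict R) with hf
  set F := fun R => X.ballMass R + Y.ballMass R with hF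
  have hFm : Monotone F := fun a b h => add_le_add (X.ballMass_mono h) (Y.ballMass_mono h)
  have key : ∀ R R', |f R - f R'| ≤ |F R - F R'| := by
    have : ∀ R R', R ≤ R' → |f R - f R'| ≤ |F R - F R'| := by
      intro R R' h
      have h1 := abs_gromovProhorovDist_sub_le (X.restrict R) (X.restrict R') (Y.restrict R)
      have h2 := abs_gromovProhorovDist_sub_le (Y.restrict R) (Y.restrict R') (X.restrict R')
      rw [gromovProhorovDist_comm, gromovProhorovDist_comm (X := Y.restrict R')] at h2
      have h3 := gromovProhorovDist_restrict_le_of_le X h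
      have h4 := gromovProhorovDist_restrict_le_of_le Y h
      have h5 := abs_sub_le (f R) (gromovProhorovDist (X.restrict R') (Y.restrict R)) (f R')
      rw [abs_sub_comm (F R), abs_of_nonneg (sub_nonneg.2 (hFm h))]
      simp only [hF, hf] at *
      linarith
    intro R R'
    rcases le_total R R' with h | h
    · exact this R R' h
    · rw [abs_sub_comm, abs_sub_comm (F R)]; exact this R' R h
  have hinv : ∀ R, F (Function.invFun F (F R)) = F R := fun R => Function.invFun_eq ⟨R, rfl⟩
  have hL : LipschitzOnWith 1 (f ∘ Function.invFun F) (Set.range F) := by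
    refine LipschitzOnWith.of_dist_le_mul ?_
    rintro _ ⟨R, rfl⟩ _ ⟨R', rfl⟩
    rw [Real.dist_eq, Real.dist_eq, NNReal.coe_one, one_mul]
    refine (key _ _).trans_eq ?_
    rw [hinv, hinv]
  obtain ⟨g, hg, hgf⟩ := hL.extend_real
  have : f = g ∘ F := by
    funext R
    have h1 := key R (Function.invFun F (F R))
    rw [hinv, sub_self, abs_zero, abs_nonpos_iff, sub_eq_zero] at h1
    rw [h1]
    exact hgf ⟨R, rfl⟩
  rw [this]
  exact hg.continuous.measurable.comp hFm.measurable

theorem localizedIntegrand_nonneg (X Y : MMSpace) (R : ℝ) : 0 ≤ localizedIntegrand X Y R :=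
  mul_nonneg (Real.exp_nonneg _) (le_min zero_le_one (gromovProhorovDist_nonneg _ _))

theorem localizedIntegrand_le (X Y : MMSpace) (R : ℝ) : localizedIntegrand X Y R ≤ Real.exp (-R) :=
  mul_le_of_le_one_right (Real.exp_nonneg _) (min_le_left _ _)

theorem measurable_localizedIntegrand (X Y : MMSpace) : Measurable (localizedIntegrand X Y) :=
  (Real.measurable_exp.comp measurable_neg).mul
    (measurable_const.min (measurable_gromovProhorovDist_restrict X Y))

theorem integrableOn_localizedIntegrand (X Y : MMSpace) :
    IntegrableOn (localizedIntegrand X Y) (Set.Ioi (0 : ℝ)) := by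
  refine Integrable.mono' (integrableOn_exp_neg_Ioi 0)
    (measurable_localizedIntegrand X Y).aestronglyMeasurable (ae_of_all _ fun R => ?_)
  rw [Real.norm_of_nonneg (localizedIntegrand_nonneg X Y R)]
  exact localizedIntegrand_le X Y R

theorem localizedGromovProhorovDist_comm (X Y : MMSpace) :
    X.localizedGromovProhorovDist Y = Y.localizedGromovProhorovDist X := by
  unfold localizedGromovProhorovDist localizedIntegrand
  simp_rw [gromovProhorovDist_comm (X := X.restrict _)]

theorem localizedGromovProhorovDist_triangle (X Y Z : MMSpace) :
    X.localizedGromovProhorovDist Z ≤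
      X.localizedGromovProhorovDist Y + Y.localizedGromovProhorovDist Z := by
  unfold localizedGromovProhorovDist
  rw [← integral_add (integrableOn_localizedIntegrand X Y) (integrableOn_localizedIntegrand Y Z)]
  refine integral_mono (integrableOn_localizedIntegrand X Z)
    ((integrableOn_localizedIntegrand X Y).add (integrableOn_localizedIntegrand Y Z)) fun R => ?_
  simp only [localizedIntegrand, ← mul_add]
  refine mul_le_mul_of_nonneg_left ?_ (Real.exp_nonneg _)
  have h := gromovProhorovDist_triangle (X.restrict R) (Y.restrict R) (Z.restrict R)
  have h1 := gromovProhorovDist_nonneg (X.restrict R) (Y.restrict R)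
  have h2 := gromovProhorovDist_nonneg (Y.restrict R) (Z.restrict R)
  rcases le_total 1 (gromovProhorovDist (X.restrict R) (Y.restrict R)) with h3 | h3
  · rw [min_eq_left h3]
    exact (min_le_left _ _).trans (le_add_of_nonneg_right (le_min zero_le_one h2))
  · rw [min_eq_right h3]
    rcases le_total 1 (gromovProhorovDist (Y.restrict R) (Z.restrict R)) with h4 | h4
    · rw [min_eq_left h4]
      exact (min_le_left _ _).trans (by linarith)
    · rw [min_eq_right h4]
      exact (min_le_right _ _).trans h

/-- A small localized distance makes the restrictions to some ball close, with a radius in any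
given interval of length one. -/
theorem exists_gromovProhorovDist_restrict_lt {X Y : MMSpace} {t η : ℝ} (ht : 0 ≤ t) (hη : η ≤ 1)
    (h : X.localizedGromovProhorovDist Y < Real.exp (-(t + 1)) * η) :
    ∃ R ∈ Set.Icc t (t + 1), gromovProhorovDist (X.restrict R) (Y.restrict R) < η := by
  by_contra! hcon
  refine h.not_ge ?_
  have h1 : ∫ _ in Set.Ioc t (t + 1), Real.exp (-(t + 1)) * η ≤
      ∫ R in Set.Ioc t (t + 1), localizedIntegrand X Y R := by
    refine setIntegral_mono_on (integrable_const _)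
      ((integrableOn_localizedIntegrand X Y).mono_set fun R hR => ht.trans_lt hR.1)
      measurableSet_Ioc fun R hR => ?_
    have h2 : η ≤ min 1 (gromovProhorovDist (X.restrict R) (Y.restrict R)) :=
      le_min hη (hcon R ⟨hR.1.le, hR.2⟩)
    calc Real.exp (-(t + 1)) * η
        ≤ Real.exp (-(t + 1)) * min 1 (gromovProhorovDist (X.restrict R) (Y.restrict R)) :=
          mul_le_mul_of_nonneg_left h2 (Real.exp_nonneg _)
      _ ≤ localizedIntegrand X Y R :=
          mul_le_mul_of_nonneg_right (Real.exp_le_exp.2 (by linarith [hR.2]))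
            (le_min zero_le_one (gromovProhorovDist_nonneg _ _))
  rw [setIntegral_const, measureReal_def, Real.volume_Ioc, smul_eq_mul] at h1
  simp only [add_sub_cancel_left, ENNReal.ofReal_one, ENNReal.toReal_one, one_mul] at h1
  exact h1.trans (setIntegral_mono_set (integrableOn_localizedIntegrand X Y)
    (ae_of_all _ fun R => localizedIntegrand_nonneg X Y R)
    (ae_of_all _ fun R hR => ht.trans_lt hR.1))

/-! ### Invariance under equivalence -/

theorem measurableSet_core (X : MMSpace) : MeasurableSet X.core :=
  Measure.isClosed_support.measurableSet.union (measurableSet_singleton _)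

theorem measure_compl_core (X : MMSpace) : X.measure X.coreᶜ = 0 :=
  measure_mono_null (Set.compl_subset_compl.2 Set.subset_union_left) Measure.measure_compl_support

theorem coreMeasure_apply (X : MMSpace) (T : Set X.core) :
    X.coreMeasure T = X.measure (Subtype.val '' T) :=
  comap_subtype_coe_apply X.measurableSet_core _ _

theorem restrict_apply_le_of_equiv {X Y : MMSpace} (φ : X.core ≃ᵢ Y.core)
    (h1 : φ X.coreRoot = Y.coreRoot) (h2 : X.coreMeasure.map φ = Y.coreMeasure) (R : ℝ)
    (A : Set X.carrier) (S : Set Y.carrier) (hS : MeasurableSet S)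
    (h : ∀ c : X.core, (c : X.carrier) ∈ A → (φ c : Y.carrier) ∈ S) :
    (X.restrict R).measure A ≤ (Y.restrict R).measure S := by
  change X.measure.restrict (Metric.closedBall X.root R) A ≤
    Y.measure.restrict (Metric.closedBall Y.root R) S
  rw [Measure.restrict_apply' Metric.isClosed_closedBall.measurableSet,
    Measure.restrict_apply' Metric.isClosed_closedBall.measurableSet]
  set T : Set Y.core := Subtype.val ⁻¹' (S ∩ Metric.closedBall Y.root R) with hT
  have hTm : MeasurableSet T :=
    measurable_subtype_coe (hS.inter Metric.isClosed_closedBall.measurableSet)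
  have hsub : A ∩ Metric.closedBall X.root R ⊆ Subtype.val '' (φ ⁻¹' T) ∪ X.coreᶜ := by
    rintro x ⟨hxA, hxR⟩
    by_cases hx : x ∈ X.core
    · refine Or.inl ⟨⟨x, hx⟩, ⟨h ⟨x, hx⟩ hxA, ?_⟩, rfl⟩
      have h3 : dist (φ ⟨x, hx⟩) (φ X.coreRoot) = dist x X.root := φ.dist_eq _ _
      rw [h1] at h3
      exact h3.trans_le hxR
    · exact Or.inr hx
  calc X.measure (A ∩ Metric.closedBall X.root R)
      ≤ X.measure (Subtype.val '' (φ ⁻¹' T)) + X.measure X.coreᶜ :=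
        (measure_mono hsub).trans (measure_union_le _ _)
    _ = X.coreMeasure.map φ T := by
        rw [measure_compl_core, add_zero, Measure.map_apply φ.continuous.measurable hTm,
          coreMeasure_apply]
    _ = Y.measure (Subtype.val '' T) := by rw [h2, coreMeasure_apply]
    _ ≤ _ := measure_mono (Set.image_preimage_subset _ _)

theorem gromovProhorovDist_restrict_eq_zero {X Y : MMSpace} (h : Equivalent X Y) (R : ℝ) :
    gromovProhorovDist (X.restrict R) (Y.restrict R) = 0 := by
  obtain ⟨φ, h1, h2⟩ := h
  set D : X.carrier → Y.carrier → ℝ :=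
    IsCross.comp (fun x (c : X.core) => dist x (c : X.carrier))
      (fun c y => dist (φ c : Y.carrier) y) with hD
  have hl : IsCross (fun x (c : X.core) => dist x (c : X.carrier)) :=
    isCross_dist_of_isometry isometry_id isometry_subtype_coe
  have hr : IsCross (fun (c : X.core) y => dist (φ c : Y.carrier) y) :=
    isCross_dist_of_isometry (isometry_subtype_coe.comp φ.isometry) isometry_id
  have : Nonempty X.core := ⟨X.coreRoot⟩
  have hDc : IsCross D := hl.isCross_comp hr
  have hφ : ∀ c : X.core, D c (φ c) = 0 := fun c => by
    refine le_antisymm ((hl.comp_le hr c c (φ c)).trans_eq ?_) (hDc.nonneg _ _)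
    simp
  have h5 : φ.symm Y.coreRoot = X.coreRoot := by rw [← h1, φ.symm_apply_apply]
  have h6 : Y.coreMeasure.map φ.symm = X.coreMeasure := by
    rw [← h2, Measure.map_map φ.symm.continuous.measurable φ.continuous.measurable]
    have : (φ.symm ∘ φ : X.core → X.core) = id := by
      funext x; simp
    rw [this, Measure.map_id]
  refine le_antisymm ?_ (gromovProhorovDist_nonneg _ _)
  refine (gromovProhorovDist_le_of_cross (X := X.restrict R) (Y := Y.restrict R) (D := D)
    hDc le_rfl fun b hb => ⟨fun A => ?_, fun B => ?_⟩).trans_eq ?_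
  · refine le_add_right (restrict_apply_le_of_equiv φ h1 h2 R A (crossNhd D A b)
      (hDc.isOpen_crossNhd A b).measurableSet fun c hc => ⟨c, hc, (hφ c).trans_lt hb⟩)
  · refine le_add_right (restrict_apply_le_of_equiv φ.symm h5 h6 R B (crossNhd (flip D) B b)
      (hDc.symm.isOpen_crossNhd B b).measurableSet fun c hc => ⟨c, hc, ?_⟩)
    have := hφ (φ.symm c)
    rw [φ.apply_symm_apply] at this
    exact this.trans_lt hb
  · have h7 := hφ X.coreRoot
    rw [h1] at h7
    rw [add_zero]
    exact h7

theorem localizedGromovProhorovDist_eq_zero {X Y : MMSpace} (h : Equivalent X Y) :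
    X.localizedGromovProhorovDist Y = 0 := by
  unfold localizedGromovProhorovDist localizedIntegrand
  simp_rw [gromovProhorovDist_restrict_eq_zero h]
  simp

end MMSpace

/-! ### Reconstruction: spaces at distance zero are equivalent -/

theorem measure_ext_of_isCompact {S : Type*} [MetricSpace S] [CompleteSpace S]
    [TopologicalSpace.SeparableSpace S] [MeasurableSpace S] [BorelSpace S] {μ ν : Measure S} (x : S)
    (hμ : ∀ r, μ (Metric.closedBall x r) ≠ ⊤) (hν : ∀ r, ν (Metric.closedBall x r) ≠ ⊤)
    (h : ∀ K, IsCompact K → μ K = ν K) : μ = ν := by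
  have : SecondCountableTopology S := UniformSpace.secondCountable_of_separable S
  have key : ∀ (μ ν : Measure S) (_ : ∀ r, μ (Metric.closedBall x r) ≠ ⊤)
      (_ : ∀ K, IsCompact K → μ K = ν K) (n : ℕ) (T : Set S), MeasurableSet T →
      μ (T ∩ Metric.closedBall x n) ≤ ν (T ∩ Metric.closedBall x n) := by
    intro μ ν hμ h n T hT
    have : IsFiniteMeasure (μ.restrict (Metric.closedBall x n)) :=
      isFiniteMeasure_restrict.2 (hμ n)
    refine ENNReal.le_of_forall_pos_le_add fun ε hε _ => ?_
    have hTm := hT.inter (Metric.isClosed_closedBall (x := x) (ε := n)).measurableSet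
    obtain ⟨K, hKT, hK, hlt⟩ := hTm.exists_isCompact_lt_add
      (μ := μ.restrict (Metric.closedBall x n)) (measure_ne_top _ _)
      (ENNReal.coe_pos.2 hε).ne'
    rw [Measure.restrict_eq_self _ Set.inter_subset_right,
      Measure.restrict_eq_self _ (hKT.trans Set.inter_subset_right)] at hlt
    refine hlt.le.trans ?_
    rw [h K hK]
    gcongr
  refine Measure.ext_of_iUnion_eq_univ (Metric.iUnion_closedBall_nat x) fun n => ?_
  ext T hT
  rw [Measure.restrict_apply hT, Measure.restrict_apply hT]
  exact le_antisymm (key μ ν hμ h n T hT) (key ν μ hν (fun K hK => (h K hK).symm) n T hT)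

namespace MMSpace

/-- A sequence of cross distances that makes larger and larger balls of `X` and `Y` close, with
its limit `E` along an ultrafilter. -/
structure CrossLimit (X Y : MMSpace) (D : ℕ → X.carrier → Y.carrier → ℝ) (a R : ℕ → ℝ)
    (E : X.carrier → Y.carrier → ℝ) : Prop where
  isCross : ∀ n, IsCross (D n)
  close : ∀ n, ProhorovClose (X.measure.restrict (Metric.closedBall X.root (R n)))
    (Y.measure.restrict (Metric.closedBall Y.root (R n))) (D n) (a n)
  tendsto_a : Tendsto a atTop (𝓝 0)
  tendsto_R : Tendsto R atTop atTop
  root_le : ∀ n, D n X.root Y.root ≤ a n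
  tendsto : ∀ x y, Tendsto (fun n => D n x y) (hyperfilter ℕ) (𝓝 (E x y))

namespace CrossLimit

variable {X Y : MMSpace} {D : ℕ → X.carrier → Y.carrier → ℝ} {a R : ℕ → ℝ}
    {E : X.carrier → Y.carrier → ℝ}

theorem symm (h : CrossLimit X Y D a R E) :
    CrossLimit Y X (fun n => flip (D n)) a R (flip E) where
  isCross n := (h.isCross n).symm
  close n := (h.close n).symm
  tendsto_a := h.tendsto_a
  tendsto_R := h.tendsto_R
  root_le := h.root_le
  tendsto x y := h.tendsto y x

theorem _root_.GromovVague.hyperfilter_le_atTop : (hyperfilter ℕ : Filter ℕ) ≤ atTop := by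
  rw [← Nat.cofinite_eq_atTop]; exact hyperfilter_le_cofinite

theorem isCross_limit (h : CrossLimit X Y D a R E) : IsCross E where
  left_triangle x x' y := le_of_tendsto_of_tendsto' (h.tendsto x y)
    (tendsto_const_nhds.add (h.tendsto x' y)) fun n => (h.isCross n).left_triangle x x' y
  right_triangle x y y' := le_of_tendsto_of_tendsto' (h.tendsto x y)
    ((h.tendsto x y').add tendsto_const_nhds) fun n => (h.isCross n).right_triangle x y y'
  dist_left_le x x' y := ge_of_tendsto' ((h.tendsto x y).add (h.tendsto x' y))
    fun n => (h.isCross n).dist_left_le x x' y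
  dist_right_le x y y' := ge_of_tendsto' ((h.tendsto x y).add (h.tendsto x y'))
    fun n => (h.isCross n).dist_right_le x y y'

theorem root_eq (h : CrossLimit X Y D a R E) : E X.root Y.root = 0 :=
  le_antisymm (le_of_tendsto_of_tendsto' (h.tendsto _ _)
    (h.tendsto_a.mono_left hyperfilter_le_atTop) h.root_le) (h.isCross_limit.nonneg _ _)

/-- For large `n` a bounded set of `X` has hardly more mass than its neighbourhood in `Y`. -/
theorem eventually_measure_le (h : CrossLimit X Y D a R E) {A : Set X.carrier}
    (hA : Bornology.IsBounded A) :
    ∀ᶠ n in atTop, X.measure A ≤ Y.measure (crossNhd (D n) A (a n)) + ENNReal.ofReal (a n) := by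
  obtain ⟨r, hr⟩ := hA.subset_closedBall X.root
  filter_upwards [h.tendsto_R.eventually_ge_atTop r] with n hn
  have h1 := (h.close n).left A
  rw [Measure.restrict_eq_self _ (hr.trans (Metric.closedBall_subset_closedBall hn))] at h1
  exact h1.trans (by gcongr; exact Measure.restrict_le_self)

/-- Every point of the support of `X` is close, in the limit distance, to some point of `Y`: its
small balls have mass, which the measure of `Y` sees near them, and inside a compact set by
tightness. -/
theorem exists_le (h : CrossLimit X Y D a R E) {x : X.carrier} (hx : x ∈ X.measure.support)
    {δ : ℝ} (hδ : 0 < δ) : ∃ y, E x y ≤ δ := by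
  set B := Metric.ball x (δ / 3) with hB
  have hBb : Bornology.IsBounded B := Metric.isBounded_ball
  have hm : 0 < X.measure B :=
    (Measure.mem_support_iff_forall x).1 hx B (Metric.ball_mem_nhds x (by positivity))
  have hm' : X.measure B ≠ ⊤ := (X.boundedlyFinite _ hBb).ne
  set C := Metric.closedBall Y.root (dist x X.root + δ + 1) with hC
  have : IsFiniteMeasure (Y.measure.restrict C) :=
    isFiniteMeasure_restrict.2 (Y.measure_closedBall_ne_top _)
  have hm2 : X.measure B / 2 ≠ 0 := (ENNReal.half_pos hm.ne').ne'
  obtain ⟨K, hK, hKle⟩ := isTightMeasureSet_iff_exists_isCompact_measure_compl_le.1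
    (isTightMeasureSet_singleton (μ := Y.measure.restrict C)) (X.measure B / 2)
    (ENNReal.half_pos hm.ne')
  have hKle := hKle _ rfl
  have ha : ∀ᶠ n in atTop, a n < min (δ / 6) 1 :=
    h.tendsto_a.eventually_lt_const (by positivity)
  have ha' : ∀ᶠ n in atTop, ENNReal.ofReal (a n) < X.measure B / 2 := by
    have := ENNReal.tendsto_ofReal h.tendsto_a
    rw [ENNReal.ofReal_zero] at this
    exact this.eventually_lt_const (ENNReal.half_pos hm.ne')
  have hex : ∀ᶠ n in atTop, ∃ y ∈ K, D n x y ≤ δ / 2 := by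
    filter_upwards [ha, ha', h.eventually_measure_le hBb] with n h1 h2 h3
    have h1a := h1.trans_le (min_le_left _ _)
    have h1b := h1.trans_le (min_le_right _ _)
    by_contra! hcon
    have hsub : crossNhd (D n) B (a n) ⊆ C ∩ Kᶜ := by
      rintro y ⟨x', hx', hxy⟩
      rw [hB, Metric.mem_ball] at hx'
      have h4 := (h.isCross n).left_triangle x x' y
      rw [dist_comm] at hx'
      refine ⟨?_, fun hy => ?_⟩
      · rw [hC, Metric.mem_closedBall, dist_comm]
        have h5 := (h.isCross n).dist_right_le X.root Y.root y
        have h6 := (h.isCross n).left_triangle X.root x y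
        rw [dist_comm] at h6
        have h7 := h.root_le n
        linarith
      · linarith [hcon y hy]
    have h4 : Y.measure (C ∩ Kᶜ) ≤ X.measure B / 2 := by
      rw [Set.inter_comm]
      exact (Measure.le_restrict_apply _ _).trans hKle
    have h5 : X.measure B < X.measure B / 2 + X.measure B / 2 :=
      h3.trans_lt (ENNReal.add_lt_add_of_le_of_lt
        (ne_top_of_le_ne_top (ENNReal.half_lt_self hm.ne' hm').ne_top
          ((measure_mono hsub).trans h4)) ((measure_mono hsub).trans h4) h2)
    rw [ENNReal.add_halves] at h5
    exact lt_irrefl _ h5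
  have hex' : ∀ n, ∃ y, (∃ y ∈ K, D n x y ≤ δ / 2) → y ∈ K ∧ D n x y ≤ δ / 2 := by
    intro n
    by_cases hn : ∃ y ∈ K, D n x y ≤ δ / 2
    · obtain ⟨y, hy⟩ := hn
      exact ⟨y, fun _ => hy⟩
    · exact ⟨Y.root, fun h => absurd h hn⟩
  choose y hy using hex'
  have hyU : ∀ᶠ n in (hyperfilter ℕ : Filter ℕ), y n ∈ K ∧ D n x (y n) ≤ δ / 2 :=
    hyperfilter_le_atTop (hex.mono fun n hn => hy n hn)
  obtain ⟨z, -, hz⟩ := hK.ultrafilter_le_nhds ((hyperfilter ℕ).map y)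
    (le_principal_iff.2 (hyU.mono fun n hn => hn.1))
  have hz' : Tendsto y (hyperfilter ℕ) (𝓝 z) := hz
  refine ⟨z, le_of_tendsto (h.tendsto x z) ?_⟩
  filter_upwards [hyU, hz'.eventually (Metric.ball_mem_nhds z (half_pos hδ))] with n h1 h2
  have h3 := (h.isCross n).right_triangle x z (y n)
  have h4 : dist (y n) z < δ / 2 := h2
  linarith

theorem exists_eq_zero (h : CrossLimit X Y D a R E) {x : X.carrier} (hx : x ∈ X.measure.support) :
    ∃ y, E x y = 0 := by
  have hE := h.isCross_limit
  choose y hy using fun k : ℕ => h.exists_le hx (one_div_pos.2 (Nat.cast_add_one_pos (α := ℝ) k))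
  have hlim := tendsto_one_div_add_atTop_nhds_zero_nat (𝕜 := ℝ)
  have hanti : ∀ N n : ℕ, N ≤ n → (1 : ℝ) / (n + 1) ≤ 1 / (N + 1) := fun N n hn =>
    one_div_le_one_div_of_le (by positivity) (by exact_mod_cast Nat.succ_le_succ hn)
  have hc : CauchySeq y := by
    refine cauchySeq_of_le_tendsto_0 (fun N : ℕ => 1 / ((N : ℝ) + 1) + 1 / (N + 1))
      (fun n m N hn hm => ?_) (by simpa using hlim.add hlim)
    have := hE.dist_right_le x (y n) (y m)
    linarith [hy n, hy m, hanti N n hn, hanti N m hm]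
  obtain ⟨z, hz⟩ := cauchySeq_tendsto_of_complete hc
  refine ⟨z, le_antisymm ?_ (hE.nonneg _ _)⟩
  exact le_of_tendsto_of_tendsto' (((hE.continuous_right x).tendsto z).comp hz) hlim hy

theorem mem_support (h : CrossLimit X Y D a R E) {x : X.carrier} (hx : x ∈ X.measure.support)
    {y : Y.carrier} (hxy : E x y = 0) : y ∈ Y.measure.support := by
  rw [Measure.mem_support_iff_forall]
  intro V hV
  obtain ⟨δ, hδ, hVδ⟩ := Metric.mem_nhds_iff.1 hV
  refine lt_of_lt_of_le ?_ (measure_mono hVδ)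
  set B := Metric.ball x (δ / 4) with hB
  have hBb : Bornology.IsBounded B := Metric.isBounded_ball
  have hm : 0 < X.measure B :=
    (Measure.mem_support_iff_forall x).1 hx B (Metric.ball_mem_nhds x (by positivity))
  have ha : ∀ᶠ n in (hyperfilter ℕ : Filter ℕ), a n < δ / 4 :=
    hyperfilter_le_atTop (h.tendsto_a.eventually_lt_const (by positivity))
  have ha' : ∀ᶠ n in (hyperfilter ℕ : Filter ℕ), ENNReal.ofReal (a n) < X.measure B := by
    have := ENNReal.tendsto_ofReal h.tendsto_a
    rw [ENNReal.ofReal_zero] at this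
    exact hyperfilter_le_atTop (this.eventually_lt_const hm)
  have hD : ∀ᶠ n in (hyperfilter ℕ : Filter ℕ), D n x y < δ / 4 :=
    (h.tendsto x y).eventually_lt_const (by rw [hxy]; positivity)
  obtain ⟨n, h1, h2, h3, h4⟩ := (ha.and (ha'.and (hD.and
    (hyperfilter_le_atTop (h.eventually_measure_le hBb))))).exists
  have hsub : crossNhd (D n) B (a n) ⊆ Metric.ball y δ := by
    rintro y' ⟨x', hx', hxy'⟩
    rw [hB, Metric.mem_ball, dist_comm] at hx'
    rw [Metric.mem_ball, dist_comm]
    have h5 := (h.isCross n).dist_right_le x y y'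
    have h6 := (h.isCross n).left_triangle x x' y'
    linarith
  refine pos_iff_ne_zero.2 fun h0 => ?_
  rw [measure_mono_null hsub h0, zero_add] at h4
  exact h2.not_ge h4

theorem exists_core (h : CrossLimit X Y D a R E) (x : X.core) : ∃ y : Y.core, E x y = 0 := by
  obtain ⟨x, hx | hx⟩ := x
  · obtain ⟨y, hy⟩ := h.exists_eq_zero hx
    exact ⟨⟨y, Or.inl (h.mem_support hx hy)⟩, hy⟩
  · refine ⟨Y.coreRoot, ?_⟩
    rw [Set.mem_singleton_iff] at hx
    subst hx
    exact h.root_eq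

/-- On compact sets the correspondence does not lose mass: up to a small error, a finite net of the
set determines the position of its neighbourhood in the other space. -/
theorem measure_le (h : CrossLimit X Y D a R E) {φ : X.carrier → Y.carrier}
    {K : Set X.carrier} (hK : IsCompact K) (hφ : ∀ x ∈ K, E x (φ x) = 0)
    (hφK : IsCompact (φ '' K)) : X.measure K ≤ Y.measure (φ '' K) := by
  have hlim : Tendsto (fun r => Y.measure (Metric.cthickening r (φ '' K))) (𝓝[>] 0)
      (𝓝 (Y.measure (φ '' K))) := by
    refine (tendsto_measure_cthickening_of_isClosed ⟨1, one_pos, ?_⟩ hφK.isClosed).mono_left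
      nhdsWithin_le_nhds
    exact (Y.boundedlyFinite _ hφK.isBounded.cthickening).ne
  refine ge_of_tendsto hlim ?_
  filter_upwards [self_mem_nhdsWithin] with δ hδ
  have hδ : 0 < δ := hδ
  obtain ⟨t, htK, htf, hcov⟩ := hK.finite_cover_balls (show 0 < δ / 4 by positivity)
  have h0 := ENNReal.tendsto_ofReal (h.tendsto_a.mono_left hyperfilter_le_atTop)
  rw [ENNReal.ofReal_zero] at h0
  have h1 := (tendsto_const_nhds (x := Y.measure (Metric.cthickening δ (φ '' K)))).add h0
  rw [add_zero] at h1
  refine ge_of_tendsto h1 ?_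
  have ha : ∀ᶠ n in (hyperfilter ℕ : Filter ℕ), a n < δ / 4 :=
    hyperfilter_le_atTop (h.tendsto_a.eventually_lt_const (by positivity))
  have hD : ∀ᶠ n in (hyperfilter ℕ : Filter ℕ), ∀ x ∈ t, D n x (φ x) < δ / 4 :=
    (Filter.eventually_all_finite htf).2 fun x hx =>
      (h.tendsto x (φ x)).eventually_lt_const (by rw [hφ x (htK hx)]; positivity)
  filter_upwards [ha, hD, hyperfilter_le_atTop (h.eventually_measure_le hK.isBounded)]
    with n h2 h3 h4
  refine h4.trans ?_
  gcongr
  rintro y ⟨k, hk, hky⟩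
  obtain ⟨x, hx, hkx⟩ := Set.mem_iUnion₂.1 (hcov hk)
  rw [Metric.mem_ball, dist_comm] at hkx
  refine Metric.mem_cthickening_of_dist_le y (φ x) _ _ ⟨x, htK hx, rfl⟩ ?_
  have h5 := (h.isCross n).dist_right_le x y (φ x)
  have h6 := (h.isCross n).left_triangle x k y
  linarith [h3 x hx]

theorem equivalent (h : CrossLimit X Y D a R E) : Equivalent X Y := by
  choose φ hφ using h.exists_core
  choose ψ hψ using h.symm.exists_core
  have hψ : ∀ y : Y.core, E (ψ y) y = 0 := hψ
  have hE := h.isCross_limit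
  have hdist : ∀ (x x' : X.core) (y y' : Y.core), E x y = 0 → E x' y' = 0 →
      dist x x' = dist y y' := by
    intro x x' y y' h1 h2
    have h3 := hE.dist_left_le x x' y
    have h4 := hE.right_triangle x' y y'
    have h5 := hE.dist_right_le x y y'
    have h6 := hE.left_triangle x x' y'
    rw [dist_comm] at h4
    refine le_antisymm ?_ ?_
    · change dist (x : X.carrier) x' ≤ dist (y : Y.carrier) y'
      linarith
    · change dist (y : Y.carrier) y' ≤ dist (x : X.carrier) x'
      linarith
  have h1 : ∀ x, ψ (φ x) = x := fun x => by
    rw [← dist_eq_zero, hdist _ _ _ _ (hψ (φ x)) (hφ x), dist_self]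
  have h2 : ∀ y, φ (ψ y) = y := fun y => by
    rw [← dist_eq_zero, ← hdist _ _ _ _ (hφ (ψ y)) (hψ y), dist_self]
  let Φ : X.core ≃ᵢ Y.core :=
    ⟨⟨φ, ψ, h1, h2⟩, Isometry.of_dist_eq fun x x' => (hdist _ _ _ _ (hφ x) (hφ x')).symm⟩
  have hroot : φ X.coreRoot = Y.coreRoot := by
    rw [← dist_eq_zero, ← hdist X.coreRoot X.coreRoot _ Y.coreRoot (hφ X.coreRoot) h.root_eq,
      dist_self]
  -- the two inequalities for the measures of compact sets
  have hle : ∀ K : Set X.core, IsCompact K → X.coreMeasure K ≤ Y.coreMeasure (φ '' K) := by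
    intro K hK
    rw [coreMeasure_apply, coreMeasure_apply]
    classical
    let f : X.carrier → Y.carrier := fun x => if hx : x ∈ X.core then φ ⟨x, hx⟩ else Y.root
    have hf : ∀ x : X.core, f x = φ x := fun x => by simp [f]
    have hfK : f '' (Subtype.val '' K) = Subtype.val '' (φ '' K) := by
      rw [← Set.image_comp, ← Set.image_comp]
      exact Set.image_congr fun x _ => hf x
    have := h.measure_le (φ := f) (hK.image continuous_subtype_val)
      (by rintro _ ⟨x, _, rfl⟩; rw [hf]; exact hφ x)
      (by rw [hfK]; exact (hK.image Φ.continuous).image continuous_subtype_val)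
    rwa [hfK] at this
  have hge : ∀ K : Set Y.core, IsCompact K → Y.coreMeasure K ≤ X.coreMeasure (ψ '' K) := by
    intro K hK
    rw [coreMeasure_apply, coreMeasure_apply]
    classical
    let f : Y.carrier → X.carrier := fun x => if hx : x ∈ Y.core then ψ ⟨x, hx⟩ else X.root
    have hf : ∀ x : Y.core, f x = ψ x := fun x => by simp [f]
    have hfK : f '' (Subtype.val '' K) = Subtype.val '' (ψ '' K) := by
      rw [← Set.image_comp, ← Set.image_comp]
      exact Set.image_congr fun x _ => hf x
    have := h.symm.measure_le (φ := f) (hK.image continuous_subtype_val)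
      (by rintro _ ⟨x, _, rfl⟩; rw [hf]; exact hψ x)
      (by rw [hfK]; exact (hK.image Φ.symm.continuous).image continuous_subtype_val)
    rwa [hfK] at this
  refine ⟨Φ, hroot, ?_⟩
  have hYc : IsClosed Y.core := Measure.isClosed_support.union isClosed_singleton
  have : CompleteSpace Y.core := hYc.completeSpace_coe
  have hsec : SecondCountableTopology Y.carrier := UniformSpace.secondCountable_of_separable _
  refine measure_ext_of_isCompact Y.coreRoot (fun r => ?_) (fun r => ?_) fun K hK => ?_
  · rw [Measure.map_apply Φ.continuous.measurable Metric.isClosed_closedBall.measurableSet,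
      coreMeasure_apply]
    refine ne_top_of_le_ne_top (X.measure_closedBall_ne_top r) (measure_mono ?_)
    rintro _ ⟨x, hx, rfl⟩
    have h3 : dist (Φ x) (Φ X.coreRoot) ≤ r := by
      have : Φ X.coreRoot = Y.coreRoot := hroot
      rw [this]; exact hx
    rwa [Φ.dist_eq] at h3
  · rw [coreMeasure_apply]
    refine ne_top_of_le_ne_top (Y.measure_closedBall_ne_top r) (measure_mono ?_)
    rintro _ ⟨x, hx, rfl⟩
    exact hx
  · rw [Measure.map_apply Φ.continuous.measurable hK.isClosed.measurableSet]
    have h3 : Φ ⁻¹' K = ψ '' K := (congrFun (Set.image_eq_preimage_of_inverse h2 h1) K).symm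
    have h4 : φ '' (ψ '' K) = K := by rw [← Set.image_comp]; simp [h2]
    rw [h3]
    refine le_antisymm ?_ (hge K hK)
    have := hle (ψ '' K) (hK.image Φ.symm.continuous)
    rwa [h4] at this

end CrossLimit

theorem equivalent_of_forall_lt {X Y : MMSpace}
    (h : ∀ n : ℕ, ∃ R : ℝ, n ≤ R ∧
      gromovProhorovDist (X.restrict R) (Y.restrict R) < 1 / (n + 1)) : Equivalent X Y := by
  choose R hR hlt using h
  choose D a hD ha hP hlt using fun n => exists_cross_restrict_of_gromovProhorovDist_lt (hlt n)
  have hD0 : ∀ n, 0 ≤ D n X.root Y.root := fun n => (hD n).nonneg _ _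
  have hb : ∀ n x y, D n x y ∈ Set.Icc 0 (dist x X.root + 1 + dist Y.root y) := by
    intro n x y
    refine ⟨(hD n).nonneg x y, ?_⟩
    have h1 := (hD n).left_triangle x X.root y
    have h2 := (hD n).right_triangle X.root y Y.root
    have h3 : D n X.root Y.root + a n < 1 / ((n : ℝ) + 1) := hlt n
    have h4 : (1 : ℝ) / (n + 1) ≤ 1 := by
      rw [div_le_one (by positivity)]; linarith [Nat.cast_nonneg (α := ℝ) n]
    have h5 := ha n
    have h1' : D n x y ≤ dist x X.root + D n X.root y := h1
    have h2' : D n X.root y ≤ D n X.root Y.root + dist Y.root y := h2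
    linarith
  have hE : ∀ (x : X.carrier) (y : Y.carrier), ∃ e,
      Tendsto (fun n => D n x y) (hyperfilter ℕ) (𝓝 e) := by
    intro x y
    obtain ⟨e, -, he⟩ := isCompact_Icc.ultrafilter_le_nhds
      ((hyperfilter ℕ).map fun n => D n x y)
      (le_principal_iff.2 (Eventually.of_forall (f := (hyperfilter ℕ : Filter ℕ))
        fun n => hb n x y))
    exact ⟨e, he⟩
  choose E hE using hE
  refine CrossLimit.equivalent (D := D) (a := fun n : ℕ => 1 / ((n : ℝ) + 1)) (R := R) (E := E)
    ⟨hD, fun n => (hP n).mono (fun x y hxy => hxy.trans ?_) ?_,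
      tendsto_one_div_add_atTop_nhds_zero_nat,
      tendsto_atTop_mono hR tendsto_natCast_atTop_atTop, fun n => ?_, hE⟩
  · linarith [hD0 n, hlt n]
  · linarith [hD0 n, hlt n]
  · have : D n X.root Y.root + a n < 1 / ((n : ℝ) + 1) := hlt n
    linarith [ha n]

theorem equivalent_of_localizedGromovProhorovDist_eq_zero {X Y : MMSpace}
    (h : X.localizedGromovProhorovDist Y = 0) : Equivalent X Y := by
  refine equivalent_of_forall_lt fun n => ?_
  obtain ⟨R, hR, hlt⟩ := exists_gromovProhorovDist_restrict_lt (X := X) (Y := Y)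
    (t := n) (η := 1 / (n + 1)) (by positivity)
    (by rw [div_le_one (by positivity)]; linarith [Nat.cast_nonneg (α := ℝ) n])
    (by rw [h]; positivity)
  exact ⟨R, hR.1, hlt⟩

end MMSpace

/-! ### Integrals of Lipschitz functions -/

/-- Prohorov closeness controls the integrals of functions that are compatible with the cross
distance, by the layer cake formula. The set `S` localizes the bound to a neighbourhood of the
support. -/
theorem ProhorovClose.integral_le {α β : Type*} [MeasurableSpace α] [MeasurableSpace β]
    {μ : Measure α} {ν : Measure β} [IsFiniteMeasure μ] [IsFiniteMeasure ν] {D : α → β → ℝ} {a : ℝ}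
    (h : ProhorovClose μ ν D a) (ha : 0 ≤ a) {f : α → ℝ} {g : β → ℝ} (hfm : Measurable f)
    (hgm : Measurable g) (hf : ∀ x, 0 ≤ f x ∧ f x ≤ 1) (hg : ∀ y, 0 ≤ g y ∧ g y ≤ 1) {L : ℝ}
    (hL : 0 ≤ L) (hfg : ∀ x y, |f x - g y| ≤ L * D x y) {S : Set β} (hSm : MeasurableSet S)
    (hS : ∀ x y, f x ≠ 0 → D x y < a → y ∈ S) :
    ∫ x, f x ∂μ ≤ ∫ y, g y ∂ν + (L * ν.real S + 1) * a := by
  have hLa : 0 ≤ L * a := mul_nonneg hL ha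
  have hgi : Integrable g ν := Integrable.of_bound hgm.aestronglyMeasurable 1
    (ae_of_all _ fun y => by rw [Real.norm_of_nonneg (hg y).1]; exact (hg y).2)
  have h1 : ∫⁻ x, ENNReal.ofReal (f x) ∂μ ≤
      ∫⁻ y, ENNReal.ofReal (g y + L * a) ∂(ν.restrict S) + ENNReal.ofReal a := by
    rw [lintegral_eq_lintegral_meas_le _ (ae_of_all _ fun x => (hf x).1) hfm.aemeasurable,
      lintegral_eq_lintegral_meas_le _ (ae_of_all _ fun y => add_nonneg (hg y).1 hLa)
        (hgm.add_const _).aemeasurable]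
    have h2 : ∀ t ∈ Set.Ioi (0 : ℝ), μ {x | t ≤ f x} ≤
        ν.restrict S {y | t ≤ g y + L * a} +
          (Set.Ioc (0 : ℝ) 1).indicator (fun _ => ENNReal.ofReal a) t := by
      intro t ht
      have ht : 0 < t := ht
      by_cases ht1 : t ≤ 1
      · rw [Set.indicator_of_mem (show t ∈ Set.Ioc (0 : ℝ) 1 from ⟨ht, ht1⟩),
          Measure.restrict_apply' hSm]
        refine (h.left _).trans ?_
        gcongr
        rintro y ⟨x, hx, hxy⟩
        have hx : t ≤ f x := hx
        refine ⟨?_, hS x y (ht.trans_le hx).ne' hxy⟩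
        have h3 := (abs_le.1 (hfg x y)).2
        have h4 := mul_le_mul_of_nonneg_left hxy.le hL
        change t ≤ g y + L * a
        linarith
      · have : {x | t ≤ f x} = ∅ := by
          ext x
          simp only [Set.mem_ofPred_eq, Set.mem_empty_iff_false, iff_false, not_le]
          exact (hf x).2.trans_lt (not_le.1 ht1)
        rw [this, measure_empty]
        exact zero_le
    refine (setLIntegral_mono' measurableSet_Ioi h2).trans ?_
    rw [lintegral_add_right _ (measurable_const.indicator measurableSet_Ioc)]
    gcongr
    refine (setLIntegral_le_lintegral _ _).trans ?_
    rw [lintegral_indicator measurableSet_Ioc, lintegral_const, Measure.restrict_apply_univ,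
      Real.volume_Ioc]
    simp
  have hgS : Integrable (fun y => g y + L * a) (ν.restrict S) :=
    hgi.restrict.add (integrable_const _)
  rw [integral_eq_lintegral_of_nonneg_ae (ae_of_all _ fun x => (hf x).1) hfm.aestronglyMeasurable]
  have h3 := ENNReal.toReal_mono (ENNReal.add_ne_top.2
    ⟨hgS.lintegral_lt_top.ne, ENNReal.ofReal_ne_top⟩) h1
  rw [ENNReal.toReal_add hgS.lintegral_lt_top.ne ENNReal.ofReal_ne_top, ENNReal.toReal_ofReal ha,
    ← integral_eq_lintegral_of_nonneg_ae (ae_of_all _ fun y => add_nonneg (hg y).1 hLa)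
      hgS.aestronglyMeasurable, integral_add hgi.restrict (integrable_const _), integral_const,
      measureReal_restrict_apply_univ, smul_eq_mul] at h3
  have h4 : ∫ y in S, g y ∂ν ≤ ∫ y, g y ∂ν :=
    setIntegral_le_integral hgi (ae_of_all _ fun y => (hg y).1)
  refine h3.trans ?_
  linarith

theorem integral_pi_insertNth {Z : Type*} [MeasurableSpace Z] (μ : Measure Z) [SigmaFinite μ]
    {k : ℕ} (i : Fin (k + 1)) {G : (Fin (k + 1) → Z) → ℝ}
    (hG : Integrable G (Measure.pi fun _ => μ)) :
    Integrable (fun p : Z × (Fin k → Z) => G (Fin.insertNth i p.1 p.2))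
      (μ.prod (Measure.pi fun _ => μ)) ∧
    ∫ u, G u ∂(Measure.pi fun _ => μ) =
      ∫ p : Z × (Fin k → Z), G (Fin.insertNth i p.1 p.2) ∂(μ.prod (Measure.pi fun _ => μ)) := by
  have h := (measurePreserving_piFinSuccAbove (fun _ : Fin (k + 1) => μ) i).symm
  exact ⟨(h.integrable_comp_emb (MeasurableEquiv.measurableEmbedding _)).2 hG,
    (h.integral_comp' G).symm⟩

theorem measurable_finCons {Z : Type*} [MeasurableSpace Z] {k : ℕ} (z : Z) :
    Measurable (fun u : Fin k → Z => (Fin.cons z u : Fin (k + 1) → Z)) := by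
  refine measurable_pi_iff.2 fun j => ?_
  induction j using Fin.cases with
  | zero => exact measurable_const
  | succ j => exact measurable_pi_apply j

theorem measurable_finCons_prod {Z : Type*} [MeasurableSpace Z] {k : ℕ} :
    Measurable (fun p : Z × (Fin k → Z) => (Fin.cons p.1 p.2 : Fin (k + 1) → Z)) := by
  refine measurable_pi_iff.2 fun j => ?_
  induction j using Fin.cases with
  | zero => exact measurable_fst
  | succ j => exact (measurable_pi_apply j).comp measurable_snd

theorem integrable_of_mem_Icc {Z : Type*} [MeasurableSpace Z] {μ : Measure Z} [IsFiniteMeasure μ]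
    {f : Z → ℝ} (hf : Measurable f) (h : ∀ z, 0 ≤ f z ∧ f z ≤ 1) : Integrable f μ :=
  Integrable.of_bound hf.aestronglyMeasurable 1
    (ae_of_all _ fun y => by rw [Real.norm_of_nonneg (h y).1]; exact (h y).2)

theorem abs_integral_le_of_abs_le {Z : Type*} [MeasurableSpace Z] {μ : Measure Z}
    [IsFiniteMeasure μ] {f : Z → ℝ} {C : ℝ} (h : ∀ z, |f z| ≤ C) :
    |∫ z, f z ∂μ| ≤ C * μ.real Set.univ :=
  norm_integral_le_of_norm_le_const (μ := μ) (f := f) (ae_of_all _ h)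

theorem measureReal_pi_univ {Z : Type*} [MeasurableSpace Z] (μ : Measure Z) [IsFiniteMeasure μ]
    (k : ℕ) : (Measure.pi fun _ : Fin k => μ).real Set.univ = μ.real Set.univ ^ k := by
  rw [measureReal_def, Measure.pi_univ, Finset.prod_const, Finset.card_univ, Fintype.card_fin,
    ENNReal.toReal_pow, measureReal_def]

/-- If the integrals of `d`-Lipschitz functions against `μ` and `ν` are close, then so are those
of coordinatewise `d`-Lipschitz functions against the product measures: replace the factors one
by one. -/
theorem abs_integral_pi_sub_le {Z : Type*} [MeasurableSpace Z] (d : Z → Z → ℝ) (S : Set Z)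
    (μ ν : Measure Z) [IsFiniteMeasure μ] [IsFiniteMeasure ν] {M η : ℝ} (hM : 1 ≤ M)
    (hμ : μ.real Set.univ ≤ M) (hν : ν.real Set.univ ≤ M)
    (h : ∀ f : Z → ℝ, Measurable f → (∀ z, 0 ≤ f z ∧ f z ≤ 1) → (∀ z z', |f z - f z'| ≤ d z z') →
      (∀ z, f z ≠ 0 → z ∈ S) → |∫ z, f z ∂μ - ∫ z, f z ∂ν| ≤ η)
    (k : ℕ) (G : (Fin k → Z) → ℝ) (hGm : Measurable G) (hG : ∀ u, 0 ≤ G u ∧ G u ≤ 1)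
    (hGd : ∀ u i z, |G u - G (Function.update u i z)| ≤ d (u i) z)
    (hGS : ∀ u, G u ≠ 0 → ∀ i, u i ∈ S) :
    |∫ u, G u ∂(Measure.pi fun _ => μ) - ∫ u, G u ∂(Measure.pi fun _ => ν)| ≤ k * M ^ k * η := by
  induction k with
  | zero =>
    rw [Measure.pi_of_empty, Measure.pi_of_empty]
    simp
  | succ k ih =>
    have hM0 : 0 < M := one_pos.trans_le hM
    have hMk : 0 < M ^ k := pow_pos hM0 k
    rcases isEmpty_or_nonempty Z with hZ | ⟨⟨z₀⟩⟩
    · have : IsEmpty (Fin (k + 1) → Z) := ⟨fun u => hZ.elim (u 0)⟩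
      have h0 := h 0 measurable_const (fun z => hZ.elim z) (fun z => hZ.elim z) fun z => hZ.elim z
      rw [integral_of_isEmpty, integral_of_isEmpty, sub_zero, abs_zero] at h0
      rw [integral_of_isEmpty, integral_of_isEmpty, sub_zero, abs_zero]
      positivity
    have hd : ∀ z z', 0 ≤ d z z' := fun z z' =>
      (abs_nonneg _).trans (hGd (fun _ => z) 0 z')
    have hη : 0 ≤ η := (abs_nonneg _).trans
      (h 0 measurable_const (fun _ => by simp) (by simpa using hd) (by simp))
    have hGi : ∀ (κ : Measure (Fin (k + 1) → Z)) [IsFiniteMeasure κ], Integrable G κ :=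
      fun κ _ => integrable_of_mem_Icc hGm hG
    -- integrate over the first coordinate last
    have hsplit : ∀ (κ : Measure Z) [IsFiniteMeasure κ], ∫ u, G u ∂(Measure.pi fun _ => κ) =
        ∫ z, ∫ u, G (Fin.cons z u) ∂(Measure.pi fun _ => κ) ∂κ := by
      intro κ _
      obtain ⟨h1, h2⟩ := integral_pi_insertNth κ 0 (hGi _)
      rw [h2, integral_prod _ h1]
      simp only [Fin.insertNth_zero']
    have hc : Measurable fun p : Z × (Fin k → Z) => G (Fin.cons p.1 p.2) :=
      hGm.comp measurable_finCons_prod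
    have hcm : ∀ z, Measurable fun u : Fin k → Z => G (Fin.cons z u) := fun z =>
      hGm.comp (measurable_finCons z)
    have hci : ∀ (κ : Measure Z) [IsFiniteMeasure κ] (z : Z),
        Integrable (fun u : Fin k → Z => G (Fin.cons z u)) (Measure.pi fun _ => κ) :=
      fun κ _ z => integrable_of_mem_Icc (hcm z) fun u => hG _
    have hI : ∀ (κ : Measure Z) [IsFiniteMeasure κ],
        Measurable fun z => ∫ u, G (Fin.cons z u) ∂(Measure.pi fun _ : Fin k => κ) :=
      fun κ _ => (hc.stronglyMeasurable.integral_prod_right'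
        (ν := Measure.pi fun _ : Fin k => κ)).measurable
    have hpow : ∀ (κ : Measure Z) [IsFiniteMeasure κ], κ.real Set.univ ≤ M →
        (Measure.pi fun _ : Fin k => κ).real Set.univ ≤ M ^ k := fun κ _ hκ => by
      rw [measureReal_pi_univ]
      exact pow_le_pow_left₀ measureReal_nonneg hκ k
    have hb : ∀ (κ : Measure Z) [IsFiniteMeasure κ] (_ : κ.real Set.univ ≤ M) (z : Z),
        0 ≤ ∫ u, G (Fin.cons z u) ∂(Measure.pi fun _ : Fin k => κ) ∧
          ∫ u, G (Fin.cons z u) ∂(Measure.pi fun _ : Fin k => κ) ≤ M ^ k := by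
      intro κ _ hκ z
      refine ⟨integral_nonneg fun u => (hG _).1, ?_⟩
      refine (integral_mono (hci κ z) (integrable_const 1) fun u => (hG _).2).trans ?_
      rw [integral_const, smul_eq_mul, mul_one]
      exact hpow κ hκ
    have hbi : ∀ (κ κ' : Measure Z) [IsFiniteMeasure κ] [IsFiniteMeasure κ']
        (_ : κ.real Set.univ ≤ M),
        Integrable (fun z => ∫ u, G (Fin.cons z u) ∂(Measure.pi fun _ : Fin k => κ)) κ' :=
      fun κ κ' _ _ hκ => Integrable.of_bound (hI κ).aestronglyMeasurable (M ^ k)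
        (ae_of_all _ fun z => by
          rw [Real.norm_of_nonneg (hb κ hκ z).1]; exact (hb κ hκ z).2)
    rw [hsplit μ, hsplit ν]
    -- exchange the inner measure
    have h1 : |∫ z, ∫ u, G (Fin.cons z u) ∂(Measure.pi fun _ : Fin k => μ) ∂μ -
        ∫ z, ∫ u, G (Fin.cons z u) ∂(Measure.pi fun _ : Fin k => ν) ∂μ| ≤ M * (k * M ^ k * η) := by
      rw [← integral_sub (hbi μ μ hμ) (hbi ν μ hν)]
      refine (abs_integral_le_of_abs_le (C := k * M ^ k * η) fun z => ?_).trans ?_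
      · refine ih (fun u => G (Fin.cons z u)) (hcm z) (fun u => hG _) (fun u i z' => ?_)
          fun u hu i => by simpa using hGS _ hu i.succ
        rw [Fin.cons_update]
        simpa using hGd (Fin.cons z u) i.succ z'
      · rw [mul_comm]
        exact mul_le_mul_of_nonneg_right hμ (by positivity)
    -- exchange the outer measure
    have h2 : |∫ z, ∫ u, G (Fin.cons z u) ∂(Measure.pi fun _ : Fin k => ν) ∂μ -
        ∫ z, ∫ u, G (Fin.cons z u) ∂(Measure.pi fun _ : Fin k => ν) ∂ν| ≤ M ^ k * η := by
      have h3 := h (fun z => (∫ u, G (Fin.cons z u) ∂(Measure.pi fun _ : Fin k => ν)) / M ^ k)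
        ((hI ν).div_const _) (fun z => ⟨div_nonneg (hb ν hν z).1 hMk.le,
          (div_le_one hMk).2 (hb ν hν z).2⟩) (fun z z' => ?_) fun z hz => ?_
      · simp_rw [integral_div] at h3
        rw [← sub_div, abs_div, abs_of_pos hMk, div_le_iff₀ hMk] at h3
        linarith
      · rw [← sub_div, abs_div, abs_of_pos hMk, div_le_iff₀ hMk,
          ← integral_sub (hci ν z) (hci ν z')]
        refine (abs_integral_le_of_abs_le (C := d z z') fun u => ?_).trans ?_
        · have := hGd (Fin.cons z u) 0 z'
          rwa [Fin.update_cons_zero, Fin.cons_zero] at this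
        · exact mul_le_mul_of_nonneg_left (hpow ν hν) (hd z z')
      · by_contra hzS
        refine hz ?_
        have : ∀ u : Fin k → Z, G (Fin.cons z u) = 0 := fun u => by
          by_contra hu
          exact hzS (by simpa using hGS _ hu 0)
        simp [this]
    have h3 := abs_sub_le (∫ z, ∫ u, G (Fin.cons z u) ∂(Measure.pi fun _ : Fin k => μ) ∂μ)
      (∫ z, ∫ u, G (Fin.cons z u) ∂(Measure.pi fun _ : Fin k => ν) ∂μ)
      (∫ z, ∫ u, G (Fin.cons z u) ∂(Measure.pi fun _ : Fin k => ν) ∂ν)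
    have h4 : M ^ k * η ≤ M ^ (k + 1) * η :=
      mul_le_mul_of_nonneg_right (pow_le_pow_right₀ hM (Nat.le_succ k)) hη
    have h5 : M * (k * M ^ k * η) + M ^ (k + 1) * η = (k + 1 : ℕ) * M ^ (k + 1) * η := by
      push_cast; ring
    linarith

/-! ### Distance matrices -/

/-- The full matrix of the distances between the entries of a tuple. -/
def distMat {Z : Type*} [Dist Z] {n : ℕ} (u : Fin n → Z) : Fin n → Fin n → ℝ :=
  fun i j => dist (u i) (u j)

theorem continuous_distMat {Z : Type*} [PseudoMetricSpace Z] {n : ℕ} :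
    Continuous (distMat : (Fin n → Z) → _) :=
  continuous_pi fun i => continuous_pi fun j => (continuous_apply i).dist (continuous_apply j)

theorem measurable_distMat {Z : Type*} [PseudoMetricSpace Z] [SecondCountableTopology Z]
    [MeasurableSpace Z] [OpensMeasurableSpace Z] {n : ℕ} :
    Measurable (distMat : (Fin n → Z) → _) :=
  measurable_pi_iff.2 fun i => measurable_pi_iff.2 fun j =>
    (measurable_pi_apply i).dist (measurable_pi_apply j)

theorem dist_distMat_update_le {Z : Type*} [PseudoMetricSpace Z] {n : ℕ} (u : Fin n → Z)
    (i : Fin n) (z : Z) : dist (distMat u) (distMat (Function.update u i z)) ≤ dist (u i) z := by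
  refine (dist_pi_le_iff dist_nonneg).2 fun j => (dist_pi_le_iff dist_nonneg).2 fun l => ?_
  simp only [distMat, Real.dist_eq]
  by_cases hj : j = i
  · subst hj
    by_cases hl : l = j
    · subst hl; simp
    · rw [Function.update_self, Function.update_of_ne hl]
      exact abs_dist_sub_le _ _ _
  · rw [Function.update_of_ne hj]
    by_cases hl : l = i
    · subst hl
      rw [Function.update_self, dist_comm (u j), dist_comm (u j)]
      exact abs_dist_sub_le _ _ _
    · rw [Function.update_of_ne hl]; simp

theorem continuous_of_lipschitz {α : Type*} [PseudoMetricSpace α] {F : α → ℝ} {L : ℝ}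
    (h : ∀ a b, |F a - F b| ≤ L * dist a b) : Continuous F := by
  refine (LipschitzWith.of_dist_le_mul (K := L.toNNReal) fun a b => (h a b).trans ?_).continuous
  exact mul_le_mul_of_nonneg_right (Real.le_coe_toNNReal L) dist_nonneg

theorem abs_integral_distMat_sub_le {Z : Type*} [PseudoMetricSpace Z] [SecondCountableTopology Z]
    [MeasurableSpace Z] [OpensMeasurableSpace Z] (r r' : Z) (S : Set Z)
    (μ ν : Measure Z) [IsFiniteMeasure μ] [IsFiniteMeasure ν] {M η L : ℝ} (hM : 1 ≤ M)
    (hμ : μ.real Set.univ ≤ M) (hν : ν.real Set.univ ≤ M)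
    (h : ∀ f : Z → ℝ, Measurable f → (∀ z, 0 ≤ f z ∧ f z ≤ 1) →
      (∀ z z', |f z - f z'| ≤ L * dist z z') → (∀ z, f z ≠ 0 → z ∈ S) →
      |∫ z, f z ∂μ - ∫ z, f z ∂ν| ≤ η)
    (k : ℕ) (F : (Fin (k + 1) → Fin (k + 1) → ℝ) → ℝ) (hF : ∀ a, 0 ≤ F a ∧ F a ≤ 1) (hL : 0 ≤ L)
    (hFL : ∀ a b, |F a - F b| ≤ L * dist a b)
    (hFS : ∀ u : Fin k → Z, F (distMat (Fin.cons r u)) ≠ 0 → ∀ i, u i ∈ S) :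
    |∫ u, F (distMat (Fin.cons r u)) ∂(Measure.pi fun _ => μ) -
      ∫ u, F (distMat (Fin.cons r' u)) ∂(Measure.pi fun _ => ν)| ≤
        k * M ^ k * η + L * dist r r' * M ^ k := by
  have hFm : Measurable F := (continuous_of_lipschitz hFL).measurable
  have hm : ∀ z : Z, Measurable fun u : Fin k → Z => F (distMat (Fin.cons z u)) := fun z =>
    hFm.comp (measurable_distMat.comp (measurable_finCons z))
  have h1 := abs_integral_pi_sub_le (fun z z' => L * dist z z') S μ ν hM hμ hν h k
    (fun u => F (distMat (Fin.cons r u))) (hm r) (fun u => hF _) (fun u i z => ?_) hFS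
  · have h2 : |∫ u, F (distMat (Fin.cons r u)) ∂(Measure.pi fun _ : Fin k => ν) -
      ∫ u, F (distMat (Fin.cons r' u)) ∂(Measure.pi fun _ => ν)| ≤ L * dist r r' * M ^ k := by
      rw [← integral_sub (integrable_of_mem_Icc (hm r) fun u => hF _)
        (integrable_of_mem_Icc (hm r') fun u => hF _)]
      refine (abs_integral_le_of_abs_le (C := L * dist r r') fun u => ?_).trans ?_
      · refine (hFL _ _).trans (mul_le_mul_of_nonneg_left ?_ hL)
        have := dist_distMat_update_le (Fin.cons r u : Fin (k + 1) → Z) 0 r'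
        rwa [Fin.update_cons_zero, Fin.cons_zero] at this
      · refine mul_le_mul_of_nonneg_left ?_ (mul_nonneg hL dist_nonneg)
        rw [measureReal_pi_univ]
        exact pow_le_pow_left₀ measureReal_nonneg hν k
    exact (abs_sub_le _ _ _).trans (add_le_add h1 h2)
  · refine (hFL _ _).trans (mul_le_mul_of_nonneg_left ?_ hL)
    have := dist_distMat_update_le (Fin.cons r u : Fin (k + 1) → Z) i.succ z
    rwa [← Fin.cons_update, Fin.cons_succ] at this

/-! ### Weak convergence through Lipschitz functions -/

/-- Weak convergence of finite measures can be tested on Lipschitz functions with values in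
`[0, 1]`. -/
theorem tendsto_finiteMeasure_of_lipschitz {Ω : Type*} [PseudoMetricSpace Ω] [MeasurableSpace Ω]
    [OpensMeasurableSpace Ω] {μs : ℕ → FiniteMeasure Ω} {μ : FiniteMeasure Ω}
    (h : ∀ (f : Ω → ℝ) (L : ℝ), (∀ ω, 0 ≤ f ω ∧ f ω ≤ 1) → (∀ x y, |f x - f y| ≤ L * dist x y) →
      Tendsto (fun n => ∫ ω, f ω ∂(μs n : Measure Ω)) atTop (𝓝 (∫ ω, f ω ∂(μ : Measure Ω)))) :
    Tendsto μs atTop (𝓝 μ) := by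
  have hmass : Tendsto (fun n => (μs n).mass) atTop (𝓝 μ.mass) := by
    have h1 := h (fun _ => 1) 0 (fun _ => by simp) (fun _ _ => by simp)
    simp only [integral_const, smul_eq_mul, mul_one] at h1
    exact NNReal.tendsto_coe.1 h1
  rcases eq_or_ne μ 0 with rfl | hμ
  · exact FiniteMeasure.tendsto_zero_of_tendsto_zero_mass (by simpa using hmass)
  have hne : Nonempty Ω := by
    by_contra hcon
    rw [not_nonempty_iff] at hcon
    exact hμ (by ext s _; simp [Set.eq_empty_of_isEmpty s])
  have hmass0 : μ.mass ≠ 0 := μ.mass_nonzero_iff.2 hμ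
  refine FiniteMeasure.tendsto_of_tendsto_normalize_testAgainstNN_of_tendsto_mass ?_ hmass
  rw [tendsto_iff_forall_lipschitz_integral_tendsto]
  rintro f ⟨C, hC⟩ ⟨L, hL⟩
  obtain ⟨x₀⟩ := hne
  have hC0 : 0 ≤ C := dist_nonneg.trans (hC x₀ x₀)
  have hC1 : 0 < 2 * C + 1 := by positivity
  set g : Ω → ℝ := fun ω => (f ω - f x₀ + C) / (2 * C + 1) with hg
  have hg01 : ∀ ω, 0 ≤ g ω ∧ g ω ≤ 1 := by
    intro ω
    have := abs_le.1 (hC ω x₀)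
    constructor
    · exact div_nonneg (by linarith) hC1.le
    · rw [hg, div_le_one hC1]; linarith
  have hgL : ∀ x y, |g x - g y| ≤ (L / (2 * C + 1)) * dist x y := by
    intro x y
    have h1 := hL.dist_le_mul x y
    rw [Real.dist_eq] at h1
    have h2 : g x - g y = (f x - f y) / (2 * C + 1) := by rw [hg]; ring
    rw [h2, abs_div, abs_of_pos hC1, div_mul_eq_mul_div]
    gcongr
  have hgm : Measurable g := (continuous_of_lipschitz hgL).measurable
  have : Nonempty Ω := ⟨x₀⟩
  have hnorm : ∀ κ : FiniteMeasure Ω, κ ≠ 0 → ∫ ω, f ω ∂(κ.normalize : Measure Ω) =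
      (2 * C + 1) * ((κ.mass : ℝ)⁻¹ * ∫ ω, g ω ∂(κ : Measure Ω)) + (f x₀ - C) := by
    intro κ hκ
    have h1 : ∀ ω, f ω = (2 * C + 1) * g ω + (f x₀ - C) := fun ω => by
      rw [hg]; field_simp; ring
    rw [integral_congr_ae (ae_of_all _ h1), integral_add
      ((integrable_of_mem_Icc hgm hg01).const_mul _) (integrable_const _), integral_const_mul,
      ← FiniteMeasure.average_eq_integral_normalize (μ := κ) hκ, average_eq]
    rw [smul_eq_mul, integral_const, smul_eq_mul,
      probReal_univ (μ := (κ.normalize : Measure Ω)), one_mul]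
    rfl
  rw [hnorm μ hμ]
  have hev : ∀ᶠ n in atTop, μs n ≠ 0 := by
    filter_upwards [hmass.eventually_ne hmass0] with n hn
    exact (μs n).mass_nonzero_iff.1 hn
  refine Tendsto.congr' (hev.mono fun n hn => (hnorm _ hn).symm) ?_
  refine Tendsto.add_const _ (Tendsto.const_mul _ (Tendsto.mul ?_ (h g _ hg01 hgL)))
  exact (NNReal.tendsto_coe.2 hmass).inv₀ (by exact_mod_cast hmass0)

/-- The piecewise linear cutoff function that is `1` up to `R` and `0` from `R + δ` on. -/
noncomputable def cutoff (R δ t : ℝ) : ℝ := max 0 (min 1 (1 - (t - R) / δ))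

theorem cutoff_mem (R δ t : ℝ) : 0 ≤ cutoff R δ t ∧ cutoff R δ t ≤ 1 :=
  ⟨le_max_left _ _, max_le zero_le_one (min_le_left _ _)⟩

theorem cutoff_eq_one {R δ t : ℝ} (hδ : 0 < δ) (h : t ≤ R) : cutoff R δ t = 1 := by
  have : (t - R) / δ ≤ 0 := div_nonpos_of_nonpos_of_nonneg (by linarith) hδ.le
  rw [cutoff, min_eq_left (by linarith), max_eq_right zero_le_one]

theorem cutoff_eq_zero {R δ t : ℝ} (hδ : 0 < δ) (h : R + δ ≤ t) : cutoff R δ t = 0 := by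
  have : 1 ≤ (t - R) / δ := (one_le_div hδ).2 (by linarith)
  exact max_eq_left ((min_le_right _ _).trans (by linarith))

theorem abs_cutoff_sub_le {R δ : ℝ} (hδ : 0 < δ) (s t : ℝ) :
    |cutoff R δ s - cutoff R δ t| ≤ 1 / δ * |s - t| := by
  refine (abs_max_sub_max_le_max _ _ _ _).trans ?_
  rw [sub_self, abs_zero, max_eq_right (abs_nonneg _)]
  refine (abs_min_sub_min_le_max _ _ _ _).trans ?_
  rw [sub_self, abs_zero, max_eq_right (abs_nonneg _)]
  rw [show 1 - (s - R) / δ - (1 - (t - R) / δ) = -(1 / δ * (s - t)) by ring, abs_neg, abs_mul,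
    abs_of_pos (one_div_pos.2 hδ)]

theorem continuous_cutoff (R δ : ℝ) : Continuous (cutoff R δ) := by
  unfold cutoff; fun_prop

theorem abs_mul_sub_mul_le {a b c d : ℝ} (hb : 0 ≤ b ∧ b ≤ 1) (hc : 0 ≤ c ∧ c ≤ 1) :
    |a * b - c * d| ≤ |a - c| + |b - d| := by
  have h : a * b - c * d = (a - c) * b + c * (b - d) := by ring
  rw [h]
  refine (abs_add_le _ _).trans ?_
  rw [abs_mul, abs_mul, abs_of_nonneg hb.1, abs_of_nonneg hc.1]
  exact add_le_add (mul_le_of_le_one_right (abs_nonneg _) hb.2)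
    (mul_le_of_le_one_left (abs_nonneg _) hc.2)

namespace MMSpace

/-! ### Test integrals -/

instance (X : MMSpace) : SecondCountableTopology X.carrier :=
  UniformSpace.secondCountable_of_separable _

instance (X : MMSpace) : IsLocallyFiniteMeasure X.measure :=
  ⟨fun x => ⟨Metric.ball x 1, Metric.ball_mem_nhds x one_pos,
    X.boundedlyFinite _ Metric.isBounded_ball⟩⟩

instance (X : MMSpace) (R : ℝ) :
    IsFiniteMeasure (X.measure.restrict (Metric.closedBall X.root R)) :=
  restrict_isFiniteMeasure X R

/-- The integral of a function of the distance matrix of the root and `k` points. -/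
noncomputable def testIntegral (X : MMSpace) (k : ℕ) (F : (Fin (k + 1) → Fin (k + 1) → ℝ) → ℝ) :
    ℝ :=
  ∫ x : Fin k → X.carrier, F (distMat (Fin.cons X.root x)) ∂(Measure.pi fun _ => X.measure)

/-- Convergence of the test integrals of Lipschitz functions with bounded support. It is
equivalent to Gromov-vague convergence, and has no exceptional radii. -/
def TestConvergence (X : ℕ → MMSpace) (Y : MMSpace) : Prop :=
  ∀ (k : ℕ) (F : (Fin (k + 1) → Fin (k + 1) → ℝ) → ℝ) (L R : ℝ), (∀ a, 0 ≤ F a ∧ F a ≤ 1) →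
    (∀ a b, |F a - F b| ≤ L * dist a b) → (∀ a, F a ≠ 0 → ∀ i, a 0 i ≤ R) →
    Tendsto (fun n => (X n).testIntegral k F) atTop (𝓝 (Y.testIntegral k F))

theorem testIntegral_eq_restrict (X : MMSpace) {k : ℕ}
    {F : (Fin (k + 1) → Fin (k + 1) → ℝ) → ℝ} {R : ℝ} (hF : ∀ a, F a ≠ 0 → ∀ i, a 0 i ≤ R) :
    X.testIntegral k F = ∫ x : Fin k → X.carrier, F (distMat (Fin.cons X.root x))
      ∂(Measure.pi fun _ => X.measure.restrict (Metric.closedBall X.root R)) := by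
  rw [← Measure.restrict_pi_pi]
  refine (setIntegral_eq_integral_of_forall_compl_eq_zero fun x hx => ?_).symm
  by_contra h
  refine hx fun i _ => ?_
  have := hF _ h i.succ
  simp only [distMat, Fin.cons_zero, Fin.cons_succ] at this
  rwa [Metric.mem_closedBall, dist_comm]

/-- The upper triangle of a full matrix. -/
noncomputable def upperTriangle (m : ℕ) (a : Fin (m + 1) → Fin (m + 1) → ℝ) : Pairs m → NNReal :=
  fun p => Real.toNNReal (a p.1.1 p.1.2)

theorem dist_upperTriangle_le {m : ℕ} (a b : Fin (m + 1) → Fin (m + 1) → ℝ) :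
    dist (upperTriangle m a) (upperTriangle m b) ≤ dist a b := by
  refine (dist_pi_le_iff dist_nonneg).2 fun p => ?_
  refine le_trans ?_ ((dist_le_pi_dist (a p.1.1) (b p.1.1) p.1.2).trans (dist_le_pi_dist a b p.1.1))
  exact (abs_max_sub_max_le_abs _ _ _)

theorem continuous_upperTriangle (m : ℕ) : Continuous (upperTriangle m) :=
  continuous_pi fun p =>
    continuous_real_toNNReal.comp ((continuous_apply p.1.2).comp (continuous_apply p.1.1))

theorem distMatrix_eq (X : MMSpace) (m : ℕ) (x : Fin m → X.carrier) :
    X.distMatrix m x = upperTriangle m (distMat (Fin.cons X.root x)) := by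
  funext p
  refine NNReal.eq ?_
  simp only [distMatrix, upperTriangle, distMat, coe_nndist]
  rw [Real.coe_toNNReal _ dist_nonneg]

theorem integral_distMatrixLaw (X : MMSpace) [IsFiniteMeasure X.measure] (m : ℕ)
    {f : (Pairs m → NNReal) → ℝ} (hf : Continuous f) :
    ∫ a, f a ∂(X.distMatrixLaw m : Measure (Pairs m → NNReal)) =
      X.testIntegral m fun a => f (upperTriangle m a) := by
  have h : X.distMatrix m = fun x => upperTriangle m (distMat (Fin.cons X.root x)) :=
    funext (X.distMatrix_eq m)
  have hm : Measurable (X.distMatrix m) := by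
    rw [h]
    exact (continuous_upperTriangle m).measurable.comp
      (measurable_distMat.comp (measurable_finCons _))
  change ∫ a, f a ∂((Measure.pi fun _ : Fin m => X.measure).map (X.distMatrix m)) = _
  rw [integral_map hm.aemeasurable hf.aestronglyMeasurable]
  simp only [distMatrix_eq]
  rfl

theorem integral_distMatrixLaw_restrict (X : MMSpace) (R : ℝ) (m : ℕ)
    {f : (Pairs m → NNReal) → ℝ} (hf : Continuous f) :
    ∫ a, f a ∂((X.restrict R).distMatrixLaw m : Measure (Pairs m → NNReal)) =
      ∫ x : Fin m → X.carrier, f (upperTriangle m (distMat (Fin.cons X.root x)))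
        ∂(Measure.pi fun _ => X.measure.restrict (Metric.closedBall X.root R)) :=
  integral_distMatrixLaw (X.restrict R) m hf

theorem norm_distMat_root_le_iff {X : MMSpace} {m : ℕ} {x : Fin m → X.carrier} {R : ℝ}
    (hR : 0 ≤ R) : ‖(distMat (Fin.cons X.root x : Fin (m + 1) → X.carrier)) 0‖ ≤ R ↔
      ∀ i, x i ∈ Metric.closedBall X.root R := by
  rw [pi_norm_le_iff_of_nonneg hR, Fin.forall_fin_succ]
  simp only [distMat, Fin.cons_zero, Fin.cons_succ, dist_self, norm_zero, Real.norm_eq_abs,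
    abs_dist, Metric.mem_closedBall, dist_comm X.root, and_iff_right hR]

theorem ae_measure_sphere_eq_zero (X : MMSpace) :
    ∀ᵐ R : ℝ, X.measure {x | dist x X.root = R} = 0 := by
  have h : Set.Countable {R : ℝ | 0 < X.measure {x | dist x X.root = R}} :=
    Measure.countable_meas_level_set_pos (measurable_id.dist measurable_const)
  have h2 := h.ae_notMem volume
  filter_upwards [h2] with R hR
  exact not_not.1 fun hne => hR (pos_iff_ne_zero.2 hne)

/-- At a radius whose sphere has no mass in the limit, the indicator function of the ball is
squeezed between cutoff functions. -/
theorem TestConvergence.gromovWeakTendsto_restrict {X : ℕ → MMSpace} {Y : MMSpace}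
    (h : TestConvergence X Y) {R : ℝ} (hR : 0 < R)
    (hsph : Y.measure {y | dist y Y.root = R} = 0) :
    GromovWeakTendsto (fun n => (X n).restrict R) (Y.restrict R) := by
  intro m
  refine tendsto_finiteMeasure_of_lipschitz fun f L hf hfL => ?_
  have hfc := continuous_of_lipschitz hfL
  simp only [integral_distMatrixLaw_restrict _ R m hfc]
  -- the functions of the matrix that are compared
  let N : (Fin (m + 1) → Fin (m + 1) → ℝ) → ℝ := fun a => ‖a 0‖
  have hN : ∀ a b, |N a - N b| ≤ dist a b := fun a b =>
    (abs_norm_sub_norm_le _ _).trans ((dist_eq_norm (a 0) (b 0)).symm.trans_le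
      (dist_le_pi_dist a b 0))
  let F : ℝ → ℝ → (Fin (m + 1) → Fin (m + 1) → ℝ) → ℝ := fun r δ a =>
    f (upperTriangle m a) * cutoff r δ (N a)
  have hF01 : ∀ r δ a, 0 ≤ F r δ a ∧ F r δ a ≤ 1 := fun r δ a =>
    ⟨mul_nonneg (hf _).1 (cutoff_mem _ _ _).1,
      mul_le_one₀ (hf _).2 (cutoff_mem _ _ _).1 (cutoff_mem _ _ _).2⟩
  have hL0 : ∀ a b : Pairs m → NNReal, |f a - f b| ≤ |L| * dist a b := fun a b =>
    (hfL a b).trans (mul_le_mul_of_nonneg_right (le_abs_self L) dist_nonneg)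
  have hFL : ∀ r δ, 0 < δ → ∀ a b, |F r δ a - F r δ b| ≤ (|L| + 1 / δ) * dist a b := by
    intro r δ hδ a b
    refine (abs_mul_sub_mul_le (cutoff_mem _ _ _) (hf _)).trans ?_
    rw [add_mul]
    refine add_le_add ((hL0 _ _).trans ?_) ((abs_cutoff_sub_le hδ _ _).trans ?_)
    · exact mul_le_mul_of_nonneg_left (dist_upperTriangle_le a b) (abs_nonneg L)
    · exact mul_le_mul_of_nonneg_left (hN a b) (one_div_pos.2 hδ).le
  have hFsupp : ∀ r δ, 0 < δ → ∀ a, F r δ a ≠ 0 → ∀ i, a 0 i ≤ r + δ := by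
    intro r δ hδ a ha i
    by_contra! hcon
    refine ha ?_
    have h1 : r + δ ≤ N a := hcon.le.trans ((le_abs_self _).trans (norm_le_pi_norm (a 0) i))
    simp only [F]
    rw [cutoff_eq_zero hδ h1, mul_zero]
  have hFt : ∀ r δ, 0 < δ → Tendsto (fun n => (X n).testIntegral m (F r δ)) atTop
      (𝓝 (Y.testIntegral m (F r δ))) := fun r δ hδ =>
    h m (F r δ) _ _ (hF01 r δ) (hFL r δ hδ) (hFsupp r δ hδ)
  have hFm : ∀ r δ, 0 < δ → ∀ W : MMSpace, Measurable fun x : Fin m → W.carrier =>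
      F r δ (distMat (Fin.cons W.root x)) := fun r δ hδ W =>
    (continuous_of_lipschitz (hFL r δ hδ)).measurable.comp
      (measurable_distMat.comp (measurable_finCons _))
  -- everything takes place in the ball of radius `R + 1`
  have hT : ∀ r δ, 0 < δ → r + δ ≤ R + 1 → ∀ W : MMSpace, W.testIntegral m (F r δ) =
      ∫ x : Fin m → W.carrier, F r δ (distMat (Fin.cons W.root x))
      ∂(Measure.pi fun _ => W.measure.restrict (Metric.closedBall W.root (R + 1))) :=
    fun r δ hδ hr W => W.testIntegral_eq_restrict fun a ha i => (hFsupp r δ hδ a ha i).trans hr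
  let J : ∀ W : MMSpace, (Fin m → W.carrier) → ℝ := fun W =>
    {x : Fin m → W.carrier | N (distMat (Fin.cons W.root x)) ≤ R}.indicator
      (fun x => f (upperTriangle m (distMat (Fin.cons W.root x))))
  have hJ1 : ∀ W x, N (distMat (Fin.cons W.root x)) ≤ R →
      J W x = f (upperTriangle m (distMat (Fin.cons W.root x))) := fun W x hx =>
    Set.indicator_of_mem (s := {x : Fin m → W.carrier | N (distMat (Fin.cons W.root x)) ≤ R}) hx _
  have hJ0 : ∀ W x, ¬ N (distMat (Fin.cons W.root x)) ≤ R → J W x = 0 := fun W x hx =>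
    Set.indicator_of_notMem
      (s := {x : Fin m → W.carrier | N (distMat (Fin.cons W.root x)) ≤ R}) hx _
  have hI : ∀ W : MMSpace,
      ∫ x : Fin m → W.carrier, f (upperTriangle m (distMat (Fin.cons W.root x)))
        ∂(Measure.pi fun _ => W.measure.restrict (Metric.closedBall W.root R)) =
      ∫ x : Fin m → W.carrier, J W x
        ∂(Measure.pi fun _ => W.measure.restrict (Metric.closedBall W.root (R + 1))) := by
    intro W
    have h1 : {x : Fin m → W.carrier | N (distMat (Fin.cons W.root x)) ≤ R} =
        Set.univ.pi fun _ => Metric.closedBall W.root R := by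
      ext x
      simp only [N, Set.mem_ofPred_eq, norm_distMat_root_le_iff hR.le, Set.mem_univ_pi]
    simp only [J]
    rw [h1, integral_indicator (MeasurableSet.univ_pi fun _ =>
      Metric.isClosed_closedBall.measurableSet), Measure.restrict_pi_pi]
    simp_rw [Measure.restrict_restrict_of_subset
      (Metric.closedBall_subset_closedBall (x := W.root) (show R ≤ R + 1 by linarith))]
  have hIm : ∀ W : MMSpace, Measurable (J W) := by
    intro W
    have h1 : Measurable fun x : Fin m → W.carrier => distMat (Fin.cons W.root x) :=
      measurable_distMat.comp (measurable_finCons _)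
    refine Measurable.indicator (hfc.measurable.comp
      ((continuous_upperTriangle m).measurable.comp h1)) ?_
    have h2 : Measurable N := (continuous_norm.comp (continuous_apply 0)).measurable
    exact measurableSet_le (h2.comp h1) measurable_const
  have hI01 : ∀ (W : MMSpace) x, 0 ≤ J W x ∧ J W x ≤ 1 := fun W x =>
    ⟨Set.indicator_nonneg (fun x _ => (hf _).1) x,
      Set.indicator_le' (fun x _ => (hf _).2) (fun _ _ => zero_le_one) x⟩
  have hup : ∀ δ, 0 < δ → δ ≤ 1 → ∀ W : MMSpace, ∫ x : Fin m → W.carrier,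
        f (upperTriangle m (distMat (Fin.cons W.root x)))
        ∂(Measure.pi fun _ => W.measure.restrict (Metric.closedBall W.root R)) ≤
        W.testIntegral m (F R δ) := by
    intro δ hδ hδ1 W
    rw [hT R δ hδ (by linarith) W, hI W]
    refine integral_mono (integrable_of_mem_Icc (hIm W) (hI01 W))
      (integrable_of_mem_Icc (hFm R δ hδ W) fun x => hF01 _ _ _) fun x => ?_
    by_cases hx : N (distMat (Fin.cons W.root x)) ≤ R
    · rw [hJ1 W x hx]
      simp only [F]
      rw [cutoff_eq_one hδ hx, mul_one]
    · rw [hJ0 W x hx]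
      exact (hF01 _ _ _).1
  have hlo : ∀ δ, 0 < δ → δ ≤ 1 → ∀ W : MMSpace, W.testIntegral m (F (R - δ) δ) ≤
      ∫ x : Fin m → W.carrier, f (upperTriangle m (distMat (Fin.cons W.root x)))
        ∂(Measure.pi fun _ => W.measure.restrict (Metric.closedBall W.root R)) := by
    intro δ hδ hδ1 W
    rw [hT (R - δ) δ hδ (by linarith) W, hI W]
    refine integral_mono (integrable_of_mem_Icc (hFm _ δ hδ W) fun x => hF01 _ _ _)
      (integrable_of_mem_Icc (hIm W) (hI01 W)) fun x => ?_
    by_cases hx : N (distMat (Fin.cons W.root x)) ≤ R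
    · rw [hJ1 W x hx]
      exact mul_le_of_le_one_right (hf _).1 (cutoff_mem _ _ _).2
    · rw [hJ0 W x hx]
      simp only [F]
      rw [cutoff_eq_zero hδ (by linarith), mul_zero]
  -- the upper and lower approximations have the same limit
  let δs : ℕ → ℝ := fun j => 1 / ((j : ℝ) + 1)
  have hδ0 : ∀ j, 0 < δs j := fun j => Nat.one_div_pos_of_nat
  have hδ1 : ∀ j, δs j ≤ 1 := fun j => by
    simp only [δs]
    rw [div_le_one (by positivity)]; linarith [Nat.cast_nonneg (α := ℝ) j]
  have hδt : Tendsto δs atTop (𝓝 0) := tendsto_one_div_add_atTop_nhds_zero_nat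
  have hlimup : Tendsto (fun j => Y.testIntegral m (F R (δs j))) atTop (𝓝
      (∫ x : Fin m → Y.carrier, f (upperTriangle m (distMat (Fin.cons Y.root x)))
        ∂(Measure.pi fun _ => Y.measure.restrict (Metric.closedBall Y.root R)))) := by
    rw [hI Y]
    simp_rw [fun j => hT R (δs j) (hδ0 j) (by linarith [hδ1 j]) Y]
    refine tendsto_integral_of_dominated_convergence (fun _ => 1)
      (fun j => (hFm R _ (hδ0 j) Y).aestronglyMeasurable) (integrable_const 1)
      (fun j => ae_of_all _ fun x => ?_) (ae_of_all _ fun x => ?_)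
    · rw [Real.norm_of_nonneg (hF01 _ _ _).1]; exact (hF01 _ _ _).2
    · by_cases hx : N (distMat (Fin.cons Y.root x)) ≤ R
      · rw [hJ1 Y x hx]
        refine tendsto_const_nhds.congr fun j => ?_
        simp only [F]
        rw [cutoff_eq_one (hδ0 j) hx, mul_one]
      · rw [hJ0 Y x hx]
        have h1 : ∀ᶠ j in atTop, δs j < N (distMat (Fin.cons Y.root x)) - R :=
          hδt.eventually_lt_const (by linarith)
        refine tendsto_const_nhds.congr' (h1.mono fun j hj => ?_)
        simp only [F]
        rw [cutoff_eq_zero (hδ0 j) (by linarith), mul_zero]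
  have hlimlo : Tendsto (fun j => Y.testIntegral m (F (R - δs j) (δs j))) atTop (𝓝
      (∫ x : Fin m → Y.carrier, f (upperTriangle m (distMat (Fin.cons Y.root x)))
        ∂(Measure.pi fun _ => Y.measure.restrict (Metric.closedBall Y.root R)))) := by
    rw [hI Y]
    simp_rw [fun j => hT (R - δs j) (δs j) (hδ0 j) (by linarith) Y]
    refine tendsto_integral_of_dominated_convergence (fun _ => 1)
      (fun j => (hFm _ _ (hδ0 j) Y).aestronglyMeasurable) (integrable_const 1)
      (fun j => ae_of_all _ fun x => ?_) ?_
    · rw [Real.norm_of_nonneg (hF01 _ _ _).1]; exact (hF01 _ _ _).2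
    · have hnull : ∀ᵐ x : Fin m → Y.carrier ∂(Measure.pi fun _ =>
          Y.measure.restrict (Metric.closedBall Y.root (R + 1))), ∀ i, dist (x i) Y.root ≠ R := by
        refine ae_all_iff.2 fun i => ?_
        refine (Measure.tendsto_eval_ae_ae (i := i)).eventually (p := fun y => dist y Y.root ≠ R) ?_
        rw [ae_iff]
        simp only [not_not]
        exact le_antisymm ((Measure.restrict_apply_le _ _).trans_eq hsph) zero_le
      filter_upwards [hnull] with x hx
      have hne : N (distMat (Fin.cons Y.root x)) ≠ R := by
        intro hcon
        refine hcon.not_lt ((pi_norm_lt_iff hR).2 fun i => ?_)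
        have hi : ‖distMat (Fin.cons Y.root x : Fin (m + 1) → Y.carrier) 0 i‖ ≤ R :=
          (norm_le_pi_norm _ i).trans_eq hcon
        induction i using Fin.cases with
        | zero => simpa [distMat] using hR
        | succ i =>
          simp only [distMat, Fin.cons_zero, Fin.cons_succ, Real.norm_eq_abs, abs_dist] at hi ⊢
          rw [dist_comm] at hi ⊢
          exact lt_of_le_of_ne hi (hx i)
      rcases lt_or_gt_of_ne hne with hlt | hgt
      · rw [hJ1 Y x hlt.le]
        have h1 : ∀ᶠ j in atTop, δs j < R - N (distMat (Fin.cons Y.root x)) :=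
          hδt.eventually_lt_const (by linarith)
        refine tendsto_const_nhds.congr' (h1.mono fun j hj => ?_)
        simp only [F]
        rw [cutoff_eq_one (hδ0 j) (by linarith), mul_one]
      · rw [hJ0 Y x hgt.not_ge]
        refine tendsto_const_nhds.congr fun j => ?_
        simp only [F]
        rw [cutoff_eq_zero (hδ0 j) (by linarith), mul_zero]
  refine tendsto_order.2 ⟨fun c hc => ?_, fun c hc => ?_⟩
  · obtain ⟨j, hj⟩ := (hlimlo.eventually_const_lt hc).exists
    filter_upwards [(hFt (R - δs j) (δs j) (hδ0 j)).eventually_const_lt hj] with n hn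
    exact hn.trans_le (hlo _ (hδ0 j) (hδ1 j) (X n))
  · obtain ⟨j, hj⟩ := (hlimup.eventually_lt_const hc).exists
    filter_upwards [(hFt R (δs j) (hδ0 j)).eventually_lt_const hj] with n hn
    exact (hup _ (hδ0 j) (hδ1 j) (X n)).trans_lt hn

theorem TestConvergence.gromovVagueTendsto {X : ℕ → MMSpace} {Y : MMSpace}
    (h : TestConvergence X Y) : GromovVagueTendsto X Y := by
  rw [GromovVagueTendsto, ae_restrict_iff' measurableSet_Ioi]
  filter_upwards [Y.ae_measure_sphere_eq_zero] with R hR hR0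
  exact h.gromovWeakTendsto_restrict hR0 hR

end MMSpace

/-! ### Test integrals and the Gromov-Prohorov distance -/

theorem distMat_cons_isometry {Z W : Type*} [PseudoMetricSpace Z] [PseudoMetricSpace W] {φ : Z → W}
    (hφ : Isometry φ) {k : ℕ} (z : Z) (x : Fin k → Z) :
    distMat (Fin.cons (φ z) (fun i => φ (x i)) : Fin (k + 1) → W) = distMat (Fin.cons z x) := by
  funext i j
  have h : ∀ i : Fin (k + 1), (Fin.cons (φ z) (fun i => φ (x i)) : Fin (k + 1) → W) i =
      φ ((Fin.cons z x : Fin (k + 1) → Z) i) := fun i => by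
    induction i using Fin.cases <;> simp
  simp only [distMat, h, hφ.dist_eq]

/-- An integral over the distance matrix of random points can be computed after an isometric
embedding. -/
theorem integral_distMat_map {Z W : Type*} [PseudoMetricSpace Z] [PseudoMetricSpace W]
    [SecondCountableTopology W] [MeasurableSpace Z] [MeasurableSpace W] [OpensMeasurableSpace W]
    {φ : Z → W} (hφ : Isometry φ) (hφm : Measurable φ) (μ : Measure Z) [IsFiniteMeasure μ] {k : ℕ}
    (z : Z) {F : (Fin (k + 1) → Fin (k + 1) → ℝ) → ℝ} (hF : Measurable F) :
    ∫ u : Fin k → W, F (distMat (Fin.cons (φ z) u)) ∂(Measure.pi fun _ => μ.map φ) =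
      ∫ x : Fin k → Z, F (distMat (Fin.cons z x)) ∂(Measure.pi fun _ => μ) := by
  rw [← Measure.pi_map_pi (fun _ => hφm.aemeasurable), integral_map]
  · simp only [distMat_cons_isometry hφ]
  · exact (measurable_pi_iff.2 fun i => hφm.comp (measurable_pi_apply i)).aemeasurable
  · exact (hF.comp (measurable_distMat.comp (measurable_finCons _))).aestronglyMeasurable

namespace MMSpace

instance {X Y : MMSpace} (d : SumMetric X Y) : SecondCountableTopology d.Space := by
  have h : TopologicalSpace.IsSeparable (Set.univ : Set d.Space) := by
    refine ((TopologicalSpace.isSeparable_range d.isometry_inl.continuous).union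
      (TopologicalSpace.isSeparable_range d.isometry_inr.continuous)).mono ?_
    rintro (x | y) _
    · exact Or.inl ⟨x, rfl⟩
    · exact Or.inr ⟨y, rfl⟩
  have := TopologicalSpace.isSeparable_univ_iff.1 h
  exact UniformSpace.secondCountable_of_separable _

instance {X Y : MMSpace} (d : SumMetric X Y) : OpensMeasurableSpace d.Space :=
  ⟨MeasurableSpace.generateFrom_le fun s hs => by
    simpa using (measurableSet_of_isClosed d (IsOpen.isClosed_compl hs)).compl⟩

/-- Test integrals are locally Lipschitz functions of the Gromov-Prohorov distance of the
restrictions. -/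
theorem abs_testIntegral_sub_le {X Y : MMSpace} {R ε : ℝ}
    (h : gromovProhorovDist (X.restrict R) (Y.restrict R) < ε) {M L : ℝ} (hM : 1 ≤ M)
    (hX : X.ballMass R ≤ M) (hY : Y.ballMass R ≤ M) {k : ℕ}
    {F : (Fin (k + 1) → Fin (k + 1) → ℝ) → ℝ} (hF : ∀ a, 0 ≤ F a ∧ F a ≤ 1) (hL : 0 ≤ L)
    (hFL : ∀ a b, |F a - F b| ≤ L * dist a b) (hFR : ∀ a, F a ≠ 0 → ∀ i, a 0 i ≤ R) :
    |X.testIntegral k F - Y.testIntegral k F| ≤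
      k * M ^ k * ((L * M + 1) * ε) + L * ε * M ^ k := by
  obtain ⟨D, a, hD, ha, hP, hc⟩ := exists_cross_restrict_of_gromovProhorovDist_lt h
  set μ := X.measure.restrict (Metric.closedBall X.root R) with hμ
  set ν := Y.measure.restrict (Metric.closedBall Y.root R) with hν
  -- a metric on the disjoint union needs a positive cross distance
  set δ := ε - (D X.root Y.root + a) with hδ
  have hδ0 : 0 < δ := sub_pos.2 hc
  have hD0 := hD.nonneg X.root Y.root
  let d := sumMetricOfCross (hD.add_const hδ0.le) fun x y =>
    add_pos_of_nonneg_of_pos (hD.nonneg x y) hδ0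
  have hcross : ∀ x y, dist (d.inl x) (d.inr y) = D x y + δ := fun x y => rfl
  have hPd : ProhorovClose μ ν (fun x y => dist (d.inl x) (d.inr y)) (a + δ) :=
    hP.mono (fun x y hxy => by rw [hcross]; linarith) (by linarith)
  have haδ : 0 ≤ a + δ := by linarith
  have haε : a + δ ≤ ε := by linarith
  have hμM : μ.real Set.univ ≤ M := by rw [hμ, measureReal_restrict_apply_univ]; exact hX
  have hνM : ν.real Set.univ ≤ M := by rw [hν, measureReal_restrict_apply_univ]; exact hY
  have hM0 : 0 ≤ M := zero_le_one.trans hM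
  have hFm : Measurable F := (continuous_of_lipschitz hFL).measurable
  have hmap : ∀ {Z : Type} [MeasurableSpace Z] (κ : Measure Z) {φ : Z → d.Space}, Measurable φ →
      (κ.map φ).real Set.univ = κ.real Set.univ := fun κ φ hφ => by
    rw [measureReal_def, Measure.map_apply hφ MeasurableSet.univ, Set.preimage_univ,
      measureReal_def]
  have key := abs_integral_distMat_sub_le (d.inl X.root) (d.inr Y.root) Set.univ
    (μ.map d.inl) (ν.map d.inr) (η := (L * M + 1) * ε) hM
    ((hmap μ d.measurable_inl).trans_le hμM) ((hmap ν d.measurable_inr).trans_le hνM)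
    (fun f hfm hf hfL _ => ?_) k F hF hL hFL fun _ _ _ => Set.mem_univ _
  · rw [integral_distMat_map d.isometry_inl d.measurable_inl μ _ hFm,
      integral_distMat_map d.isometry_inr d.measurable_inr ν _ hFm, hμ, hν,
      ← testIntegral_eq_restrict X hFR, ← testIntegral_eq_restrict Y hFR] at key
    refine key.trans (add_le_add le_rfl ?_)
    refine mul_le_mul_of_nonneg_right (mul_le_mul_of_nonneg_left ?_ hL) (pow_nonneg hM0 k)
    rw [hcross]; linarith
  · rw [integral_map d.measurable_inl.aemeasurable hfm.aestronglyMeasurable,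
      integral_map d.measurable_inr.aemeasurable hfm.aestronglyMeasurable]
    have hbound : ∀ t, t ≤ M → (L * t + 1) * (a + δ) ≤ (L * M + 1) * ε := fun t ht =>
      mul_le_mul (by linarith [mul_le_mul_of_nonneg_left ht hL]) haε haδ (by positivity)
    have h1 := hPd.integral_le haδ (hfm.comp d.measurable_inl) (hfm.comp d.measurable_inr)
      (fun x => hf _) (fun y => hf _) hL (fun x y => hfL _ _) MeasurableSet.univ
      fun _ _ _ _ => Set.mem_univ _
    have h2 := hPd.symm.integral_le haδ (hfm.comp d.measurable_inr) (hfm.comp d.measurable_inl)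
      (fun x => hf _) (fun y => hf _) hL (fun x y => by rw [abs_sub_comm]; exact hfL _ _)
      MeasurableSet.univ fun _ _ _ _ => Set.mem_univ _
    have h3 := hbound _ hμM
    have h4 := hbound _ hνM
    simp only [Function.comp_apply] at h1 h2
    rw [abs_le]
    constructor <;> linarith

/-- Masses of balls differ by at most the Gromov-Prohorov distance. -/
theorem abs_ballMass_sub_lt {X Y : MMSpace} {R ε : ℝ}
    (h : gromovProhorovDist (X.restrict R) (Y.restrict R) < ε) :
    |X.ballMass R - Y.ballMass R| < ε := by
  obtain ⟨D, a, hD, ha, hP, hc⟩ := exists_cross_restrict_of_gromovProhorovDist_lt h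
  have hD0 := hD.nonneg X.root Y.root
  have aux : ∀ {X Y : MMSpace} {D : X.carrier → Y.carrier → ℝ},
      ProhorovClose (X.measure.restrict (Metric.closedBall X.root R))
        (Y.measure.restrict (Metric.closedBall Y.root R)) D a →
      X.ballMass R ≤ Y.ballMass R + a := fun {X Y D} hP => by
    have h1 := hP.measure_univ_le
    rw [Measure.restrict_apply_univ, Measure.restrict_apply_univ,
      ← ofReal_measureReal (X.measure_closedBall_ne_top R),
      ← ofReal_measureReal (Y.measure_closedBall_ne_top R),
      ← ENNReal.ofReal_add measureReal_nonneg ha.le] at h1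
    exact (ENNReal.ofReal_le_ofReal_iff (add_nonneg measureReal_nonneg ha.le)).1 h1
  have h1 := aux hP
  have h2 := aux hP.symm
  rw [abs_lt]
  constructor <;> linarith

theorem testConvergence_of_localizedGromovProhorovDist {X : ℕ → MMSpace} {Y : MMSpace}
    (h : Tendsto (fun n => localizedGromovProhorovDist (X n) Y) atTop (𝓝 0)) :
    TestConvergence X Y := by
  intro k F L R hF hFL hFR
  set t := max R 0 with ht
  set M := Y.ballMass (t + 1) + 1 with hM
  have hY0 := Y.ballMass_nonneg (t + 1)
  have hM1 : 1 ≤ M := by linarith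
  have hFL' : ∀ a b, |F a - F b| ≤ |L| * dist a b := fun a b =>
    (hFL a b).trans (mul_le_mul_of_nonneg_right (le_abs_self L) dist_nonneg)
  set C := k * M ^ k * (|L| * M + 1) + |L| * M ^ k with hC
  have hC0 : 0 ≤ C := by positivity
  rw [Metric.tendsto_atTop]
  intro e he
  -- the error is at most `C * ε`
  set ε := min 1 (e / (C + 1)) with hε
  have hε0 : 0 < ε := lt_min one_pos (by positivity)
  have hε1 : ε ≤ 1 := min_le_left _ _
  have hCε : C * ε < e := by
    have : ε * (C + 1) ≤ e := by
      rw [← le_div_iff₀ (by positivity)]; exact min_le_right _ _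
    nlinarith
  have hpos : 0 < Real.exp (-(t + 1)) * ε := mul_pos (Real.exp_pos _) hε0
  obtain ⟨N, hN⟩ := (eventually_atTop.1 (h.eventually_lt_const hpos))
  refine ⟨N, fun n hn => ?_⟩
  obtain ⟨r, hr, hgp⟩ := exists_gromovProhorovDist_restrict_lt (le_max_right R 0) hε1 (hN n hn)
  have hYM : Y.ballMass r ≤ M := (Y.ballMass_mono hr.2).trans (by linarith)
  have hXM : (X n).ballMass r ≤ M := by
    have h1 := (abs_lt.1 (abs_ballMass_sub_lt hgp)).2
    have h2 := Y.ballMass_mono hr.2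
    linarith
  have h1 := abs_testIntegral_sub_le hgp hM1 hXM hYM hF (abs_nonneg L) hFL'
    fun a ha i => (hFR a ha i).trans ((le_max_left R 0).trans hr.1)
  rw [Real.dist_eq]
  refine h1.trans_lt (lt_of_eq_of_lt ?_ hCε)
  rw [hC]; ring

/-! ### Sampling functionals -/

/-- The full symmetric matrix of an upper triangle, with zero diagonal. -/
noncomputable def symmetrize (m : ℕ) (a : Pairs m → NNReal) : Fin (m + 1) → Fin (m + 1) → ℝ :=
  fun i j => if h : i < j then a ⟨(i, j), h⟩ else if h : j < i then a ⟨(j, i), h⟩ else 0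

theorem continuous_symmetrize (m : ℕ) : Continuous (symmetrize m) := by
  refine continuous_pi fun i => continuous_pi fun j => ?_
  unfold symmetrize
  split_ifs
  · exact NNReal.continuous_coe.comp (continuous_apply _)
  · exact NNReal.continuous_coe.comp (continuous_apply _)
  · exact continuous_const

theorem symmetrize_upperTriangle_distMat {Z : Type*} [PseudoMetricSpace Z] {m : ℕ}
    (u : Fin (m + 1) → Z) : symmetrize m (upperTriangle m (distMat u)) = distMat u := by
  funext i j
  unfold symmetrize upperTriangle distMat
  split_ifs with h h'
  · exact Real.coe_toNNReal _ dist_nonneg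
  · rw [dist_comm (u i)]; exact Real.coe_toNNReal _ dist_nonneg
  · rw [le_antisymm (not_lt.1 h') (not_lt.1 h), dist_self]

theorem GromovWeakTendsto.tendsto_testIntegral {X : ℕ → MMSpace} {Y : MMSpace}
    [∀ n, IsFiniteMeasure (X n).measure] [IsFiniteMeasure Y.measure] (h : GromovWeakTendsto X Y)
    (m : ℕ) {F : (Fin (m + 1) → Fin (m + 1) → ℝ) → ℝ} (hF : Continuous F)
    (hb : ∃ C, ∀ a, |F a| ≤ C) :
    Tendsto (fun n => (X n).testIntegral m F) atTop (𝓝 (Y.testIntegral m F)) := by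
  obtain ⟨C, hC⟩ := hb
  have hc : Continuous fun a => F (symmetrize m a) := hF.comp (continuous_symmetrize m)
  have h1 := (FiniteMeasure.tendsto_iff_forall_integral_tendsto.1 (h m))
    (BoundedContinuousFunction.ofNormedAddCommGroup _ hc C fun a => hC _)
  have h2 : ∀ (Z : MMSpace) [IsFiniteMeasure Z.measure],
      ∫ a, F (symmetrize m a) ∂(Z.distMatrixLaw m : Measure (Pairs m → NNReal)) =
        Z.testIntegral m F := fun Z _ => by
    rw [integral_distMatrixLaw Z m hc]
    simp only [testIntegral, symmetrize_upperTriangle_distMat]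
  simp only [BoundedContinuousFunction.coe_ofNormedAddCommGroup] at h1
  rw [h2] at h1
  exact h1.congr fun n => h2 (X n)

theorem GromovWeakTendsto.tendsto_mass {X : ℕ → MMSpace} {Y : MMSpace}
    [∀ n, IsFiniteMeasure (X n).measure] [IsFiniteMeasure Y.measure]
    (hXY : GromovWeakTendsto X Y) :
    Tendsto (fun n => (X n).measure.real Set.univ) atTop (𝓝 (Y.measure.real Set.univ)) := by
  have h1 := hXY.tendsto_testIntegral 1 (F := fun _ => 1) continuous_const ⟨1, fun _ => by simp⟩
  simpa [testIntegral, measureReal_pi_univ] using h1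

theorem integral_pi_snoc {Z : Type*} [MeasurableSpace Z] (μ : Measure Z) [SigmaFinite μ]
    {k : ℕ} {G : (Fin (k + 1) → Z) → ℝ} (hG : Integrable G (Measure.pi fun _ => μ)) :
    ∫ u, G u ∂(Measure.pi fun _ => μ) =
      ∫ u : Fin k → Z, ∫ z, G (Fin.snoc u z) ∂μ ∂(Measure.pi fun _ => μ) := by
  obtain ⟨h1, h2⟩ := integral_pi_insertNth μ (Fin.last k) hG
  rw [h2, integral_prod_symm _ h1]
  simp only [Fin.insertNth_last']

/-- A functional `h` of `k` points of a space is sample convergent if its integral against the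
`k`-fold product measure, weighted with a function of the distance matrix of these and further
sampled points, converges. Keeping the further points in the definition makes the class closed
under multiplication by averages over one more sampled point. -/
structure SampleConvergent (X : ℕ → MMSpace) (Y : MMSpace) {k : ℕ}
    (h : ∀ Z : MMSpace, (Fin k → Z.carrier) → ℝ) : Prop where
  measurable : ∀ (Z : MMSpace) [IsFiniteMeasure Z.measure], Measurable (h Z)
  bounded : ∀ (Z : MMSpace) [IsFiniteMeasure Z.measure], ∃ C, ∀ x, |h Z x| ≤ C
  tendsto : ∀ (l : ℕ) (F : (Fin (k + l + 1) → Fin (k + l + 1) → ℝ) → ℝ), Continuous F →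
    (∃ C, ∀ a, |F a| ≤ C) →
    Tendsto (fun n => ∫ u : Fin (k + l) → (X n).carrier, h (X n) (fun i => u (Fin.castAdd l i)) *
      F (distMat (Fin.cons (X n).root u)) ∂(Measure.pi fun _ => (X n).measure)) atTop
      (𝓝 (∫ u : Fin (k + l) → Y.carrier, h Y (fun i => u (Fin.castAdd l i)) *
        F (distMat (Fin.cons Y.root u)) ∂(Measure.pi fun _ => Y.measure)))

/-- The average of a function of the distances of `k` given points to a sampled point. -/
noncomputable def sampleAverage {k : ℕ} (g : (Fin k → ℝ) → ℝ) (Z : MMSpace)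
    (x : Fin k → Z.carrier) : ℝ :=
  ∫ z, g (fun i => dist (x i) z) ∂Z.measure

theorem abs_sampleAverage_le {k : ℕ} {g : (Fin k → ℝ) → ℝ} (h : ∀ a, 0 ≤ g a ∧ g a ≤ 1)
    (Z : MMSpace) [IsFiniteMeasure Z.measure] (x : Fin k → Z.carrier) :
    |sampleAverage g Z x| ≤ Z.measure.real Set.univ := by
  refine (abs_integral_le_of_abs_le (C := 1) fun z => ?_).trans_eq (one_mul _)
  rw [abs_of_nonneg (h _).1]
  exact (h _).2

theorem continuous_sampleAverage {k : ℕ} {g : (Fin k → ℝ) → ℝ} (hg : Continuous g)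
    (h : ∀ a, 0 ≤ g a ∧ g a ≤ 1) (Z : MMSpace) [IsFiniteMeasure Z.measure] :
    Continuous (sampleAverage g Z) := by
  refine continuous_of_dominated (bound := fun _ => 1) (fun x => ?_) (fun x => ?_)
    (integrable_const 1) (ae_of_all _ fun z => ?_)
  · exact (hg.comp (continuous_pi fun i => by fun_prop)).aestronglyMeasurable
  · refine ae_of_all _ fun z => ?_
    rw [Real.norm_of_nonneg (h _).1]
    exact (h _).2
  · exact hg.comp (continuous_pi fun i => by fun_prop)

namespace SampleConvergent

variable {X : ℕ → MMSpace} {Y : MMSpace} {k : ℕ} {h h' : ∀ Z : MMSpace, (Fin k → Z.carrier) → ℝ}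

theorem integrable (hh : SampleConvergent X Y h) (Z : MMSpace) [IsFiniteMeasure Z.measure] {l : ℕ}
    {F : (Fin (k + l + 1) → Fin (k + l + 1) → ℝ) → ℝ} (hF : Continuous F)
    (hb : ∃ C, ∀ a, |F a| ≤ C) :
    Integrable (fun u : Fin (k + l) → Z.carrier => h Z (fun i => u (Fin.castAdd l i)) *
      F (distMat (Fin.cons Z.root u))) (Measure.pi fun _ => Z.measure) := by
  obtain ⟨C, hC⟩ := hb
  obtain ⟨B, hB⟩ := hh.bounded Z
  refine Integrable.of_bound (C := B * C) (Measurable.aestronglyMeasurable ?_)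
    (ae_of_all _ fun u => ?_)
  · have h1 : Measurable fun u : Fin (k + l) → Z.carrier => F (distMat (Fin.cons Z.root u)) :=
      hF.measurable.comp (measurable_distMat.comp (measurable_finCons _))
    have h2 : Measurable fun u : Fin (k + l) → Z.carrier => h Z fun i => u (Fin.castAdd l i) :=
      (hh.measurable Z).comp (measurable_pi_iff.2 fun i => measurable_pi_apply _)
    exact h2.mul h1
  · rw [norm_mul]
    exact mul_le_mul (hB _) (hC _) (abs_nonneg _) ((abs_nonneg _).trans (hB fun _ => Z.root))

theorem const [∀ n, IsFiniteMeasure (X n).measure] [IsFiniteMeasure Y.measure]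
    (hXY : GromovWeakTendsto X Y) (c : ℝ) :
    SampleConvergent X Y (fun _ (_ : Fin k → _) => c) where
  measurable _ _ := measurable_const
  bounded _ _ := ⟨|c|, fun _ => le_rfl⟩
  tendsto l F hF hb := by
    simp only [integral_const_mul]
    exact (hXY.tendsto_testIntegral (k + l) hF hb).const_mul c

theorem add [∀ n, IsFiniteMeasure (X n).measure] [IsFiniteMeasure Y.measure]
    (hh : SampleConvergent X Y h) (hh' : SampleConvergent X Y h') :
    SampleConvergent X Y (fun Z x => h Z x + h' Z x) where
  measurable Z _ := (hh.measurable Z).add (hh'.measurable Z)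
  bounded Z _ := by
    obtain ⟨C, hC⟩ := hh.bounded Z
    obtain ⟨C', hC'⟩ := hh'.bounded Z
    exact ⟨C + C', fun x => (abs_add_le _ _).trans (add_le_add (hC x) (hC' x))⟩
  tendsto l F hF hb := by
    have key : ∀ (Z : MMSpace) [IsFiniteMeasure Z.measure],
        ∫ u : Fin (k + l) → Z.carrier, (h Z (fun i => u (Fin.castAdd l i)) +
          h' Z (fun i => u (Fin.castAdd l i))) * F (distMat (Fin.cons Z.root u))
          ∂(Measure.pi fun _ => Z.measure) =
        ∫ u : Fin (k + l) → Z.carrier, h Z (fun i => u (Fin.castAdd l i)) *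
          F (distMat (Fin.cons Z.root u)) ∂(Measure.pi fun _ => Z.measure) +
        ∫ u : Fin (k + l) → Z.carrier, h' Z (fun i => u (Fin.castAdd l i)) *
          F (distMat (Fin.cons Z.root u)) ∂(Measure.pi fun _ => Z.measure) := fun Z _ => by
      simp only [add_mul]
      exact integral_add (hh.integrable Z hF hb) (hh'.integrable Z hF hb)
    simp only [key]
    exact (hh.tendsto l F hF hb).add (hh'.tendsto l F hF hb)

theorem const_mul (hh : SampleConvergent X Y h) (c : ℝ) :
    SampleConvergent X Y (fun Z x => c * h Z x) where
  measurable Z _ := (hh.measurable Z).const_mul c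
  bounded Z _ := by
    obtain ⟨C, hC⟩ := hh.bounded Z
    exact ⟨|c| * C, fun x => by
      rw [abs_mul]; exact mul_le_mul_of_nonneg_left (hC x) (abs_nonneg c)⟩
  tendsto l F hF hb := by
    simp only [mul_assoc, integral_const_mul]
    exact (hh.tendsto l F hF hb).const_mul c

theorem sum [∀ n, IsFiniteMeasure (X n).measure] [IsFiniteMeasure Y.measure]
    (hXY : GromovWeakTendsto X Y) {ι : Type*} (s : Finset ι)
    {H : ι → ∀ Z : MMSpace, (Fin k → Z.carrier) → ℝ} (hH : ∀ i, SampleConvergent X Y (H i)) :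
    SampleConvergent X Y (fun Z x => ∑ i ∈ s, H i Z x) := by
  classical
  induction s using Finset.induction_on with
  | empty => simpa using const hXY 0
  | insert a s ha ih =>
    simp only [Finset.sum_insert ha]
    exact (hH a).add ih

theorem mul_sampleAverage [∀ n, IsFiniteMeasure (X n).measure] [IsFiniteMeasure Y.measure]
    (hh : SampleConvergent X Y h) {g : (Fin k → ℝ) → ℝ} (hg : Continuous g)
    (hg01 : ∀ a, 0 ≤ g a ∧ g a ≤ 1) :
    SampleConvergent X Y (fun Z x => h Z x * sampleAverage g Z x) where
  measurable Z _ := (hh.measurable Z).mul (continuous_sampleAverage hg hg01 Z).measurable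
  bounded Z _ := by
    obtain ⟨C, hC⟩ := hh.bounded Z
    refine ⟨C * Z.measure.real Set.univ, fun x => ?_⟩
    rw [abs_mul]
    exact mul_le_mul (hC x) (abs_sampleAverage_le hg01 Z x) (abs_nonneg _)
      ((abs_nonneg _).trans (hC x))
  tendsto l F hF hb := by
    -- the average over one more point is absorbed into the function of the distance matrix
    let F' : (Fin (k + (l + 1) + 1) → Fin (k + (l + 1) + 1) → ℝ) → ℝ := fun a =>
      F (fun i j => a (Fin.castSucc i) (Fin.castSucc j)) *
        g (fun i => a (Fin.castSucc (Fin.succ (Fin.castAdd l i))) (Fin.last _))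
    have hF' : Continuous F' := (hF.comp (by fun_prop)).mul (hg.comp (by fun_prop))
    have hb' : ∃ C, ∀ a, |F' a| ≤ C := by
      obtain ⟨C, hC⟩ := hb
      refine ⟨C, fun a => ?_⟩
      simp only [F']
      rw [abs_mul, abs_of_nonneg (hg01 _).1]
      exact (mul_le_of_le_one_right (abs_nonneg _) (hg01 _).2).trans (hC _)
    have hF'eq : ∀ (Z : MMSpace) (u : Fin (k + l) → Z.carrier) (z : Z.carrier),
        F' (distMat (Fin.cons Z.root (Fin.snoc u z : Fin (k + l + 1) → Z.carrier))) =
          F (distMat (Fin.cons Z.root u)) * g (fun i => dist (u (Fin.castAdd l i)) z) := by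
      intro Z u z
      have h1 : (Fin.cons Z.root (Fin.snoc u z : Fin (k + l + 1) → Z.carrier) :
          Fin (k + l + 1 + 1) → Z.carrier) =
          Fin.snoc (Fin.cons Z.root u : Fin (k + l + 1) → Z.carrier) z :=
        Fin.cons_snoc_eq_snoc_cons _ _ _
      simp only [F', distMat]
      erw [h1]
      simp only [Fin.snoc_castSucc, Fin.cons_succ]
      erw [Fin.snoc_last]
      rfl
    have key : ∀ (Z : MMSpace) [IsFiniteMeasure Z.measure],
        ∫ u : Fin (k + (l + 1)) → Z.carrier, h Z (fun i => u (Fin.castAdd (l + 1) i)) *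
          F' (distMat (Fin.cons Z.root u)) ∂(Measure.pi fun _ => Z.measure) =
        ∫ u : Fin (k + l) → Z.carrier, (h Z (fun i => u (Fin.castAdd l i)) *
          sampleAverage g Z (fun i => u (Fin.castAdd l i))) *
          F (distMat (Fin.cons Z.root u)) ∂(Measure.pi fun _ => Z.measure) := fun Z _ => by
      have h2 := integral_pi_snoc (k := k + l) Z.measure (hh.integrable Z hF' hb')
      refine h2.trans (integral_congr_ae (ae_of_all _ fun u => ?_))
      simp only [sampleAverage]
      rw [mul_right_comm, ← integral_const_mul]
      refine integral_congr_ae (ae_of_all _ fun z => ?_)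
      have h3 : ∀ i, (Fin.snoc u z : Fin (k + l + 1) → Z.carrier) (Fin.castAdd (l + 1) i) =
          u (Fin.castAdd l i) := fun i =>
        Fin.snoc_castSucc (α := fun _ => Z.carrier) z u (Fin.castAdd l i)
      simp only [hF'eq, h3, mul_assoc]
    have h4 := hh.tendsto (l + 1) F' hF' hb'
    simp only [key] at h4
    exact h4

end SampleConvergent
/-- The squared distance of a family of sample averages to prescribed values. -/
noncomputable def sampleDeviation {ι : Type} [Fintype ι] {k : ℕ} (g : ι → (Fin k → ℝ) → ℝ)
    (c : ι → ℝ) (Z : MMSpace) (x : Fin k → Z.carrier) : ℝ :=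
  ∑ i, (sampleAverage (g i) Z x - c i) ^ 2

theorem sampleDeviation_nonneg {ι : Type} [Fintype ι] {k : ℕ} (g : ι → (Fin k → ℝ) → ℝ)
    (c : ι → ℝ) (Z : MMSpace) (x : Fin k → Z.carrier) : 0 ≤ sampleDeviation g c Z x :=
  Finset.sum_nonneg fun _ _ => sq_nonneg _

theorem continuous_sampleDeviation {ι : Type} [Fintype ι] {k : ℕ} {g : ι → (Fin k → ℝ) → ℝ}
    (hg : ∀ i, Continuous (g i)) (hg01 : ∀ i a, 0 ≤ g i a ∧ g i a ≤ 1) (c : ι → ℝ) (Z : MMSpace)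
    [IsFiniteMeasure Z.measure] : Continuous (sampleDeviation g c Z) :=
  continuous_finsetSum _ fun i _ =>
    ((continuous_sampleAverage (hg i) (hg01 i) Z).sub continuous_const).pow 2

namespace SampleConvergent

variable {X : ℕ → MMSpace} {Y : MMSpace} {k : ℕ} {h : ∀ Z : MMSpace, (Fin k → Z.carrier) → ℝ}
  {ι : Type} [Fintype ι] {g : ι → (Fin k → ℝ) → ℝ}

theorem mul_sampleDeviation [∀ n, IsFiniteMeasure (X n).measure] [IsFiniteMeasure Y.measure]
    (hXY : GromovWeakTendsto X Y) (hh : SampleConvergent X Y h) (hg : ∀ i, Continuous (g i))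
    (hg01 : ∀ i a, 0 ≤ g i a ∧ g i a ≤ 1) (c : ι → ℝ) :
    SampleConvergent X Y (fun Z x => h Z x * sampleDeviation g c Z x) := by
  have h1 : ∀ i, SampleConvergent X Y (fun Z x => h Z x * (sampleAverage (g i) Z x - c i) ^ 2) := by
    intro i
    have h2 := hh.mul_sampleAverage (hg i) (hg01 i)
    have h3 := ((h2.mul_sampleAverage (hg i) (hg01 i)).add (h2.const_mul (-2 * c i))).add
      (hh.const_mul (c i ^ 2))
    convert h3 using 3
    ring
  have h4 := sum hXY Finset.univ h1
  simpa only [sampleDeviation, Finset.mul_sum] using h4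

theorem polynomial_sampleDeviation [∀ n, IsFiniteMeasure (X n).measure]
    [IsFiniteMeasure Y.measure] (hXY : GromovWeakTendsto X Y) (hg : ∀ i, Continuous (g i))
    (hg01 : ∀ i a, 0 ≤ g i a ∧ g i a ≤ 1) (c : ι → ℝ) (p : Polynomial ℝ) :
    SampleConvergent X Y (fun Z x => p.eval (sampleDeviation g c Z x)) := by
  induction p using Polynomial.induction_on with
  | C a => simpa using const hXY a
  | add p q hp hq => simpa using hp.add hq
  | monomial n a ih =>
    have := mul_sampleDeviation hXY ih hg hg01 c
    convert this using 3
    simp [pow_succ, mul_assoc]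

end SampleConvergent

/-- Along a Gromov-weakly convergent sequence, finitely many points of the support of the limit can
be approximated: both their distances and the averages that they define. The latter are
no functions of a distance matrix, but polynomials in them become such after integration over
further sampled points, and a bump function is approximated by polynomials. -/
theorem GromovWeakTendsto.eventually_exists_points {X : ℕ → MMSpace} {Y : MMSpace}
    [∀ n, IsFiniteMeasure (X n).measure] [IsFiniteMeasure Y.measure] (hXY : GromovWeakTendsto X Y)
    {k : ℕ} (y : Fin k → Y.carrier) (hy : ∀ i, y i ∈ Y.measure.support) {ι : Type} [Fintype ι]
    (g : ι → (Fin k → ℝ) → ℝ) (hg : ∀ i, Continuous (g i)) (hg01 : ∀ i a, 0 ≤ g i a ∧ g i a ≤ 1)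
    {δ : ℝ} (hδ : 0 < δ) :
    ∀ᶠ n in atTop, ∃ x : Fin k → (X n).carrier,
      dist (distMat (Fin.cons (X n).root x)) (distMat (Fin.cons Y.root y)) < δ ∧
      ∀ i, |sampleAverage (g i) (X n) x - sampleAverage (g i) Y y| < δ := by
  let c : ι → ℝ := fun i => sampleAverage (g i) Y y
  let χ : (Fin (k + 1) → Fin (k + 1) → ℝ) → ℝ := fun a =>
    cutoff 0 δ (dist a (distMat (Fin.cons Y.root y)))
  let φ : ℝ → ℝ := cutoff 0 (δ ^ 2)
  have hδ2 : 0 < δ ^ 2 := by positivity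
  have hχ : Continuous χ := (continuous_cutoff _ _).comp (continuous_id.dist continuous_const)
  have hφ : Continuous φ := continuous_cutoff _ _
  have hχ01 : ∀ a, 0 ≤ χ a ∧ χ a ≤ 1 := fun a => cutoff_mem _ _ _
  have hφ01 : ∀ t, 0 ≤ φ t ∧ φ t ≤ 1 := fun a => cutoff_mem _ _ _
  let J : MMSpace → ℝ := fun Z => ∫ u : Fin k → Z.carrier,
    φ (sampleDeviation g c Z u) * χ (distMat (Fin.cons Z.root u)) ∂(Measure.pi fun _ => Z.measure)
  have hcont : ∀ (Z : MMSpace) [IsFiniteMeasure Z.measure] {f : ℝ → ℝ}, Continuous f →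
      Continuous fun u : Fin k → Z.carrier =>
        f (sampleDeviation g c Z u) * χ (distMat (Fin.cons Z.root u)) := fun Z _ f hf => by
    refine (hf.comp (continuous_sampleDeviation hg hg01 c Z)).mul
      (hχ.comp (continuous_distMat.comp ?_))
    exact continuous_const.finCons continuous_id
  have hnonneg : ∀ (Z : MMSpace) u,
      0 ≤ φ (sampleDeviation g c Z u) * χ (distMat (Fin.cons Z.root u)) := fun Z u =>
    mul_nonneg (hφ01 _).1 (hχ01 _).1
  have hint : ∀ (Z : MMSpace) [IsFiniteMeasure Z.measure], Integrable (fun u : Fin k → Z.carrier =>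
      φ (sampleDeviation g c Z u) * χ (distMat (Fin.cons Z.root u)))
      (Measure.pi fun _ => Z.measure) := fun Z _ =>
    integrable_of_mem_Icc (hcont Z hφ).measurable fun u =>
      ⟨hnonneg Z u, mul_le_one₀ (hφ01 _).2 (hχ01 _).1 (hχ01 _).2⟩
  -- the limit integral is positive
  have hpos : 0 < J Y := by
    refine (integral_pos_iff_support_of_nonneg (hnonneg Y) (hint Y)).2 ?_
    have hval : φ (sampleDeviation g c Y y) * χ (distMat (Fin.cons Y.root y)) = 1 := by
      have h1 : sampleDeviation g c Y y = 0 := by simp [sampleDeviation, c]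
      simp only [φ, χ, h1, dist_self]
      rw [cutoff_eq_one hδ2 le_rfl, cutoff_eq_one hδ le_rfl, one_mul]
    have hopen := (isOpen_ne (x := (0 : ℝ))).preimage (hcont Y hφ)
    have hmem : y ∈ (fun u : Fin k → Y.carrier =>
        φ (sampleDeviation g c Y u) * χ (distMat (Fin.cons Y.root u))) ⁻¹' {x | x ≠ 0} := by
      simp only [Set.mem_preimage, hval]
      exact one_ne_zero
    obtain ⟨r, hr, hball⟩ := Metric.isOpen_iff.1 hopen y hmem
    refine lt_of_lt_of_le ?_ (measure_mono hball)
    rw [ball_pi y hr, Measure.pi_pi]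
    refine pos_iff_ne_zero.2 (Finset.prod_ne_zero_iff.2 fun i _ => ?_)
    exact ((Measure.mem_support_iff_forall _).1 (hy i) _ (Metric.ball_mem_nhds _ hr)).ne'
  -- the integrals converge
  have hlim : Tendsto (fun n => J (X n)) atTop (𝓝 (J Y)) := by
    set M := Y.measure.real Set.univ + 1 with hM
    have hY0 : 0 ≤ Y.measure.real Set.univ := measureReal_nonneg
    have hM0 : 0 < M := by linarith
    have hMX : ∀ᶠ n in atTop, (X n).measure.real Set.univ ≤ M :=
      (hXY.tendsto_mass.eventually_lt_const (by linarith)).mono fun _ h => h.le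
    have hc : ∀ i, |c i| ≤ M := fun i =>
      (abs_sampleAverage_le (hg01 i) Y y).trans (by linarith)
    have hV : ∀ (Z : MMSpace) [IsFiniteMeasure Z.measure], Z.measure.real Set.univ ≤ M → ∀ u,
        sampleDeviation g c Z u ∈ Set.Icc 0 (∑ _i : ι, (2 * M) ^ 2) := by
      refine fun Z _ hZ u => ⟨sampleDeviation_nonneg _ _ _ _, Finset.sum_le_sum fun i _ => ?_⟩
      refine sq_le_sq' ?_ ?_ <;>
      linarith [abs_le.1 (hc i), abs_le.1 ((abs_sampleAverage_le (hg01 i) Z u).trans hZ)]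
    have happrox : ∀ (p : Polynomial ℝ) (η : ℝ),
        (∀ t ∈ Set.Icc 0 (∑ _i : ι, (2 * M) ^ 2), |p.eval t - φ t| < η) →
        ∀ (Z : MMSpace) [IsFiniteMeasure Z.measure], Z.measure.real Set.univ ≤ M →
        |∫ u : Fin k → Z.carrier, p.eval (sampleDeviation g c Z u) *
          χ (distMat (Fin.cons Z.root u)) ∂(Measure.pi fun _ => Z.measure) - J Z| ≤ η * M ^ k := by
      intro p η hp Z _ hZ
      have hpb : ∀ u, |p.eval (sampleDeviation g c Z u) * χ (distMat (Fin.cons Z.root u)) -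
          φ (sampleDeviation g c Z u) * χ (distMat (Fin.cons Z.root u))| ≤ η := fun u => by
        rw [← sub_mul, abs_mul, abs_of_nonneg (hχ01 _).1]
        exact (mul_le_of_le_one_right (abs_nonneg _) (hχ01 _).2).trans (hp _ (hV Z hZ u)).le
      have hη : 0 ≤ η := (abs_nonneg _).trans (hpb fun _ => Z.root)
      have hpi : Integrable (fun u : Fin k → Z.carrier => p.eval (sampleDeviation g c Z u) *
          χ (distMat (Fin.cons Z.root u))) (Measure.pi fun _ => Z.measure) := by
        refine Integrable.of_bound (C := η + 1) (hcont Z p.continuous).aestronglyMeasurable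
          (ae_of_all _ fun u => ?_)
        have h1 := abs_le.1 (hpb u)
        have h2 : φ (sampleDeviation g c Z u) * χ (distMat (Fin.cons Z.root u)) ≤ 1 :=
          mul_le_one₀ (hφ01 _).2 (hχ01 _).1 (hχ01 _).2
        have h3 := hnonneg Z u
        rw [Real.norm_eq_abs, abs_le]
        constructor <;> linarith
      rw [← integral_sub hpi (hint Z)]
      refine (abs_integral_le_of_abs_le hpb).trans ?_
      rw [measureReal_pi_univ]
      exact mul_le_mul_of_nonneg_left (pow_le_pow_left₀ measureReal_nonneg hZ k) hη
    rw [Metric.tendsto_atTop']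
    intro e he
    have hMk : 0 < M ^ k := pow_pos hM0 k
    obtain ⟨p, hp⟩ := exists_polynomial_near_of_continuousOn 0 (∑ _i : ι, (2 * M) ^ 2) φ
      hφ.continuousOn (e / 3 / M ^ k) (by positivity)
    have h1 := (SampleConvergent.polynomial_sampleDeviation hXY hg hg01 c p).tendsto 0 χ hχ
      ⟨1, fun a => by rw [abs_of_nonneg (hχ01 a).1]; exact (hχ01 a).2⟩
    have h2 := (Metric.tendsto_nhds.1 h1) (e / 3) (by positivity)
    obtain ⟨N, hN⟩ := eventually_atTop.1 (h2.and hMX)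
    refine ⟨N, fun n hn => ?_⟩
    obtain ⟨h3, h4⟩ := hN n hn.le
    have h5 := happrox p _ hp (X n) h4
    have h6 := happrox p _ hp Y (by linarith)
    rw [div_mul_cancel₀ _ hMk.ne'] at h5 h6
    rw [Real.dist_eq] at h3 ⊢
    simp only [Nat.add_zero, Fin.castAdd_zero, Fin.cast_refl, id_eq] at h3
    rw [abs_le] at h5 h6
    rw [abs_lt] at h3 ⊢
    constructor <;> linarith [h3.1, h3.2, h5.1, h5.2, h6.1, h6.2]
  filter_upwards [hlim.eventually_const_lt hpos] with n hn
  by_contra! hcon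
  refine hn.ne' ?_
  refine integral_eq_zero_of_ae (ae_of_all _ fun u => ?_)
  change φ _ * χ _ = 0
  by_contra hne
  obtain ⟨hne1, hne2⟩ := mul_ne_zero_iff.1 hne
  have h1 : dist (distMat (Fin.cons (X n).root u)) (distMat (Fin.cons Y.root y)) < δ := by
    by_contra! hge
    exact hne2 (cutoff_eq_zero hδ (by linarith))
  obtain ⟨i, hi⟩ := hcon u h1
  refine hne1 (cutoff_eq_zero hδ2 ?_)
  rw [zero_add]
  refine le_trans ?_ (Finset.single_le_sum (fun i _ => sq_nonneg _) (Finset.mem_univ i))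
  rw [← sq_abs (_ - _)]
  exact pow_le_pow_left₀ hδ.le hi 2

end MMSpace

/-! ### Gromov-weak convergence implies Gromov-Prohorov convergence -/

theorem isCross_glueDist {α β γ : Type*} [MetricSpace α] [MetricSpace β] [Nonempty γ] {p : γ → α}
    {q : γ → β} {ε : ℝ} (hε : 0 < ε) (h : ∀ i j, |dist (p i) (p j) - dist (q i) (q j)| ≤ 2 * ε) :
    IsCross fun x y => Metric.glueDist p q ε (.inl x) (.inr y) := by
  let d := (Metric.glueMetricApprox p q ε hε h).toPseudoMetricSpace
  have hd : ∀ x y z : α ⊕ β, Metric.glueDist p q ε x z ≤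
      Metric.glueDist p q ε x y + Metric.glueDist p q ε y z := d.dist_triangle
  exact ⟨fun x x' y => hd (.inl x) (.inl x') (.inr y), fun x y y' => hd (.inl x) (.inr y') (.inr y),
    fun x x' y => hd (.inl x) (.inr y) (.inl x'), fun x y y' => hd (.inr y) (.inl x) (.inr y')⟩

/-- A function of the distances to `k` points, which is `1` if one of those with index in `I` is at
most `ε` and `0` if all of these are at least `2 * ε`. -/
noncomputable def nearSome {k : ℕ} (ε : ℝ) (I : Finset (Fin k)) (a : Fin k → ℝ) : ℝ :=
  1 - ∏ i ∈ I, (1 - cutoff ε ε (a i))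

theorem nearSome_mem {k : ℕ} (ε : ℝ) (I : Finset (Fin k)) (a : Fin k → ℝ) :
    0 ≤ nearSome ε I a ∧ nearSome ε I a ≤ 1 := by
  have h1 : 0 ≤ ∏ i ∈ I, (1 - cutoff ε ε (a i)) :=
    Finset.prod_nonneg fun i _ => sub_nonneg.2 (cutoff_mem _ _ _).2
  have h2 : ∏ i ∈ I, (1 - cutoff ε ε (a i)) ≤ 1 :=
    Finset.prod_le_one (fun i _ => sub_nonneg.2 (cutoff_mem _ _ _).2)
      fun i _ => sub_le_self _ (cutoff_mem _ _ _).1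
  unfold nearSome
  constructor <;> linarith

theorem continuous_nearSome {k : ℕ} (ε : ℝ) (I : Finset (Fin k)) : Continuous (nearSome ε I) :=
  continuous_const.sub (continuous_finsetProd _ fun i _ =>
    continuous_const.sub ((continuous_cutoff _ _).comp (continuous_apply i)))

theorem nearSome_eq_one {k : ℕ} {ε : ℝ} (hε : 0 < ε) {I : Finset (Fin k)} {a : Fin k → ℝ}
    (h : ∃ i ∈ I, a i ≤ ε) : nearSome ε I a = 1 := by
  obtain ⟨i, hi, hia⟩ := h
  rw [nearSome, Finset.prod_eq_zero hi, sub_zero]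
  rw [cutoff_eq_one hε hia, sub_self]

theorem nearSome_eq_zero {k : ℕ} {ε : ℝ} (hε : 0 < ε) {I : Finset (Fin k)} {a : Fin k → ℝ}
    (h : ∀ i ∈ I, 2 * ε ≤ a i) : nearSome ε I a = 0 := by
  rw [nearSome, Finset.prod_eq_one, sub_self]
  intro i hi
  rw [cutoff_eq_zero hε (by linarith [h i hi]), sub_zero]

theorem exists_support_net {Z : Type*} [MetricSpace Z] [CompleteSpace Z] [SecondCountableTopology Z]
    [MeasurableSpace Z] [BorelSpace Z] (ν : Measure Z) [IsFiniteMeasure ν] {ε : ℝ} (hε : 0 < ε) :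
    ∃ (k : ℕ) (y : Fin k → Z), (∀ i, y i ∈ ν.support) ∧
      ν (⋃ i, Metric.ball (y i) ε)ᶜ ≤ ENNReal.ofReal ε := by
  obtain ⟨K, hKS, hK, hlt⟩ :=
    (Measure.isClosed_support (μ := ν)).measurableSet.exists_isCompact_lt_add
      (measure_ne_top ν _) (ENNReal.ofReal_pos.2 hε).ne'
  obtain ⟨t, htK, ht, hcov⟩ := hK.finite_cover_balls hε
  let e := ht.toFinset.equivFin
  refine ⟨_, fun i => (e.symm i : Z), fun i =>
    hKS (htK (ht.mem_toFinset.1 (e.symm i).2)), ?_⟩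
  have h1 : K ⊆ ⋃ i, Metric.ball (e.symm i : Z) ε := fun z hz => by
    obtain ⟨x, hx, hzx⟩ := Set.mem_iUnion₂.1 (hcov hz)
    refine Set.mem_iUnion.2 ⟨e ⟨x, ht.mem_toFinset.2 hx⟩, ?_⟩
    rwa [e.symm_apply_apply]
  have h2 : ν ν.support = ν Set.univ := by
    rw [← measure_add_measure_compl (μ := ν) (Measure.isClosed_support (μ := ν)).measurableSet,
      Measure.measure_compl_support, add_zero]
  refine (measure_mono (Set.compl_subset_compl.2 h1)).trans ?_
  rw [measure_compl hK.isClosed.measurableSet (measure_ne_top _ _), tsub_le_iff_left, ← h2]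
  exact hlt.le

namespace MMSpace

theorem GromovWeakTendsto.tendsto_gromovProhorovDist {X : ℕ → MMSpace} {Y : MMSpace}
    [∀ n, IsFiniteMeasure (X n).measure] [IsFiniteMeasure Y.measure]
    (hXY : GromovWeakTendsto X Y) :
    Tendsto (fun n => gromovProhorovDist (X n) Y) atTop (𝓝 0) := by
  refine (tendsto_order.2 ⟨fun c hc => Eventually.of_forall fun n =>
    hc.trans_le (gromovProhorovDist_nonneg _ _), fun c hc => ?_⟩)
  set ε := c / 5 with hεc
  have hε : 0 < ε := by positivity
  obtain ⟨k, y, hy, hcov⟩ := exists_support_net Y.measure hε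
  filter_upwards [hXY.eventually_exists_points y hy (nearSome ε) (continuous_nearSome ε)
    (nearSome_mem ε) hε, hXY.tendsto_mass.eventually_lt_const
      (lt_add_of_pos_right (Y.measure.real Set.univ) hε)] with n hx hmass
  obtain ⟨x, hxd, hxg⟩ := hx
  set q : Fin (k + 1) → Y.carrier := Fin.cons Y.root y with hq
  set p : Fin (k + 1) → (X n).carrier := Fin.cons (X n).root x with hp
  have hpq : ∀ i j, |dist (q i) (q j) - dist (p i) (p j)| ≤ 2 * (ε / 2) := fun i j => by
    rw [abs_sub_comm, ← Real.dist_eq, mul_div_cancel₀ _ two_ne_zero]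
    exact ((dist_le_pi_dist (distMat p i) (distMat q i) j).trans
      (dist_le_pi_dist (distMat p) (distMat q) i)).trans hxd.le
  have hD := isCross_glueDist (half_pos hε) hpq
  set D : Y.carrier → (X n).carrier → ℝ := fun y x => Metric.glueDist q p (ε / 2) (.inl y) (.inr x)
    with hDdef
  have hDpq : ∀ i, D (q i) (p i) = ε / 2 := fun i => Metric.glueDist_glued_points q p _ i
  have hleft : ∀ A : Set Y.carrier,
      Y.measure A ≤ (X n).measure (crossNhd D A (4 * ε)) + ENNReal.ofReal (2 * ε) := by
    intro A
    classical
    let I : Finset (Fin k) := Finset.univ.filter fun i => (A ∩ Metric.ball (y i) ε).Nonempty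
    let U : Set Y.carrier := ⋃ i ∈ I, Metric.ball (y i) ε
    let W : Set (X n).carrier := ⋃ i ∈ I, Metric.ball (x i) (2 * ε)
    have hUm : MeasurableSet U :=
      (isOpen_biUnion fun _ _ => Metric.isOpen_ball).measurableSet
    have hWm : MeasurableSet W :=
      (isOpen_biUnion fun _ _ => Metric.isOpen_ball).measurableSet
    have hAU : A ⊆ U ∪ (⋃ i, Metric.ball (y i) ε)ᶜ := fun a ha => by
      by_cases h : a ∈ ⋃ i, Metric.ball (y i) ε
      · obtain ⟨i, hi⟩ := Set.mem_iUnion.1 h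
        exact Or.inl (Set.mem_iUnion₂.2 ⟨i, Finset.mem_filter.2 ⟨Finset.mem_univ _, a, ha, hi⟩, hi⟩)
      · exact Or.inr h
    have hWA : W ⊆ crossNhd D A (4 * ε) := fun z hz => by
      obtain ⟨i, hi, hzi⟩ := Set.mem_iUnion₂.1 hz
      obtain ⟨a, ha, hai⟩ := (Finset.mem_filter.1 hi).2
      refine ⟨a, ha, ?_⟩
      have h1 := hD.left_triangle a (y i) z
      have h2 := hD.right_triangle (y i) z (x i)
      have h3 : D (y i) (x i) = ε / 2 := hDpq i.succ
      rw [Metric.mem_ball] at hzi hai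
      rw [dist_comm] at hzi
      linarith
    have hU : Y.measure.real U ≤ sampleAverage (nearSome ε I) Y y := by
      rw [← integral_indicator_one hUm]
      refine integral_mono ((integrable_const (1 : ℝ)).indicator hUm) (integrable_of_mem_Icc
        ((continuous_nearSome ε I).comp (by fun_prop)).measurable fun z => nearSome_mem _ _ _)
        fun z => ?_
      by_cases hz : z ∈ U
      · rw [Set.indicator_of_mem hz]
        obtain ⟨i, hi, hzi⟩ := Set.mem_iUnion₂.1 hz
        rw [Metric.mem_ball, dist_comm] at hzi
        exact (nearSome_eq_one hε (a := fun i => dist (y i) z) ⟨i, hi, hzi.le⟩).ge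
      · rw [Set.indicator_of_notMem hz]
        exact (nearSome_mem _ _ _).1
    have hW : sampleAverage (nearSome ε I) (X n) x ≤ (X n).measure.real W := by
      rw [← integral_indicator_one hWm]
      refine integral_mono (integrable_of_mem_Icc
        ((continuous_nearSome ε I).comp (by fun_prop)).measurable fun z => nearSome_mem _ _ _)
        ((integrable_const (1 : ℝ)).indicator hWm) fun z => ?_
      by_cases hz : z ∈ W
      · rw [Set.indicator_of_mem hz]
        exact (nearSome_mem _ _ _).2
      · refine (nearSome_eq_zero hε fun i hi => ?_).le.trans
          (Set.indicator_nonneg (fun _ _ => zero_le_one) z)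
        by_contra! hlt
        rw [dist_comm] at hlt
        exact hz (Set.mem_iUnion₂.2 ⟨i, hi, hlt⟩)
    have hUW : Y.measure.real U ≤ (X n).measure.real W + ε := by
      linarith [(abs_lt.1 (hxg I)).1]
    refine (measure_mono hAU).trans ((measure_union_le _ _).trans ?_)
    rw [two_mul, ENNReal.ofReal_add hε.le hε.le, ← add_assoc]
    refine add_le_add ?_ hcov
    rw [← ofReal_measureReal (measure_ne_top Y.measure U)]
    refine (ENNReal.ofReal_le_ofReal hUW).trans ?_
    rw [ENNReal.ofReal_add measureReal_nonneg hε.le,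
      ofReal_measureReal (measure_ne_top _ W)]
    gcongr
  have h1 : ProhorovClose Y.measure (X n).measure D (4 * ε) := by
    refine ProhorovClose.of_left (b := 2 * ε) (c := ε) hD (by positivity) hε.le hleft ?_
      (by linarith)
    rw [← ofReal_measureReal, ← ofReal_measureReal, ← ENNReal.ofReal_add measureReal_nonneg hε.le]
    exact ENNReal.ofReal_le_ofReal hmass.le
  rw [gromovProhorovDist_comm]
  refine (gromovProhorovDist_le hD (by positivity) h1).trans_lt ?_
  have h2 : D Y.root (X n).root = ε / 2 := hDpq 0
  linarith

theorem GromovVagueTendsto.tendsto_localizedGromovProhorovDist {X : ℕ → MMSpace} {Y : MMSpace}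
    (h : GromovVagueTendsto X Y) :
    Tendsto (fun n => localizedGromovProhorovDist (X n) Y) atTop (𝓝 0) := by
  have h1 : Tendsto (fun n => ∫ R in Set.Ioi (0 : ℝ), localizedIntegrand (X n) Y R) atTop
      (𝓝 (∫ _ in Set.Ioi (0 : ℝ), (0 : ℝ))) := by
    refine tendsto_integral_of_dominated_convergence (fun R => Real.exp (-R))
      (fun n => (measurable_localizedIntegrand _ _).aestronglyMeasurable)
      (integrableOn_exp_neg_Ioi 0) (fun n => ae_of_all _ fun R => ?_) ?_
    · rw [Real.norm_of_nonneg (localizedIntegrand_nonneg _ _ _)]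
      exact localizedIntegrand_le _ _ _
    · filter_upwards [h] with R hR
      have h2 := ((tendsto_const_nhds (x := (1 : ℝ))).min
        hR.tendsto_gromovProhorovDist).const_mul (Real.exp (-R))
      simpa [localizedIntegrand] using h2
  rw [integral_zero] at h1
  exact h1

theorem tendsto_localizedGromovProhorovDist_iff {X : ℕ → MMSpace} {Y : MMSpace} :
    Tendsto (fun n => localizedGromovProhorovDist (X n) Y) atTop (𝓝 0) ↔ GromovVagueTendsto X Y :=
  ⟨fun h => (testConvergence_of_localizedGromovProhorovDist h).gromovVagueTendsto,
    fun h => h.tendsto_localizedGromovProhorovDist⟩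

/-! ### Gluing a sequence of spaces -/

/-- A separable metric space into which a given space is embedded isometrically. -/
structure Extension (X : MMSpace) : Type 1 where
  Space : Type
  [metric : MetricSpace Space]
  [separable : TopologicalSpace.SeparableSpace Space]
  embed : X.carrier → Space
  isometry : Isometry embed

attribute [instance] Extension.metric Extension.separable

theorem separableSpace_glueSpace {α β γ : Type*} [MetricSpace α] [MetricSpace β] [MetricSpace γ]
    [Nonempty γ] [TopologicalSpace.SeparableSpace α] [TopologicalSpace.SeparableSpace β]
    {Φ : γ → α} {Ψ : γ → β} (hΦ : Isometry Φ) (hΨ : Isometry Ψ) :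
    TopologicalSpace.SeparableSpace (Metric.GlueSpace hΦ hΨ) := by
  refine TopologicalSpace.isSeparable_univ_iff.1 <|
    ((TopologicalSpace.isSeparable_range (Metric.toGlueL_isometry hΦ hΨ).continuous).union
      (TopologicalSpace.isSeparable_range (Metric.toGlueR_isometry hΦ hΨ).continuous)).mono ?_
  intro x _
  induction x using Quotient.inductionOn' with
  | h x =>
    rcases x with x | y
    · exact Or.inl ⟨x, rfl⟩
    · exact Or.inr ⟨y, rfl⟩

instance (X : MMSpace) : Nonempty X.carrier := ⟨X.root⟩

/-- Extend an extension of `X` by `Y`, placed relative to `X` as prescribed by a metric on the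
disjoint union. -/
noncomputable def Extension.glue {X Y : MMSpace} (W : Extension X) (d : SumMetric X Y) :
    Extension Y :=
  { Space := Metric.GlueSpace W.isometry d.isometry_inl
    separable := separableSpace_glueSpace _ _
    embed := Metric.toGlueR W.isometry d.isometry_inl ∘ d.inr
    isometry := (Metric.toGlueR_isometry _ _).comp d.isometry_inr }

/-- The canonical embedding of an extension into a larger one. -/
noncomputable def Extension.toGlue {X Y : MMSpace} (W : Extension X) (d : SumMetric X Y)
    (w : W.Space) : (W.glue d).Space :=
  Metric.toGlueL W.isometry d.isometry_inl w

theorem Extension.isometry_toGlue {X Y : MMSpace} (W : Extension X) (d : SumMetric X Y) :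
    Isometry (W.toGlue d) :=
  Metric.toGlueL_isometry W.isometry d.isometry_inl

theorem Extension.dist_toGlue {X Y : MMSpace} (W : Extension X) (d : SumMetric X Y) (x : X.carrier)
    (y : Y.carrier) : dist (W.toGlue d (W.embed x)) ((W.glue d).embed y) = d.cross x y := by
  have h : W.toGlue d (W.embed x) = Metric.toGlueR W.isometry d.isometry_inl (d.inl x) :=
    congrFun (Metric.toGlue_commute W.isometry d.isometry_inl) x
  rw [h]
  exact (Metric.toGlueR_isometry W.isometry d.isometry_inl).dist_eq (d.inl x) (d.inr y)

/-- The space obtained by gluing the first spaces of a sequence successively. -/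
noncomputable def extensionChain (X : ℕ → MMSpace) (d : ∀ n, SumMetric (X n) (X (n + 1))) :
    ∀ n, Extension (X n)
  | 0 => { Space := (X 0).carrier, embed := id, isometry := isometry_id }
  | n + 1 => (extensionChain X d n).glue (d n)

theorem exists_common_extension (X : ℕ → MMSpace) (d : ∀ n, SumMetric (X n) (X (n + 1))) :
    ∃ (Z : Type) (_ : MetricSpace Z) (_ : CompleteSpace Z) (_ : TopologicalSpace.SeparableSpace Z)
      (Φ : ∀ n, (X n).carrier → Z), (∀ n, Isometry (Φ n)) ∧
      ∀ n x y, dist (Φ n x) (Φ (n + 1) y) = (d n).cross x y := by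
  let W := extensionChain X d
  let f : ∀ n, (W n).Space → (W (n + 1)).Space := fun n => (W n).toGlue (d n)
  have hf : ∀ n, Isometry (f n) := fun n => (W n).isometry_toGlue (d n)
  have := Metric.separableSpaceInductiveLimit_of_separableSpace hf
  let Φ : ∀ n, (X n).carrier → UniformSpace.Completion (Metric.InductiveLimit hf) :=
    fun n x => (Metric.toInductiveLimit hf n ((W n).embed x) : Metric.InductiveLimit hf)
  refine ⟨UniformSpace.Completion (Metric.InductiveLimit hf), inferInstance, inferInstance,
    inferInstance, Φ, fun n => UniformSpace.Completion.coe_isometry.comp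
      ((Metric.toInductiveLimit_isometry hf n).comp (W n).isometry), fun n x y => ?_⟩
  simp only [Φ]
  rw [UniformSpace.Completion.coe_isometry.dist_eq, ← Metric.toInductiveLimit_commute hf n,
    Function.comp_apply, (Metric.toInductiveLimit_isometry hf (n + 1)).dist_eq]
  exact (W n).dist_toGlue (d n) x y

end MMSpace

/-! ### Sequences of measures that are Cauchy for Lipschitz functions -/

section LipschitzCauchy

variable {Z : Type*} [MetricSpace Z] [CompleteSpace Z] [SecondCountableTopology Z]
  [MeasurableSpace Z] [BorelSpace Z]

/-- A sequence of finite measures whose integrals of Lipschitz functions are Cauchy uniformly is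
concentrated, up to `ε`, on finitely many balls of radius `δ`. -/
theorem exists_finite_net_of_lipschitz_cauchy {κ : ℕ → FiniteMeasure Z}
    (h : ∀ L ε : ℝ, 0 < ε → ∃ N, ∀ n, N ≤ n → ∀ f : Z → ℝ, (∀ z, 0 ≤ f z ∧ f z ≤ 1) →
      (∀ z z', |f z - f z'| ≤ L * dist z z') →
      |∫ z, f z ∂(κ n : Measure Z) - ∫ z, f z ∂(κ N : Measure Z)| ≤ ε)
    {δ ε : ℝ} (hδ : 0 < δ) (hε : 0 < ε) :
    ∃ t : Set Z, t.Finite ∧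
      ∀ n, (κ n : Measure Z) (⋃ x ∈ t, Metric.closedBall x δ)ᶜ ≤ ENNReal.ofReal ε := by
  rcases isEmpty_or_nonempty Z with hZ | ⟨⟨z₀⟩⟩
  · exact ⟨∅, Set.finite_empty, fun n => by simp [Set.eq_empty_of_isEmpty]⟩
  have hδ2 : 0 < δ / 2 := half_pos hδ
  have hε2 : 0 < ε / 2 := half_pos hε
  obtain ⟨N, hN⟩ := h (1 / (δ / 2)) (ε / 2) hε2
  have hKi : ∀ n, ∃ K : Set Z, IsCompact K ∧ (κ n : Measure Z) Kᶜ ≤ ENNReal.ofReal (ε / 2) := by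
    intro n
    obtain ⟨K, -, hK, hlt⟩ := MeasurableSet.univ.exists_isCompact_lt_add
      (measure_ne_top (κ n : Measure Z) _) (ENNReal.ofReal_pos.2 hε2).ne'
    refine ⟨K, hK, ?_⟩
    rw [measure_compl hK.isClosed.measurableSet (measure_ne_top _ _), tsub_le_iff_left]
    exact hlt.le
  choose K hK hKc using hKi
  set T : Set Z := {z₀} ∪ ⋃ i ∈ Finset.range (N + 1), K i with hT
  have hTc : IsCompact T :=
    isCompact_singleton.union ((Finset.range (N + 1)).isCompact_biUnion fun i _ => hK i)
  have hTne : T.Nonempty := ⟨z₀, Or.inl rfl⟩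
  have hTK : ∀ n ≤ N, (κ n : Measure Z) Tᶜ ≤ ENNReal.ofReal (ε / 2) := fun n hn =>
    (measure_mono (Set.compl_subset_compl.2 fun z hz =>
      Or.inr (Set.mem_iUnion₂.2 ⟨n, Finset.mem_range.2 (by omega), hz⟩))).trans (hKc n)
  obtain ⟨t, -, ht, hcov⟩ := hTc.finite_cover_balls hδ2
  refine ⟨t, ht, fun n => ?_⟩
  -- points outside the balls have distance at least `δ / 2` from the compact set
  have hfar : ∀ z, z ∈ (⋃ x ∈ t, Metric.closedBall x δ)ᶜ → δ / 2 ≤ Metric.infDist z T := by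
    intro z hz
    by_contra! hlt
    obtain ⟨w, hw, hzw⟩ := (Metric.infDist_lt_iff hTne).1 hlt
    obtain ⟨x, hx, hwx⟩ := Set.mem_iUnion₂.1 (hcov hw)
    refine hz (Set.mem_iUnion₂.2 ⟨x, hx, ?_⟩)
    rw [Metric.mem_ball] at hwx
    rw [Metric.mem_closedBall]
    linarith [dist_triangle z w x]
  rcases le_or_gt n N with hn | hn
  · refine (measure_mono fun z hz hzT => ?_).trans ((hTK n hn).trans
      (ENNReal.ofReal_le_ofReal (by linarith)))
    have := hfar z hz
    rw [Metric.infDist_zero_of_mem hzT] at this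
    linarith
  · let f : Z → ℝ := fun z => 1 - cutoff 0 (δ / 2) (Metric.infDist z T)
    have hf : ∀ z, 0 ≤ f z ∧ f z ≤ 1 := fun z =>
      ⟨sub_nonneg.2 (cutoff_mem _ _ _).2, sub_le_self _ (cutoff_mem _ _ _).1⟩
    have hfL : ∀ z z', |f z - f z'| ≤ 1 / (δ / 2) * dist z z' := fun z z' => by
      simp only [f]
      rw [sub_sub_sub_cancel_left, abs_sub_comm]
      refine (abs_cutoff_sub_le hδ2 _ _).trans
        (mul_le_mul_of_nonneg_left ?_ (one_div_pos.2 hδ2).le)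
      have := (Metric.lipschitz_infDist_pt T).dist_le_mul z z'
      simpa [Real.dist_eq] using this
    have hfm : Measurable f := (continuous_of_lipschitz hfL).measurable
    have hA : MeasurableSet (⋃ x ∈ t, Metric.closedBall x δ)ᶜ :=
      (ht.isClosed_biUnion fun _ _ => Metric.isClosed_closedBall).measurableSet.compl
    have h1 : (κ n : Measure Z).real (⋃ x ∈ t, Metric.closedBall x δ)ᶜ ≤
        ∫ z, f z ∂(κ n : Measure Z) := by
      rw [← integral_indicator_one hA]
      refine integral_mono ((integrable_const (1 : ℝ)).indicator hA)
        (integrable_of_mem_Icc hfm hf) fun z => ?_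
      by_cases hz : z ∈ (⋃ x ∈ t, Metric.closedBall x δ)ᶜ
      · rw [Set.indicator_of_mem hz]
        simp only [f, Pi.one_apply]
        rw [cutoff_eq_zero hδ2 (by linarith [hfar z hz]), sub_zero]
      · rw [Set.indicator_of_notMem hz]
        exact (hf z).1
    have h2 : ∫ z, f z ∂(κ N : Measure Z) ≤ (κ N : Measure Z).real Tᶜ := by
      have hTm : MeasurableSet Tᶜ := hTc.isClosed.measurableSet.compl
      rw [← integral_indicator_one hTm]
      refine integral_mono (integrable_of_mem_Icc hfm hf)
        ((integrable_const (1 : ℝ)).indicator hTm) fun z => ?_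
      by_cases hz : z ∈ Tᶜ
      · rw [Set.indicator_of_mem hz]
        exact (hf z).2
      · rw [Set.indicator_of_notMem hz]
        simp only [f]
        rw [Metric.infDist_zero_of_mem (not_not.1 hz), cutoff_eq_one hδ2 le_rfl, sub_self]
    have h3 : (κ N : Measure Z).real Tᶜ ≤ ε / 2 :=
      ENNReal.toReal_le_of_le_ofReal hε2.le (hTK N le_rfl)
    have h4 := (abs_le.1 (hN n hn.le f hf hfL)).2
    rw [← ofReal_measureReal (measure_ne_top _ _)]
    exact ENNReal.ofReal_le_ofReal (by linarith)

theorem exists_isCompact_of_lipschitz_cauchy {κ : ℕ → FiniteMeasure Z}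
    (h : ∀ L ε : ℝ, 0 < ε → ∃ N, ∀ n, N ≤ n → ∀ f : Z → ℝ, (∀ z, 0 ≤ f z ∧ f z ≤ 1) →
      (∀ z z', |f z - f z'| ≤ L * dist z z') →
      |∫ z, f z ∂(κ n : Measure Z) - ∫ z, f z ∂(κ N : Measure Z)| ≤ ε)
    {ε : ℝ} (hε : 0 < ε) :
    ∃ K : Set Z, IsCompact K ∧ ∀ n, (κ n : Measure Z) Kᶜ ≤ ENNReal.ofReal ε := by
  have hk : ∀ k : ℕ, ∃ t : Set Z, t.Finite ∧ ∀ n,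
      (κ n : Measure Z) (⋃ x ∈ t, Metric.closedBall x (1 / ((k : ℝ) + 1)))ᶜ ≤
        ENNReal.ofReal (ε / 2 / 2 ^ k) := fun k =>
    exists_finite_net_of_lipschitz_cauchy h Nat.one_div_pos_of_nat (by positivity)
  choose t ht hκ using hk
  refine ⟨⋂ k : ℕ, ⋃ x ∈ t k, Metric.closedBall x (1 / ((k : ℝ) + 1)), ?_, fun n => ?_⟩
  · refine TotallyBounded.isCompact_of_isClosed (Metric.totallyBounded_iff.2 fun r hr => ?_)
      (isClosed_iInter fun k => (ht k).isClosed_biUnion fun _ _ => Metric.isClosed_closedBall)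
    obtain ⟨k, hk⟩ := exists_nat_one_div_lt hr
    exact ⟨t k, ht k, (Set.iInter_subset _ k).trans
      (Set.iUnion₂_mono fun x _ => Metric.closedBall_subset_ball hk)⟩
  · rw [Set.compl_iInter]
    refine (measure_iUnion_le _).trans ((ENNReal.tsum_le_tsum fun k => hκ k n).trans ?_)
    have hs := hasSum_geometric_two' ε
    rw [← ENNReal.ofReal_tsum_of_nonneg (fun k => by positivity) hs.summable, hs.tsum_eq]

theorem exists_tendsto_of_lipschitz_cauchy {κ : ℕ → FiniteMeasure Z}
    (h : ∀ L ε : ℝ, 0 < ε → ∃ N, ∀ n, N ≤ n → ∀ f : Z → ℝ, (∀ z, 0 ≤ f z ∧ f z ≤ 1) →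
      (∀ z z', |f z - f z'| ≤ L * dist z z') →
      |∫ z, f z ∂(κ n : Measure Z) - ∫ z, f z ∂(κ N : Measure Z)| ≤ ε) :
    ∃ κ' : FiniteMeasure Z, Tendsto κ atTop (𝓝 κ') := by
  have hcauchy : ∀ (L : ℝ) (f : Z → ℝ), (∀ z, 0 ≤ f z ∧ f z ≤ 1) →
      (∀ z z', |f z - f z'| ≤ L * dist z z') →
      CauchySeq fun n => ∫ z, f z ∂(κ n : Measure Z) := by
    intro L f hf hfL
    refine Metric.cauchySeq_iff'.2 fun ε hε => ?_
    obtain ⟨N, hN⟩ := h L (ε / 2) (half_pos hε)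
    exact ⟨N, fun n hn => (hN n hn f hf hfL).trans_lt (half_lt_self hε)⟩
  have hmass : ∃ C : NNReal, ∀ n, (κ n).mass ≤ C := by
    have h1 := hcauchy 0 (fun _ => 1) (fun _ => by simp) fun _ _ => by simp
    obtain ⟨C, hC⟩ := h1.isBounded_range.bddAbove
    refine ⟨C.toNNReal, fun n => ?_⟩
    have h2 := hC ⟨n, rfl⟩
    simp only [integral_const, smul_eq_mul, mul_one] at h2
    exact NNReal.le_toNNReal_of_coe_le h2
  obtain ⟨C, hC⟩ := hmass
  have hK : ∀ k : ℕ, ∃ K : Set Z, IsCompact K ∧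
      ∀ n, (κ n : Measure Z) Kᶜ ≤ ENNReal.ofReal (1 / ((k : ℝ) + 1)) := fun k =>
    exists_isCompact_of_lipschitz_cauchy h Nat.one_div_pos_of_nat
  choose K hK hκK using hK
  have hu : Tendsto (fun k : ℕ => Real.toNNReal (1 / ((k : ℝ) + 1))) atTop (𝓝 0) := by
    have := (continuous_real_toNNReal.tendsto 0).comp
      (tendsto_one_div_add_atTop_nhds_zero_nat (𝕜 := ℝ))
    rw [Real.toNNReal_zero] at this
    exact this
  have hcomp := isCompact_setOfPred_finiteMeasure_mass_le_compl_isCompact_le C hu hK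
    (Or.inl inferInstance)
  have hmem : ∀ n, κ n ∈ {μ : FiniteMeasure Z | μ.mass ≤ C ∧
      ∀ k, μ (K k)ᶜ ≤ Real.toNNReal (1 / ((k : ℝ) + 1))} := fun n => by
    refine ⟨hC n, fun k => ?_⟩
    have := hκK k n
    rw [← FiniteMeasure.ennreal_coeFn_eq_coeFn_toMeasure] at this
    exact ENNReal.coe_le_coe.1 this
  obtain ⟨κ', -, hκ'⟩ := hcomp (f := map κ atTop) (by
    rw [le_principal_iff, mem_map]
    exact Eventually.of_forall (f := atTop) hmem)
  refine ⟨κ', tendsto_finiteMeasure_of_lipschitz fun f L hf hfL => ?_⟩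
  have hfc := continuous_of_lipschitz hfL
  have hcont : Continuous fun μ : FiniteMeasure Z => ∫ z, f z ∂(μ : Measure Z) :=
    continuous_iff_continuousAt.2 fun μ =>
      (FiniteMeasure.tendsto_iff_forall_integral_tendsto.1 tendsto_id)
        (BoundedContinuousFunction.ofNormedAddCommGroup f hfc 1 fun z => by
          rw [Real.norm_of_nonneg (hf z).1]; exact (hf z).2)
  have hclus : MapClusterPt κ' atTop κ := hκ'
  exact le_nhds_of_cauchy_adhp (hcauchy L f hf hfL)
    (hclus.continuousAt_comp hcont.continuousAt)

end LipschitzCauchy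

/-! ### Limits of boundedly finite measures -/

theorem cutoff_mono {R R' δ t : ℝ} (hδ : 0 < δ) (h : R ≤ R') : cutoff R δ t ≤ cutoff R' δ t := by
  unfold cutoff
  gcongr

theorem integral_withDensity_toNNReal {Z : Type*} [MeasurableSpace Z] (μ : Measure Z) {g : Z → ℝ}
    (hg : Measurable g) (hg0 : ∀ z, 0 ≤ g z) (f : Z → ℝ) :
    ∫ z, f z ∂(μ.withDensity fun z => ((g z).toNNReal : ENNReal)) = ∫ z, g z * f z ∂μ := by
  rw [integral_withDensity_eq_integral_smul hg.real_toNNReal]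
  refine integral_congr_ae (ae_of_all _ fun z => ?_)
  simp only [NNReal.smul_def, Real.coe_toNNReal _ (hg0 z), smul_eq_mul]

theorem isFiniteMeasure_withDensity_toNNReal {Z : Type*} [MeasurableSpace Z] (μ : Measure Z)
    {g : Z → ℝ} (hg1 : ∀ z, g z ≤ 1) {S : Set Z} (hS : MeasurableSet S) (hμ : μ S ≠ ⊤)
    (hgS : ∀ z, z ∉ S → g z ≤ 0) :
    IsFiniteMeasure (μ.withDensity fun z => ((g z).toNNReal : ENNReal)) := by
  refine isFiniteMeasure_withDensity (ne_top_of_le_ne_top hμ ?_)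
  rw [← lintegral_indicator_one hS]
  refine lintegral_mono fun z => ?_
  by_cases hz : z ∈ S
  · rw [Set.indicator_of_mem hz]
    exact ENNReal.coe_le_coe.2 (Real.toNNReal_le_one.2 (hg1 z))
  · rw [Set.indicator_of_notMem hz, Real.toNNReal_of_nonpos (hgS z hz)]
    exact le_rfl

section

variable {Z : Type*} [MetricSpace Z] [CompleteSpace Z] [SecondCountableTopology Z]
  [MeasurableSpace Z] [BorelSpace Z]

/-- If the integrals of Lipschitz functions with bounded support are Cauchy, uniformly for each
Lipschitz constant and each support, then the measures converge. The limit is put together from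
the weak limits of the finite measures obtained by cutting off at integer radii, by means of a
partition of unity. -/
theorem exists_limit_measure (z₀ : Z) (m : ℕ → Measure Z)
    (hm : ∀ n r, m n (Metric.closedBall z₀ r) ≠ ⊤)
    (h : ∀ L r ε : ℝ, 0 < ε → ∃ N, ∀ n, N ≤ n → ∀ f : Z → ℝ, (∀ z, 0 ≤ f z ∧ f z ≤ 1) →
      (∀ z z', |f z - f z'| ≤ L * dist z z') → (∀ z, f z ≠ 0 → dist z z₀ ≤ r) →
      |∫ z, f z ∂(m n) - ∫ z, f z ∂(m N)| ≤ ε) :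
    ∃ m' : Measure Z, (∀ r, m' (Metric.closedBall z₀ r) ≠ ⊤) ∧
      ∀ (f : Z → ℝ) (L r : ℝ), (∀ z, 0 ≤ f z ∧ f z ≤ 1) →
      (∀ z z', |f z - f z'| ≤ L * dist z z') → (∀ z, f z ≠ 0 → dist z z₀ ≤ r) →
      Tendsto (fun n => ∫ z, f z ∂(m n)) atTop (𝓝 (∫ z, f z ∂m')) := by
  let c : ℝ → Z → ℝ := fun J z => cutoff J 1 (dist z z₀)
  have hc01 : ∀ J z, 0 ≤ c J z ∧ c J z ≤ 1 := fun J z => cutoff_mem _ _ _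
  have hcL : ∀ J z z', |c J z - c J z'| ≤ 1 * dist z z' := fun J z z' => by
    refine (abs_cutoff_sub_le one_pos _ _).trans ?_
    rw [one_div_one]
    exact mul_le_mul_of_nonneg_left (abs_dist_sub_le _ _ _) zero_le_one
  have hcc : ∀ J, Continuous (c J) := fun J => continuous_of_lipschitz (hcL J)
  have hcm : ∀ J, Measurable (c J) := fun J => (hcc J).measurable
  have hc0 : ∀ J z, J + 1 ≤ dist z z₀ → c J z = 0 := fun J z hz => cutoff_eq_zero one_pos hz
  have hc1 : ∀ J z, dist z z₀ ≤ J → c J z = 1 := fun J z hz => cutoff_eq_one one_pos hz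
  have hfin : ∀ J n, IsFiniteMeasure
      ((m n).withDensity fun z => ((c J z).toNNReal : ENNReal)) := fun J n =>
    isFiniteMeasure_withDensity_toNNReal _ (fun z => (hc01 J z).2)
      Metric.isClosed_closedBall.measurableSet (hm n (J + 1)) fun z hz =>
        (hc0 J z (le_of_lt (not_le.1 hz))).le
  -- the weak limits of the finite measures that are cut off
  let κn : ℝ → ℕ → FiniteMeasure Z := fun J n => ⟨_, hfin J n⟩
  have hlim : ∀ J : ℝ, ∃ κ : FiniteMeasure Z, Tendsto (κn J) atTop (𝓝 κ) := by
    intro J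
    refine exists_tendsto_of_lipschitz_cauchy fun L ε hε => ?_
    obtain ⟨N, hN⟩ := h (1 + |L|) (J + 1) ε hε
    refine ⟨N, fun n hn f hf hfL => ?_⟩
    have h1 := hN n hn (fun z => c J z * f z) (fun z => ⟨mul_nonneg (hc01 J z).1 (hf z).1,
      mul_le_one₀ (hc01 J z).2 (hf z).1 (hf z).2⟩) (fun z z' => ?_) fun z hz => ?_
    · simp only [κn, FiniteMeasure.toMeasure_mk, integral_withDensity_toNNReal _ (hcm J)
        (fun z => (hc01 J z).1)]
      exact h1
    · refine (abs_mul_sub_mul_le (hf z) (hc01 J z')).trans ?_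
      rw [add_mul]
      exact add_le_add (hcL J z z') ((hfL z z').trans
        (mul_le_mul_of_nonneg_right (le_abs_self L) dist_nonneg))
    · by_contra! hlt
      exact hz (by simp only [hc0 J z hlt.le, zero_mul])
  choose κ hκ using hlim
  -- the partition of unity
  let θ : ℕ → Z → ℝ := fun J z => c J z - c (J - 1) z
  have hθ0 : ∀ J z, 0 ≤ θ J z := fun J z => sub_nonneg.2 (cutoff_mono one_pos (by linarith))
  have hθ1 : ∀ J z, θ J z ≤ 1 := fun J z =>
    (sub_le_self _ (hc01 _ z).1).trans (hc01 _ z).2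
  have hθc : ∀ J, Continuous (θ J) := fun J => (hcc J).sub (hcc (J - 1))
  have hθm : ∀ J, Measurable (θ J) := fun J => (hθc J).measurable
  have hθ_near : ∀ (J : ℕ) z, dist z z₀ ≤ J - 1 → θ J z = 0 := fun J z hz => by
    simp only [θ]
    rw [hc1 _ z (by linarith), hc1 _ z hz, sub_self]
  have hθ_far : ∀ (J : ℕ) z, (J : ℝ) + 1 ≤ dist z z₀ → θ J z = 0 := fun J z hz => by
    simp only [θ]
    rw [hc0 _ z hz, hc0 _ z (by linarith), sub_self]
  have hθsum : ∀ (n : ℕ) z, ∑ J ∈ Finset.range n, θ J z = c (n - 1) z := fun n z => by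
    induction n with
    | zero => simpa using (hc0 (-1) z (by linarith [dist_nonneg (x := z) (y := z₀)])).symm
    | succ n ih =>
      rw [Finset.sum_range_succ, ih]
      simp only [θ]
      push_cast
      rw [add_sub_cancel_right]
      ring
  let P : ℕ → Measure Z := fun J =>
    (κ (J + 1) : Measure Z).withDensity fun z => ((θ J z).toNNReal : ENNReal)
  have hPfin : ∀ J, IsFiniteMeasure (P J) := fun J =>
    isFiniteMeasure_withDensity_toNNReal _ (hθ1 J) MeasurableSet.univ (measure_ne_top _ _)
      fun z hz => (hz (Set.mem_univ z)).elim
  have hPnull : ∀ (J : ℕ) r, r ≤ (J : ℝ) - 1 → P J (Metric.closedBall z₀ r) = 0 := by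
    intro J r hr
    rw [withDensity_apply _ Metric.isClosed_closedBall.measurableSet]
    refine setLIntegral_eq_zero Metric.isClosed_closedBall.measurableSet fun z hz => ?_
    rw [hθ_near J z (le_trans hz hr)]
    simp
  have hball : ∀ r, Measure.sum P (Metric.closedBall z₀ r) ≠ ⊤ := by
    intro r
    obtain ⟨n, hn⟩ := exists_nat_ge (r + 1)
    rw [Measure.sum_apply _ Metric.isClosed_closedBall.measurableSet,
      tsum_eq_sum (s := Finset.range n) fun J hJ => hPnull J r ?_]
    · exact ENNReal.sum_ne_top.2 fun J _ => measure_ne_top _ _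
    · have : (n : ℝ) ≤ J := by exact_mod_cast not_lt.1 fun h => hJ (Finset.mem_range.2 h)
      linarith
  refine ⟨Measure.sum P, hball, fun f L r hf hfL hfr => ?_⟩
  have hfc := continuous_of_lipschitz hfL
  have hfm : Measurable f := hfc.measurable
  obtain ⟨n, hn⟩ := exists_nat_ge (r + 1)
  have hfθ : ∀ J, n ≤ J → ∀ z, θ J z * f z = 0 := fun J hJ z => by
    by_cases hz : f z = 0
    · rw [hz, mul_zero]
    · have : (n : ℝ) ≤ J := by exact_mod_cast hJ
      rw [hθ_near J z (by linarith [hfr z hz]), zero_mul]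
  have hPint : ∀ J, ∫ z, f z ∂(P J) = ∫ z, θ J z * f z ∂(κ (J + 1) : Measure Z) := fun J =>
    integral_withDensity_toNNReal _ (hθm J) (hθ0 J) f
  have hint : ∀ (μ : Measure Z) (_ : μ (Metric.closedBall z₀ r) ≠ ⊤) {g : Z → ℝ}, Measurable g →
      (∀ z, 0 ≤ g z ∧ g z ≤ 1) → (∀ z, g z ≠ 0 → dist z z₀ ≤ r) → Integrable g μ := by
    intro μ hμ g hgm hg hgr
    have : IsFiniteMeasure (μ.restrict (Metric.closedBall z₀ r)) := isFiniteMeasure_restrict.2 hμ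
    have h1 : IntegrableOn g (Metric.closedBall z₀ r) μ := integrable_of_mem_Icc hgm hg
    refine (integrableOn_iff_integrable_of_support_subset fun z hz => ?_).1 h1
    exact hgr z hz
  have hsum := hasSum_integral_measure (hint _ (hball r) hfm hf hfr)
  have hval : ∫ z, f z ∂(Measure.sum P) =
      ∑ J ∈ Finset.range n, ∫ z, θ J z * f z ∂(κ (J + 1) : Measure Z) := by
    rw [← hsum.tsum_eq, tsum_eq_sum (s := Finset.range n)]
    · exact Finset.sum_congr rfl fun J _ => hPint J
    · intro J hJ
      rw [hPint J]
      simp [hfθ J (not_lt.1 fun h => hJ (Finset.mem_range.2 h))]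
  have hvaln : ∀ k, ∫ z, f z ∂(m k) = ∑ J ∈ Finset.range n, ∫ z, θ J z * f z
      ∂((m k).withDensity fun z => ((c (J + 1) z).toNNReal : ENNReal)) := by
    intro k
    simp only [integral_withDensity_toNNReal _ (hcm _) (fun z => (hc01 _ z).1)]
    have h1 : ∀ (J : ℕ) z, c (J + 1) z * (θ J z * f z) = θ J z * f z := fun J z => by
      rcases le_total (dist z z₀) (J + 1) with hz | hz
      · rw [hc1 _ z hz, one_mul]
      · rw [hθ_far J z hz, zero_mul, mul_zero]
    simp only [h1]
    rw [← integral_finsetSum]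
    · refine integral_congr_ae (ae_of_all _ fun z => ?_)
      simp only [← Finset.sum_mul, hθsum]
      by_cases hz : f z = 0
      · rw [hz, mul_zero]
      · rw [hc1 _ z (by linarith [hfr z hz]), one_mul]
    · exact fun J _ => hint _ (hm k r) ((hθm J).mul hfm) (fun z => ⟨mul_nonneg (hθ0 J z) (hf z).1,
        mul_le_one₀ (hθ1 J z) (hf z).1 (hf z).2⟩) fun z hz => hfr z (right_ne_zero_of_mul hz)
  rw [hval]
  simp only [hvaln]
  refine tendsto_finsetSum _ fun J _ => ?_
  exact (FiniteMeasure.tendsto_iff_forall_integral_tendsto.1 (hκ (J + 1)))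
    (BoundedContinuousFunction.ofNormedAddCommGroup _ ((hθc J).mul hfc) 1 fun z => by
      change |θ J z * f z| ≤ 1
      rw [abs_of_nonneg (mul_nonneg (hθ0 J z) (hf z).1)]
      exact mul_le_one₀ (hθ1 J z) (hf z).1 (hf z).2)

end

namespace MMSpace

/-! ### Completeness -/

/-- The data of a common complete extension of a sequence of spaces in which the restrictions of
consecutive spaces to large balls are exponentially close. -/
structure ControlledEmbedding (X : ℕ → MMSpace) (Z : Type) [MetricSpace Z] where
  embed : ∀ n, (X n).carrier → Z
  isometry : ∀ n, Isometry (embed n)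
  radius : ℕ → ℝ
  le_radius : ∀ n : ℕ, n ≤ radius n
  dist_root : ∀ n, dist (embed n (X n).root) (embed (n + 1) (X (n + 1)).root) ≤ (1 / 2) ^ n
  close : ∀ n, ∃ a, 0 ≤ a ∧ a ≤ (1 / 2) ^ n ∧
    ProhorovClose ((X n).measure.restrict (Metric.closedBall (X n).root (radius n)))
      ((X (n + 1)).measure.restrict (Metric.closedBall (X (n + 1)).root (radius n)))
      (fun x y => dist (embed n x) (embed (n + 1) y)) a

namespace ControlledEmbedding

variable {X : ℕ → MMSpace} {Z : Type} [MetricSpace Z]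

theorem exists_limit_root [CompleteSpace Z] (E : ControlledEmbedding X Z) :
    ∃ z, ∀ n, dist (E.embed n (X n).root) z ≤ 2 * (1 / 2) ^ n := by
  have h : ∀ n, dist (E.embed n (X n).root) (E.embed (n + 1) (X (n + 1)).root) ≤
      2 / 2 / 2 ^ n := fun n => (E.dist_root n).trans_eq (by rw [div_self two_ne_zero, one_div_pow])
  obtain ⟨z, hz⟩ := cauchySeq_tendsto_of_complete (cauchySeq_of_le_geometric_two h)
  refine ⟨z, fun n => (dist_le_of_le_geometric_two_of_tendsto h hz n).trans_eq ?_⟩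
  rw [one_div_pow]; ring

theorem half_pow_le_one (n : ℕ) : (1 / 2 : ℝ) ^ n ≤ 1 := pow_le_one₀ (by norm_num) (by norm_num)

section

variable [MeasurableSpace Z] [BorelSpace Z]

theorem integral_map_eq (E : ControlledEmbedding X Z) {z₀ : Z}
    (hz : ∀ n, dist (E.embed n (X n).root) z₀ ≤ 2 * (1 / 2) ^ n) (n : ℕ) {f : Z → ℝ}
    (hfc : Continuous f) {r R : ℝ} (hfr : ∀ z, f z ≠ 0 → dist z z₀ ≤ r) (hR : r + 2 ≤ R) :
    ∫ z, f z ∂((X n).measure.map (E.embed n)) =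
      ∫ x, f (E.embed n x) ∂((X n).measure.restrict (Metric.closedBall (X n).root R)) := by
  rw [integral_map (E.isometry n).continuous.measurable.aemeasurable hfc.aestronglyMeasurable]
  refine (setIntegral_eq_integral_of_forall_compl_eq_zero fun x hx => ?_).symm
  by_contra hne
  refine hx ?_
  rw [Metric.mem_closedBall, ← (E.isometry n).dist_eq]
  have h1 := dist_triangle_right (E.embed n x) (E.embed n (X n).root) z₀
  linarith [hfr _ hne, hz n, half_pow_le_one n]

theorem abs_integral_sub_succ_le (E : ControlledEmbedding X Z) {z₀ : Z}
    (hz : ∀ n, dist (E.embed n (X n).root) z₀ ≤ 2 * (1 / 2) ^ n) (n : ℕ) {f : Z → ℝ} {L r M : ℝ}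
    (hL : 0 ≤ L) (hf : ∀ z, 0 ≤ f z ∧ f z ≤ 1) (hfL : ∀ z z', |f z - f z'| ≤ L * dist z z')
    (hfr : ∀ z, f z ≠ 0 → dist z z₀ ≤ r) (hn : r + 2 ≤ n)
    (hM : ∀ p, n ≤ p → (X p).ballMass (r + 4) ≤ M) :
    |∫ z, f z ∂((X n).measure.map (E.embed n)) -
      ∫ z, f z ∂((X (n + 1)).measure.map (E.embed (n + 1)))| ≤ (L * M + 1) * (1 / 2) ^ n := by
  have hfc := continuous_of_lipschitz hfL
  have hR := hn.trans (E.le_radius n)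
  rw [E.integral_map_eq hz n hfc hfr hR, E.integral_map_eq hz (n + 1) hfc hfr hR]
  obtain ⟨a, ha, hah, hP⟩ := E.close n
  set μ := (X n).measure.restrict (Metric.closedBall (X n).root (E.radius n))
  set ν := (X (n + 1)).measure.restrict (Metric.closedBall (X (n + 1)).root (E.radius n))
  -- points that are close to the support of the function lie in a fixed ball
  have hfar : ∀ p x z, f z ≠ 0 → dist z (E.embed p x) < a →
      x ∈ Metric.closedBall (X p).root (r + 4) := fun p x z hne hlt => by
    rw [Metric.mem_closedBall, ← (E.isometry p).dist_eq]
    have h1 := dist_triangle_right (E.embed p x) (E.embed p (X p).root) z₀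
    have h2 := dist_triangle_left (E.embed p x) z₀ z
    linarith [hfr _ hne, hz p, half_pow_le_one p, half_pow_le_one n]
  have hmass : ∀ p, n ≤ p → ∀ R,
      ((X p).measure.restrict (Metric.closedBall (X p).root R)).real
        (Metric.closedBall (X p).root (r + 4)) ≤ M := fun p hp R => by
    refine le_trans ?_ (hM p hp)
    exact ENNReal.toReal_mono ((X p).measure_closedBall_ne_top _) (Measure.restrict_apply_le _ _)
  have hbound : ∀ t, 0 ≤ t → t ≤ M → (L * t + 1) * a ≤ (L * M + 1) * (1 / 2) ^ n := by
    intro t ht0 ht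
    have : L * t ≤ L * M := mul_le_mul_of_nonneg_left ht hL
    exact mul_le_mul (by linarith) hah ha (by nlinarith)
  have hm : ∀ p, Measurable fun x => f (E.embed p x) := fun p =>
    (hfc.comp (E.isometry p).continuous).measurable
  have h1 := hP.integral_le ha (hm n) (hm (n + 1)) (fun x => hf _) (fun y => hf _) hL
    (fun x y => hfL _ _) Metric.isClosed_closedBall.measurableSet
    fun x y hne hlt => hfar (n + 1) y _ hne hlt
  have h2 := hP.symm.integral_le ha (hm (n + 1)) (hm n) (fun x => hf _) (fun y => hf _) hL
    (fun x y => by rw [abs_sub_comm]; exact hfL _ _) Metric.isClosed_closedBall.measurableSet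
    fun x y hne hlt => hfar n y _ hne (by rw [dist_comm]; exact hlt)
  have h3 := hbound _ measureReal_nonneg (hmass (n + 1) (Nat.le_succ n) (E.radius n))
  have h4 := hbound _ measureReal_nonneg (hmass n le_rfl (E.radius n))
  rw [abs_le]
  constructor <;> linarith

theorem abs_integral_sub_le (E : ControlledEmbedding X Z) {z₀ : Z}
    (hz : ∀ n, dist (E.embed n (X n).root) z₀ ≤ 2 * (1 / 2) ^ n) {n p : ℕ} (hp : n ≤ p)
    {f : Z → ℝ} {L r M : ℝ} (hL : 0 ≤ L) (hf : ∀ z, 0 ≤ f z ∧ f z ≤ 1)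
    (hfL : ∀ z z', |f z - f z'| ≤ L * dist z z') (hfr : ∀ z, f z ≠ 0 → dist z z₀ ≤ r)
    (hn : r + 2 ≤ n) (hM : ∀ p, n ≤ p → (X p).ballMass (r + 4) ≤ M) :
    |∫ z, f z ∂((X n).measure.map (E.embed n)) - ∫ z, f z ∂((X p).measure.map (E.embed p))| ≤
      2 * (L * M + 1) * (1 / 2) ^ n := by
  have hM0 : 0 ≤ M := ((X n).ballMass_nonneg _).trans (hM n le_rfl)
  have key : |∫ z, f z ∂((X n).measure.map (E.embed n)) -
      ∫ z, f z ∂((X p).measure.map (E.embed p))| ≤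
      2 * (L * M + 1) * ((1 / 2) ^ n - (1 / 2) ^ p) := by
    induction p, hp using Nat.le_induction with
    | base => simp
    | succ p hp ih =>
      have h1 := E.abs_integral_sub_succ_le hz p hL hf hfL hfr
        (hn.trans (by exact_mod_cast hp)) fun q hq => hM q (hp.trans hq)
      refine (abs_sub_le _ (∫ z, f z ∂((X p).measure.map (E.embed p))) _).trans
        ((add_le_add ih h1).trans_eq ?_)
      rw [pow_succ]; ring
  refine key.trans ?_
  have : (0 : ℝ) ≤ (1 / 2) ^ p := by positivity
  have h2 : 0 ≤ 2 * (L * M + 1) := by positivity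
  nlinarith

variable [CompleteSpace Z] [SecondCountableTopology Z]

theorem exists_testConvergence (E : ControlledEmbedding X Z)
    (hmass : ∀ r, ∃ (M : ℝ) (N : ℕ), ∀ n, N ≤ n → (X n).ballMass r ≤ M) :
    ∃ Y : MMSpace, TestConvergence X Y := by
  obtain ⟨z₀, hz⟩ := E.exists_limit_root
  set m : ℕ → Measure Z := fun n => (X n).measure.map (E.embed n) with hmdef
  have hem : ∀ n, Measurable (E.embed n) := fun n => (E.isometry n).continuous.measurable
  have hm : ∀ n r, m n (Metric.closedBall z₀ r) ≠ ⊤ := fun n r => by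
    rw [Measure.map_apply (hem n) Metric.isClosed_closedBall.measurableSet]
    refine ne_top_of_le_ne_top ((X n).measure_closedBall_ne_top (r + 2)) (measure_mono ?_)
    intro x hx
    rw [Set.mem_preimage, Metric.mem_closedBall] at hx
    rw [Metric.mem_closedBall, ← (E.isometry n).dist_eq]
    linarith [dist_triangle_right (E.embed n x) (E.embed n (X n).root) z₀, hz n, half_pow_le_one n]
  have hhalf : Tendsto (fun n : ℕ => (1 / 2 : ℝ) ^ n) atTop (𝓝 0) :=
    tendsto_pow_atTop_nhds_zero_of_lt_one (by norm_num) (by norm_num)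
  -- the uniform Cauchy property
  have hunif : ∀ L r : ℝ, 0 ≤ L → ∃ (C : ℝ) (N : ℕ), ∀ n p, N ≤ n → n ≤ p → ∀ f : Z → ℝ,
      (∀ z, 0 ≤ f z ∧ f z ≤ 1) → (∀ z z', |f z - f z'| ≤ L * dist z z') →
      (∀ z, f z ≠ 0 → dist z z₀ ≤ r) →
      |∫ z, f z ∂(m n) - ∫ z, f z ∂(m p)| ≤ C * (1 / 2) ^ n := by
    intro L r hL
    obtain ⟨M, N, hMN⟩ := hmass (r + 4)
    obtain ⟨N', hN'⟩ := exists_nat_ge (r + 2)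
    refine ⟨2 * (L * M + 1), max N N', fun n p hn hp f hf hfL hfr => ?_⟩
    exact E.abs_integral_sub_le hz hp hL hf hfL hfr
      (hN'.trans (by exact_mod_cast (le_max_right N N').trans hn))
      fun q hq => hMN q ((le_max_left N N').trans (hn.trans hq))
  obtain ⟨m', hm', hlim⟩ := exists_limit_measure z₀ m hm (fun L r ε hε => by
    obtain ⟨C, N, hN⟩ := hunif |L| r (abs_nonneg L)
    have h1 : ∀ᶠ n in atTop, C * (1 / 2) ^ n < ε := by
      have := hhalf.const_mul C
      rw [mul_zero] at this
      exact this.eventually_lt_const hε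
    obtain ⟨n₀, hn₀, hn₀'⟩ := ((eventually_ge_atTop N).and h1).exists
    refine ⟨n₀, fun n hn f hf hfL hfr => ?_⟩
    rw [abs_sub_comm]
    exact (hN n₀ n hn₀ hn f hf (fun z z' => (hfL z z').trans
      (mul_le_mul_of_nonneg_right (le_abs_self L) dist_nonneg)) hfr).trans hn₀'.le)
  let Y : MMSpace :=
    { carrier := Z
      root := z₀
      measure := m'
      boundedlyFinite := fun s hs => by
        obtain ⟨r, hr⟩ := (Metric.isBounded_iff_subset_closedBall z₀).1 hs
        exact (measure_mono hr).trans_lt (lt_top_iff_ne_top.2 (hm' r)) }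
  refine ⟨Y, fun k F L R hF hFL hFR => ?_⟩
  have hFL' : ∀ a b, |F a - F b| ≤ |L| * dist a b := fun a b =>
    (hFL a b).trans (mul_le_mul_of_nonneg_right (le_abs_self L) dist_nonneg)
  have hFm : Measurable F := (continuous_of_lipschitz hFL).measurable
  obtain ⟨C, N, hCN⟩ := hunif |L| (R + 2) (abs_nonneg L)
  obtain ⟨M₀, N₀, hM₀⟩ := hmass (R + 4)
  set M := max (max M₀ (Y.ballMass (R + 4))) 1 with hM
  have hbound : ∀ n, max N N₀ ≤ n → |(X n).testIntegral k F - Y.testIntegral k F| ≤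
      k * M ^ k * (C * (1 / 2) ^ n) + |L| * (2 * (1 / 2) ^ n) * M ^ k := by
    intro n hn
    set μ := (X n).measure.restrict (Metric.closedBall (X n).root (R + 4)) with hμ
    set ν : Measure Z := m'.restrict (Metric.closedBall z₀ (R + 4)) with hν
    have hνfin : IsFiniteMeasure ν := isFiniteMeasure_restrict.2 (hm' _)
    have hμM : (μ.map (E.embed n)).real Set.univ ≤ M := by
      rw [measureReal_def, Measure.map_apply (hem n) MeasurableSet.univ, Set.preimage_univ,
        ← measureReal_def, hμ, measureReal_restrict_apply_univ]
      exact (hM₀ n ((le_max_right _ _).trans hn)).trans ((le_max_left _ _).trans (le_max_left _ _))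
    have hνM : ν.real Set.univ ≤ M := by
      rw [hν, measureReal_restrict_apply_univ]
      exact (le_max_right _ _).trans (le_max_left _ _)
    have key := abs_integral_distMat_sub_le (E.embed n (X n).root) z₀ {z | dist z z₀ ≤ R + 2}
      (μ.map (E.embed n)) ν (η := C * (1 / 2) ^ n) (L := |L|) (le_max_right _ _) hμM hνM
      (fun f hfm hf hfL hfr => ?_) k F hF (abs_nonneg L) hFL' fun u hu i => ?_
    · rw [integral_distMat_map (E.isometry n) (hem n) μ _ hFm, hμ,
        ← testIntegral_eq_restrict (X n) (R := R + 4) fun a ha i =>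
          (hFR a ha i).trans (by linarith)]
        at key
      have hY : Y.testIntegral k F = ∫ u : Fin k → Z, F (distMat (Fin.cons z₀ u))
          ∂(Measure.pi fun _ => ν) :=
        testIntegral_eq_restrict Y (R := R + 4) fun a ha i => (hFR a ha i).trans (by linarith)
      rw [hY]
      refine key.trans (add_le_add le_rfl ?_)
      refine mul_le_mul_of_nonneg_right (mul_le_mul_of_nonneg_left (hz n) (abs_nonneg L)) ?_
      exact pow_nonneg (zero_le_one.trans (le_max_right _ _)) k
    · have hfc := continuous_of_lipschitz hfL
      have h1 : ∫ z, f z ∂(μ.map (E.embed n)) = ∫ z, f z ∂(m n) := by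
        rw [integral_map (hem n).aemeasurable hfc.aestronglyMeasurable]
        exact (E.integral_map_eq hz n hfc hfr (by linarith)).symm
      have h2 : ∫ z, f z ∂ν = ∫ z, f z ∂m' := by
        refine setIntegral_eq_integral_of_forall_compl_eq_zero fun z hz => ?_
        by_contra hne
        exact hz (Metric.mem_closedBall.2 ((hfr z hne).trans (by linarith)))
      rw [h1, h2]
      refine le_of_tendsto ((tendsto_const_nhds.sub (hlim f |L| (R + 2) hf hfL hfr)).abs) ?_
      filter_upwards [eventually_ge_atTop n] with p hp
      exact hCN n p ((le_max_left _ _).trans hn) hp f hf hfL hfr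
    · have h1 := hFR _ hu i.succ
      simp only [distMat, Fin.cons_zero, Fin.cons_succ] at h1
      have h2 := dist_triangle_left (u i) z₀ (E.embed n (X n).root)
      change dist (u i) z₀ ≤ R + 2
      linarith [hz n, half_pow_le_one n]
  rw [tendsto_iff_dist_tendsto_zero]
  have hlim0 : Tendsto (fun n : ℕ => k * M ^ k * (C * (1 / 2) ^ n) +
      |L| * (2 * (1 / 2) ^ n) * M ^ k) atTop (𝓝 0) := by
    have := ((hhalf.const_mul C).const_mul (k * M ^ k)).add
      (((hhalf.const_mul 2).const_mul |L|).mul_const (M ^ k))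
    simpa using this
  refine squeeze_zero' (Eventually.of_forall fun n => dist_nonneg) ?_ hlim0
  filter_upwards [eventually_ge_atTop (max N N₀)] with n hn
  rw [Real.dist_eq]
  exact hbound n hn

end

end ControlledEmbedding

/-- The quantitative Cauchy condition that the completeness proof requires. -/
noncomputable def cauchyScale (n : ℕ) : ℝ := Real.exp (-((n : ℝ) + 1)) * (1 / 2) ^ n

theorem cauchyScale_pos (n : ℕ) : 0 < cauchyScale n := by
  unfold cauchyScale; positivity

theorem exists_controlledEmbedding {X : ℕ → MMSpace}
    (h : ∀ n, localizedGromovProhorovDist (X n) (X (n + 1)) < cauchyScale n) :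
    ∃ (Z : Type) (_ : MetricSpace Z) (_ : CompleteSpace Z) (_ : TopologicalSpace.SeparableSpace Z),
      Nonempty (ControlledEmbedding X Z) := by
  have h1 : ∀ n, ∃ (R : ℝ) (D : (X n).carrier → (X (n + 1)).carrier → ℝ) (a : ℝ), n ≤ R ∧
      IsCross D ∧ 0 < a ∧ ProhorovClose
        ((X n).measure.restrict (Metric.closedBall (X n).root R))
        ((X (n + 1)).measure.restrict (Metric.closedBall (X (n + 1)).root R)) D a ∧
      D (X n).root (X (n + 1)).root + a < (1 / 2) ^ n := fun n => by
    obtain ⟨R, hR, hgp⟩ := exists_gromovProhorovDist_restrict_lt (Nat.cast_nonneg n)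
      (ControlledEmbedding.half_pow_le_one n) (h n)
    obtain ⟨D, a, hD, ha, hP, hc⟩ := exists_cross_restrict_of_gromovProhorovDist_lt hgp
    exact ⟨R, D, a, hR.1, hD, ha, hP, hc⟩
  choose R D a hR hD ha hP hc using h1
  set δ : ℕ → ℝ := fun n => (1 / 2) ^ n - (D n (X n).root (X (n + 1)).root + a n) with hδ
  have hδ0 : ∀ n, 0 < δ n := fun n => sub_pos.2 (hc n)
  let d : ∀ n, SumMetric (X n) (X (n + 1)) := fun n =>
    sumMetricOfCross ((hD n).add_const (hδ0 n).le) fun x y =>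
      add_pos_of_nonneg_of_pos ((hD n).nonneg x y) (hδ0 n)
  obtain ⟨Z, i1, i2, i3, Φ, hΦ, hΦd⟩ := exists_common_extension X d
  have hcross : ∀ n x y, dist (Φ n x) (Φ (n + 1) y) = D n x y + δ n := hΦd
  refine ⟨Z, i1, i2, i3, ⟨
    { embed := Φ, isometry := hΦ, radius := R, le_radius := hR, dist_root := ?_, close := ?_ }⟩⟩
  · intro n
    rw [hcross]
    simp only [hδ]
    linarith [ha n]
  · intro n
    have hD0 := (hD n).nonneg (X n).root (X (n + 1)).root
    refine ⟨a n + δ n, (add_pos (ha n) (hδ0 n)).le, ?_,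
      (hP n).mono (fun x y hxy => ?_) (le_add_of_nonneg_right (hδ0 n).le)⟩
    · simp only [hδ]; linarith
    · rw [hcross]; linarith

/-- Every sequence that is Cauchy at a sufficient speed has a Gromov-vague limit. -/
theorem exists_gromovVagueTendsto_of_cauchy {X : ℕ → MMSpace}
    (h : ∀ N n m, N ≤ n → N ≤ m → localizedGromovProhorovDist (X n) (X m) < cauchyScale N) :
    ∃ Y : MMSpace, GromovVagueTendsto X Y := by
  obtain ⟨Z, i1, i2, i3, ⟨E⟩⟩ := exists_controlledEmbedding fun n =>
    h n n (n + 1) le_rfl (Nat.le_succ n)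
  let _ : MeasurableSpace Z := _root_.borel Z
  have : BorelSpace Z := ⟨rfl⟩
  have : SecondCountableTopology Z := UniformSpace.secondCountable_of_separable Z
  obtain ⟨Y, hY⟩ := E.exists_testConvergence fun r => by
    obtain ⟨N, hN⟩ := exists_nat_ge r
    refine ⟨(X N).ballMass (N + 1) + 1, N, fun n hn => ?_⟩
    obtain ⟨R, hR, hgp⟩ := exists_gromovProhorovDist_restrict_lt (Nat.cast_nonneg N)
      (ControlledEmbedding.half_pow_le_one N) (h N n N hn le_rfl)
    have h1 := (abs_lt.1 (abs_ballMass_sub_lt hgp)).2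
    have h2 := (X n).ballMass_mono (hN.trans hR.1)
    have h3 := (X N).ballMass_mono hR.2
    linarith [ControlledEmbedding.half_pow_le_one N]
  exact ⟨Y, hY.gromovVagueTendsto⟩

/-! ### A countable family of test integrals that determines convergence -/

/-- The cutoff function of a distance matrix at radius `R` around the root. -/
noncomputable def rootCutoff (k : ℕ) (R : ℝ) (a : Fin (k + 1) → Fin (k + 1) → ℝ) : ℝ :=
  cutoff R 1 ‖a 0‖

theorem rootCutoff_mem (k : ℕ) (R : ℝ) (a : Fin (k + 1) → Fin (k + 1) → ℝ) :
    0 ≤ rootCutoff k R a ∧ rootCutoff k R a ≤ 1 := cutoff_mem _ _ _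

theorem abs_rootCutoff_sub_le (k : ℕ) (R : ℝ) (a b : Fin (k + 1) → Fin (k + 1) → ℝ) :
    |rootCutoff k R a - rootCutoff k R b| ≤ 1 * dist a b := by
  refine (abs_cutoff_sub_le one_pos _ _).trans ?_
  rw [one_div_one]
  refine mul_le_mul_of_nonneg_left ((abs_norm_sub_norm_le _ _).trans ?_) zero_le_one
  rw [← dist_eq_norm]
  exact dist_le_pi_dist a b 0

theorem le_of_rootCutoff_ne_zero {k : ℕ} {R : ℝ} {a : Fin (k + 1) → Fin (k + 1) → ℝ}
    (h : rootCutoff k R a ≠ 0) (i : Fin (k + 1)) : a 0 i ≤ R + 1 := by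
  by_contra! hlt
  exact h (cutoff_eq_zero one_pos
    (hlt.le.trans ((le_abs_self _).trans (norm_le_pi_norm (a 0) i))))

/-- A compact set of matrices that contains the distance matrices of points within distance `R + 1`
of the root. -/
def matrixBox (k : ℕ) (R : ℝ) : Set (Fin (k + 1) → Fin (k + 1) → ℝ) :=
  Set.Icc (fun _ _ => 0) (fun _ _ => 2 * (R + 1))

theorem distMat_mem_matrixBox {Z : Type*} [PseudoMetricSpace Z] {k : ℕ} {R : ℝ}
    {u : Fin (k + 1) → Z} (h : rootCutoff k R (distMat u) ≠ 0) : distMat u ∈ matrixBox k R := by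
  refine ⟨fun i j => dist_nonneg, fun i j => ?_⟩
  have h1 : ∀ i, dist (u 0) (u i) ≤ R + 1 := le_of_rootCutoff_ne_zero h
  change dist (u i) (u j) ≤ 2 * (R + 1)
  linarith [dist_triangle_left (u i) (u j) (u 0), h1 i, h1 j]

/-- The Lipschitz functions of a distance matrix with values in `[0, 1]`. -/
def IsTest (k : ℕ) (F : (Fin (k + 1) → Fin (k + 1) → ℝ) → ℝ) : Prop :=
  (∀ a, 0 ≤ F a ∧ F a ≤ 1) ∧ ∃ L : ℝ, ∀ a b, |F a - F b| ≤ L * dist a b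

theorem IsTest.continuous {k : ℕ} {F : (Fin (k + 1) → Fin (k + 1) → ℝ) → ℝ} (h : IsTest k F) :
    Continuous F := by
  obtain ⟨L, hL⟩ := h.2
  exact continuous_of_lipschitz hL

theorem exists_countable_dense_test (k : ℕ) (R : ℝ) :
    ∃ T : Set ((Fin (k + 1) → Fin (k + 1) → ℝ) → ℝ), T.Countable ∧ (∀ F ∈ T, IsTest k F) ∧
      ∀ F, IsTest k F → ∀ ε, 0 < ε → ∃ G ∈ T, ∀ a ∈ matrixBox k R, |F a - G a| ≤ ε := by
  have : CompactSpace (matrixBox k R) := isCompact_iff_compactSpace.1 isCompact_Icc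
  let res : {F // IsTest k F} → C(matrixBox k R, ℝ) := fun F =>
    ⟨fun a => F.1 a, F.2.continuous.comp continuous_subtype_val⟩
  obtain ⟨c, hc, hcc, hdense⟩ :=
    (TopologicalSpace.IsSeparable.of_separableSpace (Set.range res)).exists_countable_dense_subset
  have : Nonempty {F // IsTest k F} := ⟨⟨fun _ => 0, fun _ => by simp, 0, fun _ _ => by simp⟩⟩
  choose! g hg using fun φ (hφ : φ ∈ c) => hc hφ
  refine ⟨(fun φ => (g φ).1) '' c, hcc.image _, ?_, fun F hF ε hε => ?_⟩
  · rintro _ ⟨φ, -, rfl⟩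
    exact (g φ).2
  · obtain ⟨φ, hφ, hd⟩ := Metric.mem_closure_iff.1 (hdense ⟨⟨F, hF⟩, rfl⟩) ε hε
    refine ⟨_, ⟨φ, hφ, rfl⟩, fun a ha => ?_⟩
    have h1 := (ContinuousMap.dist_le hε.le).1 hd.le ⟨a, ha⟩
    rw [← hg φ hφ] at h1
    exact h1

theorem TestConvergence.mul_rootCutoff {X : ℕ → MMSpace} {Y : MMSpace} (h : TestConvergence X Y)
    {k : ℕ} {F : (Fin (k + 1) → Fin (k + 1) → ℝ) → ℝ} (hF : IsTest k F) (R : ℝ) :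
    Tendsto (fun n => (X n).testIntegral k fun a => F a * rootCutoff k R a) atTop
      (𝓝 (Y.testIntegral k fun a => F a * rootCutoff k R a)) := by
  obtain ⟨hF01, L, hL⟩ := hF
  refine h k _ (L + 1) (R + 1) (fun a => ⟨mul_nonneg (hF01 a).1 (rootCutoff_mem _ _ _).1,
    mul_le_one₀ (hF01 a).2 (rootCutoff_mem _ _ _).1 (rootCutoff_mem _ _ _).2⟩) (fun a b => ?_)
    fun a ha i => le_of_rootCutoff_ne_zero (right_ne_zero_of_mul ha) i
  rw [add_mul]
  exact (abs_mul_sub_mul_le (rootCutoff_mem _ _ _) (hF01 b)).trans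
    (add_le_add (hL a b) (abs_rootCutoff_sub_le k R a b))

theorem abs_testIntegral_mul_rootCutoff_sub_le (X : MMSpace) {k : ℕ} {R ε : ℝ}
    {F G : (Fin (k + 1) → Fin (k + 1) → ℝ) → ℝ} (hF : IsTest k F) (hG : IsTest k G)
    (h : ∀ a ∈ matrixBox k R, |F a - G a| ≤ ε) :
    |X.testIntegral k (fun a => F a * rootCutoff k R a) -
      X.testIntegral k (fun a => G a * rootCutoff k R a)| ≤
      ε * X.testIntegral k (fun a => rootCutoff k R a) := by
  have hc : Continuous (rootCutoff k R) := continuous_of_lipschitz (abs_rootCutoff_sub_le k R)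
  have hsupp : ∀ H : (Fin (k + 1) → Fin (k + 1) → ℝ) → ℝ, ∀ a, H a * rootCutoff k R a ≠ 0 →
      ∀ i, a 0 i ≤ R + 1 := fun H a ha i => le_of_rootCutoff_ne_zero (right_ne_zero_of_mul ha) i
  rw [testIntegral_eq_restrict X (hsupp F), testIntegral_eq_restrict X (hsupp G),
    testIntegral_eq_restrict X fun a ha i => le_of_rootCutoff_ne_zero ha i]
  have hdm : Measurable fun x : Fin k → X.carrier => distMat (Fin.cons X.root x) :=
    measurable_distMat.comp (measurable_finCons _)
  have hi : ∀ H, IsTest k H → Integrable (fun x : Fin k → X.carrier =>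
      H (distMat (Fin.cons X.root x)) * rootCutoff k R (distMat (Fin.cons X.root x)))
      (Measure.pi fun _ => X.measure.restrict (Metric.closedBall X.root (R + 1))) := fun H hH =>
    integrable_of_mem_Icc ((hH.continuous.mul hc).measurable.comp hdm) fun x =>
      ⟨mul_nonneg (hH.1 _).1 (rootCutoff_mem _ _ _).1,
        mul_le_one₀ (hH.1 _).2 (rootCutoff_mem _ _ _).1 (rootCutoff_mem _ _ _).2⟩
  rw [← integral_sub (hi F hF) (hi G hG), ← integral_const_mul]
  refine (abs_integral_le_integral_abs).trans (integral_mono ((hi F hF).sub (hi G hG)).abs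
    ((integrable_of_mem_Icc (hc.measurable.comp hdm) fun x => rootCutoff_mem _ _ _).const_mul ε)
    fun x => ?_)
  change |_ * _ - _ * _| ≤ ε * _
  rw [← sub_mul, abs_mul, abs_of_nonneg (rootCutoff_mem _ _ _).1]
  by_cases hx : rootCutoff k R (distMat (Fin.cons X.root x)) = 0
  · rw [hx, mul_zero, mul_zero]
  · exact mul_le_mul_of_nonneg_right (h _ (distMat_mem_matrixBox hx)) (rootCutoff_mem _ _ _).1

/-- Convergence of the test integrals of a countable dense family suffices. The total masses are
bounded since the constant function `1` is approximated as well. -/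
theorem testConvergence_of_dense {T : ∀ k : ℕ, ℕ → Set ((Fin (k + 1) → Fin (k + 1) → ℝ) → ℝ)}
    (hT : ∀ k R, ∀ F ∈ T k R, IsTest k F)
    (hdense : ∀ k R F, IsTest k F → ∀ ε, 0 < ε → ∃ G ∈ T k R,
      ∀ a ∈ matrixBox k (R : ℕ), |F a - G a| ≤ ε)
    {X : ℕ → MMSpace} {Y : MMSpace} (h : ∀ k R, ∀ F ∈ T k R,
      Tendsto (fun n => (X n).testIntegral k fun a => F a * rootCutoff k R a) atTop
      (𝓝 (Y.testIntegral k fun a => F a * rootCutoff k R a))) :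
    TestConvergence X Y := by
  intro k F L R₀ hF01 hFL hFR
  obtain ⟨R, hR⟩ := exists_nat_ge (max R₀ 0)
  have hF : IsTest k F := ⟨hF01, L, hFL⟩
  have hone : IsTest k fun _ => 1 := ⟨fun _ => by simp, 0, fun _ _ => by simp⟩
  -- the cutoff does not change the integral of `F`
  have hFint : ∀ Z : MMSpace, Z.testIntegral k F =
      Z.testIntegral k fun a => F a * rootCutoff k R a := by
    intro Z
    unfold testIntegral
    refine integral_congr_ae (ae_of_all _ fun x => ?_)
    by_cases hx : F (distMat (Fin.cons Z.root x)) = 0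
    · simp only [hx, zero_mul]
    · have h1 : rootCutoff k R (distMat (Fin.cons Z.root x)) = 1 := by
        refine cutoff_eq_one one_pos ((pi_norm_le_iff_of_nonneg (Nat.cast_nonneg R)).2 fun i => ?_)
        have h2 : 0 ≤ distMat (Fin.cons Z.root x : Fin (k + 1) → Z.carrier) 0 i := dist_nonneg
        rw [Real.norm_of_nonneg h2]
        exact (hFR _ hx i).trans ((le_max_left _ _).trans hR)
      simp only [h1, mul_one]
  simp only [hFint]
  set I : MMSpace → ℝ := fun Z => Z.testIntegral k fun a => rootCutoff k R a with hI
  have hI0 : ∀ Z, 0 ≤ I Z := fun Z => integral_nonneg fun x => (rootCutoff_mem _ _ _).1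
  obtain ⟨G₁, hG₁, hG₁1⟩ := hdense k R _ hone (1 / 2) (by norm_num)
  have hIle : ∀ Z : MMSpace, I Z ≤ 2 * Z.testIntegral k fun a => G₁ a * rootCutoff k R a := by
    intro Z
    have h1 := (abs_le.1 (abs_testIntegral_mul_rootCutoff_sub_le Z hone (hT k R _ hG₁) hG₁1)).2
    simp only [one_mul] at h1
    change I Z - _ ≤ 1 / 2 * I Z at h1
    linarith
  obtain ⟨B, hB⟩ : ∃ B, ∀ᶠ n in atTop, I (X n) ≤ B := by
    refine ⟨2 * (Y.testIntegral k (fun a => G₁ a * rootCutoff k R a) + 1), ?_⟩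
    filter_upwards [(h k R _ hG₁).eventually_lt_const (lt_add_one _)] with n hn
    exact (hIle _).trans (by linarith)
  rw [Metric.tendsto_atTop']
  intro e he
  set C := max B (I Y) with hC
  have hC0 : 0 ≤ C := (hI0 Y).trans (le_max_right _ _)
  set ε := e / (3 * (C + 1)) with hε
  have hε0 : 0 < ε := by positivity
  have hεC : ε * C < e / 3 := by
    have : ε * (C + 1) = e / 3 := by rw [hε]; field_simp
    nlinarith
  obtain ⟨G, hG, hGF⟩ := hdense k R F hF ε hε0
  have herr : ∀ Z, I Z ≤ C → |Z.testIntegral k (fun a => F a * rootCutoff k R a) -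
      Z.testIntegral k (fun a => G a * rootCutoff k R a)| < e / 3 := fun Z hZ =>
    (abs_testIntegral_mul_rootCutoff_sub_le Z hF (hT k R _ hG) hGF).trans_lt
      ((mul_le_mul_of_nonneg_left hZ hε0.le).trans_lt hεC)
  have h1 := (Metric.tendsto_nhds.1 (h k R _ hG)) (e / 3) (by positivity)
  obtain ⟨N, hN⟩ := eventually_atTop.1 (h1.and hB)
  refine ⟨N, fun n hn => ?_⟩
  obtain ⟨h2, h3⟩ := hN n hn.le
  have h4 := abs_lt.1 (herr (X n) (h3.trans (le_max_left _ _)))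
  have h5 := abs_lt.1 (herr Y (le_max_right _ _))
  rw [Real.dist_eq, abs_lt] at h2
  rw [Real.dist_eq, abs_lt]
  constructor <;> linarith [h2.1, h2.2, h4.1, h4.2, h5.1, h5.2]

end MMSpace

/-! ### The metric on the space of equivalence classes -/

theorem MMSpace.localizedGromovProhorovDist_congr {X X' Y Y' : MMSpace} (hX : X.Equivalent X')
    (hY : Y.Equivalent Y') :
    X.localizedGromovProhorovDist Y = X'.localizedGromovProhorovDist Y' := by
  have key : ∀ {X X' Y Y' : MMSpace}, X.Equivalent X' → Y.Equivalent Y' →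
      X.localizedGromovProhorovDist Y ≤ X'.localizedGromovProhorovDist Y' := by
    intro X X' Y Y' hX hY
    have h1 := localizedGromovProhorovDist_eq_zero hX
    have h2 := localizedGromovProhorovDist_eq_zero hY
    rw [localizedGromovProhorovDist_comm] at h2
    have h3 := localizedGromovProhorovDist_triangle X X' Y
    have h4 := localizedGromovProhorovDist_triangle X' Y' Y
    linarith
  exact le_antisymm (key hX hY)
    (key (equivalent_equivalence.symm hX) (equivalent_equivalence.symm hY))

/-- The space of equivalence classes, to be equipped with the localized Gromov-Prohorov metric. It
is kept apart from `MMClass`, which already carries the Gromov-vague topology. -/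
def MetricClass : Type 1 := Quotient MMSpace.setoid

/-- The equivalence class of a space, as a point of the metric space. -/
def MMSpace.toMetricClass (X : MMSpace) : MetricClass := Quotient.mk MMSpace.setoid X

namespace MetricClass

noncomputable instance : MetricSpace MetricClass where
  dist := Quotient.lift₂ MMSpace.localizedGromovProhorovDist fun _ _ _ _ hX hY =>
    MMSpace.localizedGromovProhorovDist_congr hX hY
  dist_self x := by
    induction x using Quotient.inductionOn with
    | h X =>
      exact MMSpace.localizedGromovProhorovDist_eq_zero (MMSpace.equivalent_equivalence.refl X)
  dist_comm x y := by
    induction x, y using Quotient.inductionOn₂ with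
    | h X Y => exact MMSpace.localizedGromovProhorovDist_comm X Y
  dist_triangle x y z := by
    induction x, y, z using Quotient.inductionOn₃ with
    | h X Y Z => exact MMSpace.localizedGromovProhorovDist_triangle X Y Z
  eq_of_dist_eq_zero {x y} h := by
    induction x, y using Quotient.inductionOn₂ with
    | h X Y => exact Quotient.sound (MMSpace.equivalent_of_localizedGromovProhorovDist_eq_zero h)

/-- A representative. -/
noncomputable def rep (x : MetricClass) : MMSpace := Quotient.out x

theorem toMetricClass_rep (x : MetricClass) : x.rep.toMetricClass = x := Quotient.out_eq x

theorem tendsto_toMetricClass_iff (X : ℕ → MMSpace) (Y : MMSpace) :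
    Tendsto (fun n => (X n).toMetricClass) atTop (𝓝 Y.toMetricClass) ↔
      MMSpace.GromovVagueTendsto X Y := by
  rw [← MMSpace.tendsto_localizedGromovProhorovDist_iff, tendsto_iff_dist_tendsto_zero]
  rfl

theorem tendsto_iff (x : ℕ → MetricClass) (y : MetricClass) :
    Tendsto x atTop (𝓝 y) ↔ MMSpace.GromovVagueTendsto (fun n => (x n).rep) y.rep := by
  rw [← tendsto_toMetricClass_iff]
  simp only [toMetricClass_rep]

/-- Both topologies are sequential, with the same convergent sequences. -/
theorem topology_eq :
    (inferInstance : TopologicalSpace MetricClass) = gromovVagueTopology := by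
  refine TopologicalSpace.ext (funext fun U => propext ⟨fun hU X Y hXY hY => ?_, fun hU => ?_⟩)
  · have hU' : IsOpen (X := MetricClass) U := hU
    exact ((tendsto_toMetricClass_iff X Y).2 hXY).eventually_mem (hU'.mem_nhds hY)
  · have hU' : IsClosed (X := MetricClass) Uᶜ := by
      refine IsSeqClosed.isClosed fun x y hx hxy hy => ?_
      obtain ⟨n, hn⟩ := (hU _ _ ((tendsto_iff x y).1 hxy)
        (show y.rep.toMetricClass ∈ U by rwa [toMetricClass_rep])).exists
      change (x n).rep.toMetricClass ∈ U at hn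
      rw [toMetricClass_rep] at hn
      exact hx n hn
    exact isClosed_compl_iff.1 hU'

instance : CompleteSpace MetricClass := by
  refine Metric.complete_of_convergent_controlled_sequences MMSpace.cauchyScale
    MMSpace.cauchyScale_pos fun u hu => ?_
  have h1 : ∀ x y : MetricClass, dist x y = x.rep.localizedGromovProhorovDist y.rep := fun x y => by
    conv_lhs => rw [← toMetricClass_rep x, ← toMetricClass_rep y]
    rfl
  obtain ⟨Y, hY⟩ := MMSpace.exists_gromovVagueTendsto_of_cauchy (X := fun n => (u n).rep)
    fun N n m hn hm => by
      rw [← h1]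
      exact hu N n m hn hm
  refine ⟨Y.toMetricClass, ?_⟩
  simpa only [toMetricClass_rep] using (tendsto_toMetricClass_iff _ _).2 hY

/-- Countably many test integrals embed the space of equivalence classes into a countable product
of lines. -/
instance : SecondCountableTopology MetricClass := by
  choose T hTc hT hdense using fun (k R : ℕ) => MMSpace.exists_countable_dense_test k R
  have : ∀ k R, Countable (T k R) := fun k R => (hTc k R).to_subtype
  let ι := Σ k : ℕ, Σ R : ℕ, T k R
  let ev : MetricClass → ι → ℝ := fun x i =>
    x.rep.testIntegral i.1 fun a => i.2.2.1 a * MMSpace.rootCutoff i.1 i.2.1 a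
  have hseq : ∀ (x : ℕ → MetricClass) (y : MetricClass),
      Tendsto x atTop (𝓝 y) ↔ Tendsto (fun n => ev (x n)) atTop (𝓝 (ev y)) := by
    intro x y
    rw [tendsto_iff, tendsto_pi_nhds]
    constructor
    · rintro h ⟨k, R, F, hF⟩
      exact (MMSpace.testConvergence_of_localizedGromovProhorovDist
        h.tendsto_localizedGromovProhorovDist).mul_rootCutoff (hT k R F hF) R
    · intro h
      exact (MMSpace.testConvergence_of_dense hT hdense fun k R F hF =>
        h ⟨k, R, F, hF⟩).gromovVagueTendsto
  have hind : IsInducing ev := by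
    refine isInducing_iff_nhds.2 fun y => le_antisymm ?_ ?_
    · rw [← tendsto_iff_comap, tendsto_iff_seq_tendsto]
      exact fun x hx => (hseq x y).1 hx
    · rw [← tendsto_id', tendsto_iff_seq_tendsto]
      exact fun x hx => (hseq x y).2 (tendsto_comap_iff.1 hx)
  exact hind.secondCountableTopology

theorem polishSpace : PolishSpace MMClass := by
  rw [← topology_eq]
  exact (inferInstance : PolishSpace MetricClass)

end MetricClass
end GromovVague

theorem mainTheorem5 :
    -- the convergent sequences of the topology are exactly the Gromov-vaguely convergent ones
    (∀ (X : ℕ → GromovVague.MMSpace) (Y : GromovVague.MMSpace),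
      Tendsto (fun n => (X n).toClass) atTop (𝓝 Y.toClass) ↔
        GromovVague.MMSpace.GromovVagueTendsto X Y) ∧
    PolishSpace GromovVague.MMClass ∧
    -- the localized Gromov-Prohorov metric is well defined, complete, and induces the topology
    (∀ X Y : GromovVague.MMSpace,
      IntegrableOn (GromovVague.MMSpace.localizedIntegrand X Y) (Set.Ioi (0 : ℝ))) ∧
    ∃ d : MetricSpace GromovVague.MMClass,
      (∀ X Y : GromovVague.MMSpace,
        d.dist X.toClass Y.toClass = X.localizedGromovProhorovDist Y) ∧
      d.toUniformSpace.toTopologicalSpace = GromovVague.gromovVagueTopology ∧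
      @CompleteSpace GromovVague.MMClass d.toUniformSpace := by
  refine ⟨fun X Y => ?_, GromovVague.MetricClass.polishSpace,
    GromovVague.MMSpace.integrableOn_localizedIntegrand,
    (inferInstance : MetricSpace GromovVague.MetricClass), fun X Y => rfl,
    GromovVague.MetricClass.topology_eq,
    (inferInstance : CompleteSpace GromovVague.MetricClass)⟩
  rw [← GromovVague.MetricClass.tendsto_toMetricClass_iff, ← GromovVague.MetricClass.topology_eq]
  rfl
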